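/- **Setting.** A *topological structure* is a zero-dimensional compact metrizable space $A$ with two closed binary relations $R^A$ and $\le^A$. An *epimorphism* $\varphi\colon A\to B$ is a continuous surjection with $(\varphi\times\varphi)[R^A]=R^B$ and $(\varphi\times\varphi)[\le^A]=\ \le^B$; an *automorphism* of $A$ is a bijective epimorphism $A\to A$. Let $\mathcal F$ be the family of all finite nonempty structures $P$ such that $\le^P$ is a partial order, $a\mathrel{R^P}b$ holds iff $a=b$ or one of $a,b$ is an immediate $\le^P$-successor of the other, and $R^P$, as an undirected graph with loops removed, has no cycles (finite Hasse forests). A *projective Fraïssé limit* of $\mathcal F$ is a topological structure $\mathbb F$ such that 1. for every $A\in\mathcal F$ there is an epimorphism $\mathbb F\to A$; 2. for every covering $\mathcal U$ of $\mathbb F$ by clopen sets there are $A\in\mathcal F$ and an epimorphism $\varphi\colon\mathbb F\to A$ such that each $\varphi^{-1}(a)$, $a\in A$, is contained in a member of $\mathcal U$; 3. for all $A\in\mathcal F$ and epimorphisms $\varphi_1,\varphi_2\colon\mathbb F\to A$ there is an automorphism $\psi$ of $\mathbb F$ with $\varphi_2=\varphi_1\psi$. For such an $\mathbb F$, let $Y=\mathbb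 F/R^{\mathbb F}$ with the quotient topology (the *Fraïssé fence*), let $p\colon\mathbb F\to Y$ be the quotient map, and let $\le^Y=(p\times p)[\le^{\mathbb F}]$. Let $\mathfrak L$ and $\mathfrak U$ be the sets of $\le^Y$-minimal and of $\le^Y$-maximal points of $Y$, let $\mathfrak M=\mathfrak U\setminus\mathfrak L$, and let $\mathrm E(Y)$ be the set of endpoints of $Y$, i.e. of the points $x\in Y$ that are an end of every arc (homeomorphic copy of $[0,1]$) in $Y$ containing $x$. All these sets carry the subspace topology. A space $X$ is: *almost zero-dimensional* if each point has a neighbourhood basis of closed sets that are intersections of clopen sets; *cohesive* if each point has a neighbourhood containing no nonempty clopen subset of $X$; *totally separated* if the intersection of all clopen neighbourhoods of each point is a singleton; *homogeneous* if its homeomorphism group acts transitively; *$\tfrac12$-homogeneous* if its homeomorphism group has exactly two orbits on $X$; *strongly $\sigma$-complete* if it is a union of countably many closed, completely metrizable subspaces. Dimension is the (small) inductive dimension. **Theorem.** The family $\mathcal F$ has a projective Fraïssé limit. For every projective Fraïssé limit $\mathbb F$ of $\mathcal F$, the relation $R^{\mathbb F}$ is an equivalence relation, $\le^Y$ is a partial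 order on $Y$, and: (i) $\mathfrak L\cap\mathfrak U$ is homeomorphic to the Baire space $\mathbb N^{\mathbb N}$; (ii) $\mathrm E(Y)$ is Polish and not totally separated; (iii) $\mathfrak U$ is $\tfrac12$-homogeneous, Polish, almost zero-dimensional, one-dimensional and not cohesive; (iv) $\mathfrak M$ is homogeneous, strongly $\sigma$-complete, almost zero-dimensional, one-dimensional and not cohesive. -/

import Mathlib

open Topology TopologicalSpace

universe u v

namespace FraisseFence

/-! ### Topological structures in the language with two binary relation symbols `R` and `≤` -/

/-- A topological structure: a zero-dimensional compact metrizable space with closed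
interpretations `R` and `le` of the two binary relation symbols. -/
structure TopStructure where
  carrier : Type u
  [top : TopologicalSpace carrier]
  [compact : CompactSpace carrier]
  [metrizable : MetrizableSpace carrier]
  [zeroDim : HasSmallInductiveDimensionLE carrier 0]
  R : carrier → carrier → Prop
  le : carrier → carrier → Prop
  isClosed_R : IsClosed {x : carrier × carrier | R x.1 x.2}
  isClosed_le : IsClosed {x : carrier × carrier | le x.1 x.2}

instance : CoeSort TopStructure.{u} (Type u) := ⟨TopStructure.carrier⟩

attribute [instance] TopStructure.top TopStructure.compact TopStructure.metrizable
  TopStructure.zeroDim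

/-- An epimorphism: a continuous surjection carrying each relation of `A` onto that of `B`. -/
structure IsEpimorphism {A : TopStructure.{u}} {B : TopStructure.{v}} (φ : A → B) : Prop where
  continuous : Continuous φ
  surjective : Function.Surjective φ
  R_iff : ∀ b₁ b₂ : B, B.R b₁ b₂ ↔ ∃ a₁ a₂ : A, φ a₁ = b₁ ∧ φ a₂ = b₂ ∧ A.R a₁ a₂
  le_iff : ∀ b₁ b₂ : B, B.le b₁ b₂ ↔ ∃ a₁ a₂ : A, φ a₁ = b₁ ∧ φ a₂ = b₂ ∧ A.le a₁ a₂

/-- An automorphism: a bijective epimorphism of `A` onto itself. -/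
def IsAutomorphism {A : TopStructure.{u}} (ψ : A → A) : Prop :=
  IsEpimorphism ψ ∧ Function.Injective ψ

/-- `φ` refines the covering `𝒰`: the preimage of each point lies in a member of `𝒰`. -/
def Refines {A : TopStructure.{u}} {B : TopStructure.{v}} (φ : A → B) (𝒰 : Set (Set A)) : Prop :=
  ∀ b : B, ∃ V ∈ 𝒰, φ ⁻¹' {b} ⊆ V

/-- `𝔽` is a projective Fraïssé limit of the family `𝒢` of topological structures. -/
structure IsProjectiveFraisseLimit (𝒢 : TopStructure.{v} → Prop) (𝔽 : TopStructure.{u}) :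
    Prop where
  /-- projective universality -/
  universal : ∀ A : TopStructure.{v}, 𝒢 A → ∃ φ : 𝔽 → A, IsEpimorphism φ
  /-- every clopen covering is refined by an epimorphism onto a member of the family -/
  refine : ∀ 𝒰 : Set (Set 𝔽), (∀ V ∈ 𝒰, IsClopen V) → ⋃₀ 𝒰 = Set.univ →
    ∃ A : TopStructure.{v}, 𝒢 A ∧ ∃ φ : 𝔽 → A, IsEpimorphism φ ∧ Refines φ 𝒰
  /-- projective ultrahomogeneity -/
  ultrahomogeneous : ∀ A : TopStructure.{v}, 𝒢 A → ∀ φ₁ φ₂ : 𝔽 → A,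
    IsEpimorphism φ₁ → IsEpimorphism φ₂ → ∃ ψ : 𝔽 → 𝔽, IsAutomorphism ψ ∧ φ₂ = φ₁ ∘ ψ

/-! ### Finite Hasse forests -/

/-- `a ≤ b` and there is nothing strictly between them. -/
def TopStructure.NextOrEq (P : TopStructure.{u}) (a b : P) : Prop :=
  P.le a b ∧ ∀ c : P, P.le a c → P.le c b → c = a ∨ c = b

/-- A Hasse partial order: `le` is a partial order and `R` is its (reflexive, symmetric) Hasse
diagram. -/
structure IsHPO (P : TopStructure.{u}) : Prop where
  refl : ∀ a : P, P.le a a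
  antisymm : ∀ a b : P, P.le a b → P.le b a → a = b
  trans : ∀ a b c : P, P.le a b → P.le b c → P.le a c
  R_iff : ∀ a b : P, P.R a b ↔ a = b ∨ P.NextOrEq a b ∨ P.NextOrEq b a

/-- A finite (nonempty) Hasse forest: a finite Hasse partial order whose Hasse diagram, as an
undirected graph, has no cycles. -/
structure IsFiniteHForest (P : TopStructure.{u}) : Prop where
  finite : Finite P
  nonempty : Nonempty P
  hpo : IsHPO P
  acyclic : (SimpleGraph.fromRel P.R).IsAcyclic

/-! ### The quotient by `R` and its endpoints -/

/-- The quotient space of `A` by the relation `R` (with the quotient topology). -/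
abbrev TopStructure.Quo (A : TopStructure.{u}) : Type u := Quot A.R

/-- The relation induced by `le` on the quotient, i.e. its image under the quotient map. -/
def TopStructure.quoLE (A : TopStructure.{u}) (x y : A.Quo) : Prop :=
  ∃ a b : A, Quot.mk A.R a = x ∧ Quot.mk A.R b = y ∧ A.le a b

/-- `𝔏`: the minimal points of the quotient. -/
def TopStructure.lower (A : TopStructure.{u}) : Set A.Quo :=
  {x | ∀ y, A.quoLE y x → y = x}

/-- `𝔘`: the maximal points of the quotient. -/
def TopStructure.upper (A : TopStructure.{u}) : Set A.Quo :=
  {x | ∀ y, A.quoLE x y → y = x}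

/-! ### Topological notions -/

section Topological

variable (X : Type u) [TopologicalSpace X]

/-- The endpoints of a space: points that can belong to an arc only as one of its two ends. -/
def endpoints : Set X :=
  {x | ∀ f : unitInterval → X, IsEmbedding f → x ∈ Set.range f → x = f 0 ∨ x = f 1}

/-- Every point has a neighbourhood basis of closed sets that are intersections of clopen sets. -/
def AlmostZeroDimensional : Prop :=
  ∀ x : X, ∀ V ∈ 𝓝 x, ∃ C ∈ 𝓝 x, C ⊆ V ∧ IsClosed C ∧
    ∃ 𝒮 : Set (Set X), (∀ S ∈ 𝒮, IsClopen S) ∧ C = ⋂₀ 𝒮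

/-- Every point has a neighbourhood that contains no nonempty clopen subset of the space. -/
def Cohesive : Prop :=
  ∀ x : X, ∃ V ∈ 𝓝 x, ∀ C : Set X, C ⊆ V → IsClopen C → ¬ C.Nonempty

/-- The homeomorphism group acts transitively. -/
def Homogeneous : Prop :=
  ∀ x y : X, ∃ h : X ≃ₜ X, h x = y

/-- `1/n`-homogeneity: the homeomorphism group has exactly `n` orbits. -/
def OneOverHomogeneous (n : ℕ) : Prop :=
  (Set.range fun x : X => {y : X | ∃ h : X ≃ₜ X, h x = y}).encard = n

/-- A countable union of closed, completely metrizable subspaces. -/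
def StronglySigmaComplete : Prop :=
  ∃ f : ℕ → Set X, (∀ n, IsClosed (f n) ∧ IsCompletelyMetrizableSpace (f n)) ∧
    ⋃ n, f n = Set.univ

end Topological

end FraisseFence

/-! The proof builds a concrete limit and reads off all properties from it. A code `c`, a point of
the Cantor space, determines a decreasing sequence of nondegenerate rational intervals `ivl c n`
inside [0,1]: the digit `c n` tells whether to intersect the current interval with the n-th window,
and every rational pair occurs infinitely often as a window. Their intersection is `[lo c, hi c]`,
where `lo` is lower and `hi` upper semicontinuous. The fence is `{(c, t) | lo c ≤ t ≤ hi c}`; its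
prespace replaces the real t by a rational cut, and `R` identifies cuts with the same value.

The prespace is a limit because it has the lifting property (`prefence_exists_lift`). A map to a
finite forest depends on finitely many digits and rationals, so over a small cylinder it climbs a
chain of the forest as the cut passes finitely many thresholds. Such a climb lifts along an
epimorphism of forests, since acyclicity makes the path between two comparable points unique.
Surjectivity on pairs is arranged by changing the lift over tiny new cylinders with prescribed
intervals (`exists_stamp`). A back-and-forth argument shows that structures with fine forest
quotients and the lifting property are isomorphic (`HasLifts.exists_homeomorph`); hence every limit
has the concrete fence as its quotient.

Under this identification 𝔏 and 𝔘 consist of the lower and upper ends of the fibres, E(Y) is their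
union, 𝔏 ∩ 𝔘 corresponds to the degenerate codes (`lo c = hi c`) and 𝔐 to the others. The topology
on 𝔘 and 𝔐 is that of the graph of `hi`. Semicontinuity gives Polishness, almost zero-dimensionality
and dimension at most one.

Two arguments carry the rest. First, a connectedness argument of Lelek fan type
(`false_of_separated`): a separation of the graph of `hi` over the nondegenerate codes into two open
parts cannot also separate the top of a fibre from its bottom. Hence E(Y) is not totally separated,
and a point of 𝔘 over a nondegenerate fibre has no small clopen neighbourhoods, whereas one over a
degenerate fibre does. Second, clopen sets of codes that contain a largest interval are homeomorphic
by maps that change `lo` and `hi` affinely (`IsFull.exists_homeomorph`). Gluing such maps over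
shells around two codes of the same kind moves one to the other (`exists_equiv_tendsto`), so the two
kinds of codes are exactly the orbits. The degenerate codes form a Baire space by recording the
levels at which the interval has been halved. -/

namespace FraisseFence

/-! ### Back-and-forth for compact metric spaces -/

section BackAndForth

variable {X : Type u} {Y : Type v} [MetricSpace X] [CompactSpace X] [MetricSpace Y] [CompactSpace Y]

/-- The sections of the relation `Z` have diameter less than `ε`, in both coordinates. -/
def SmallSections (Z : Set (X × Y)) (ε : ℝ) : Prop :=
  (∀ x x' y, (x, y) ∈ Z → (x', y) ∈ Z → dist x x' < ε) ∧
    ∀ x y y', (x, y) ∈ Z → (x, y') ∈ Z → dist y y' < ε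

/-- The intersection of the relations is the graph of the homeomorphism: compactness gives every
point a partner in it, small sections make the partner unique, and both projections of this compact
set are then homeomorphisms. -/
theorem exists_homeomorph_of_antitone_relations (Z : ℕ → Set (X × Y))
    (hclosed : ∀ n, IsClosed (Z n)) (hanti : Antitone Z)
    (hleft : ∀ n x, ∃ y, (x, y) ∈ Z n) (hright : ∀ n y, ∃ x, (x, y) ∈ Z n)
    (hsmall : ∀ ε > 0, ∃ n, SmallSections (Z n) ε) :
    ∃ f : X ≃ₜ Y, ∀ n x, (x, f x) ∈ Z n := by
  have hG : IsClosed (⋂ n, Z n) := isClosed_iInter hclosed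
  have : CompactSpace (⋂ n, Z n : Set (X × Y)) := isCompact_iff_compactSpace.mp hG.isCompact
  have h1 : Function.Bijective fun p : (⋂ n, Z n : Set (X × Y)) => p.1.1 := by
    constructor
    · rintro ⟨⟨x, y⟩, h⟩ ⟨⟨x', y'⟩, h'⟩ (rfl : x = x')
      simp only [Set.mem_iInter] at h h'
      have : y = y' := by
        by_contra hne
        obtain ⟨n, hn⟩ := hsmall _ (dist_pos.mpr hne)
        exact lt_irrefl _ (hn.2 x y y' (h n) (h' n))
      subst this; rfl
    · intro x
      obtain ⟨y, hy⟩ := IsCompact.nonempty_iInter_of_sequence_nonempty_isCompact_isClosed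
        (fun n => {y | (x, y) ∈ Z n}) (fun n y h => hanti (Nat.le_succ n) h) (hleft · x)
        ((hclosed 0).preimage (by fun_prop : Continuous fun y => (x, y))).isCompact
        (fun n => (hclosed n).preimage (by fun_prop : Continuous fun y => (x, y)))
      simp only [Set.mem_iInter] at hy
      exact ⟨⟨(x, y), by simpa using hy⟩, rfl⟩
  have h2 : Function.Bijective fun p : (⋂ n, Z n : Set (X × Y)) => p.1.2 := by
    constructor
    · rintro ⟨⟨x, y⟩, h⟩ ⟨⟨x', y'⟩, h'⟩ (rfl : y = y')
      simp only [Set.mem_iInter] at h h'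
      have : x = x' := by
        by_contra hne
        obtain ⟨n, hn⟩ := hsmall _ (dist_pos.mpr hne)
        exact lt_irrefl _ (hn.1 x x' y (h n) (h' n))
      subst this; rfl
    · intro y
      obtain ⟨x, hx⟩ := IsCompact.nonempty_iInter_of_sequence_nonempty_isCompact_isClosed
        (fun n => {x | (x, y) ∈ Z n}) (fun n x h => hanti (Nat.le_succ n) h) (hright · y)
        ((hclosed 0).preimage (by fun_prop : Continuous fun x => (x, y))).isCompact
        (fun n => (hclosed n).preimage (by fun_prop : Continuous fun x => (x, y)))
      simp only [Set.mem_iInter] at hx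
      exact ⟨⟨(x, y), by simpa using hx⟩, rfl⟩
  let f1 : (⋂ n, Z n : Set (X × Y)) ≃ₜ X :=
    Continuous.homeoOfEquivCompactToT2 (f := Equiv.ofBijective _ h1)
      (continuous_fst.comp continuous_subtype_val)
  let f2 : (⋂ n, Z n : Set (X × Y)) ≃ₜ Y :=
    Continuous.homeoOfEquivCompactToT2 (f := Equiv.ofBijective _ h2)
      (continuous_snd.comp continuous_subtype_val)
  refine ⟨f1.symm.trans f2, fun n x => ?_⟩
  obtain ⟨p, rfl⟩ := f1.surjective x
  have hp := p.2
  simp only [Set.mem_iInter] at hp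
  rw [Homeomorph.trans_apply, Homeomorph.symm_apply_apply]
  exact hp n

/-- The last clause is what makes the lemma useful: whatever the members of `𝒜` respect
approximately, such as a closed relation or the ends of intervals, is respected exactly by the limit
map. -/
theorem exists_homeomorph_of_back_and_forth (𝒜 : Set (X × Y) → Prop)
    (hclosed : ∀ Z, 𝒜 Z → IsClosed Z) (hleft : ∀ Z, 𝒜 Z → ∀ x, ∃ y, (x, y) ∈ Z)
    (hright : ∀ Z, 𝒜 Z → ∀ y, ∃ x, (x, y) ∈ Z)
    (hstep : ∀ Z, 𝒜 Z → ∀ ε > 0, ∃ Z' ⊆ Z, 𝒜 Z' ∧ SmallSections Z' ε)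
    (Z₀ : Set (X × Y)) (hZ₀ : 𝒜 Z₀) :
    ∃ f : X ≃ₜ Y, (∀ x, (x, f x) ∈ Z₀) ∧
      ∀ ε > 0, ∃ Z, 𝒜 Z ∧ SmallSections Z ε ∧ ∀ x, (x, f x) ∈ Z := by
  choose F hFsub hFA hFsmall using hstep
  let S : ℕ → {Z : Set (X × Y) // 𝒜 Z} := fun n => Nat.rec ⟨Z₀, hZ₀⟩
    (fun n Z => ⟨F Z.1 Z.2 (1 / ((n : ℝ) + 1)) Nat.one_div_pos_of_nat, hFA _ _ _ _⟩) n
  have hS : ∀ n, SmallSections (S (n + 1)).1 (1 / ((n : ℝ) + 1)) := fun n => hFsmall _ _ _ _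
  have hsm : ∀ ε > 0, ∃ n, SmallSections (S n).1 ε := by
    intro ε hε
    obtain ⟨n, hn⟩ := exists_nat_one_div_lt hε
    exact ⟨n + 1, fun x x' y h h' => ((hS n).1 x x' y h h').trans hn,
      fun x y y' h h' => ((hS n).2 x y y' h h').trans hn⟩
  obtain ⟨f, hf⟩ := exists_homeomorph_of_antitone_relations (fun n => (S n).1)
    (fun n => hclosed _ (S n).2) (antitone_nat_of_succ_le fun n => hFsub _ _ _ _)
    (fun n => hleft _ (S n).2) (fun n => hright _ (S n).2) hsm
  refine ⟨f, hf 0, fun ε hε => ?_⟩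
  obtain ⟨n, hn⟩ := hsm ε hε
  exact ⟨_, (S n).2, hn, hf n⟩

end BackAndForth

/-! ### Polish subspaces -/

/-- A countable intersection of open sets `U n` sits in the Polish space `∏ U n` as the diagonal,
which is closed. -/
theorem polishSpace_of_isGδ {X : Type u} [TopologicalSpace X] [PolishSpace X] {s : Set X}
    (hs : IsGδ s) : PolishSpace s := by
  obtain ⟨U, hU, rfl⟩ := isGδ_iff_eq_iInter_nat.mp hs
  have : ∀ n, PolishSpace (U n) := fun n => (hU n).polishSpace
  let d : (⋂ n, U n : Set X) → ∀ n, U n := fun x n => ⟨x.1, Set.mem_iInter.mp x.2 n⟩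
  have hd : Continuous d := by fun_prop
  refine IsClosedEmbedding.polishSpace (f := d) ⟨⟨⟨?_⟩, ?_⟩, ?_⟩
  · refine le_antisymm hd.le_induced ?_
    have h0 : Continuous fun f : (∀ n, U n) => ((f 0 : U 0) : X) := by fun_prop
    intro W hW
    obtain ⟨W', hW', rfl⟩ := isOpen_induced_iff.mp hW
    exact ⟨_, hW'.preimage h0, rfl⟩
  · intro x y h
    exact Subtype.ext (congrArg (fun f : (∀ n, U n) => ((f 0 : U 0) : X)) h)
  · have : Set.range d = ⋂ n, {f : ∀ n, U n | ((f n : U n) : X) = (f 0 : U 0)} := by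
      ext f
      simp only [Set.mem_range, Set.mem_iInter, Set.mem_ofPred_eq]
      constructor
      · rintro ⟨x, rfl⟩ n; rfl
      · intro h
        refine ⟨⟨(f 0).1, Set.mem_iInter.mpr fun n => h n ▸ (f n).2⟩, ?_⟩
        funext n
        exact Subtype.ext (h n).symm
    rw [this]
    exact isClosed_iInter fun n => isClosed_eq (by fun_prop) (by fun_prop)

/-! ### Zero-dimensional spaces -/

theorem exists_isClopen_mem_subset {X : Type u} [TopologicalSpace X]
    [h : HasSmallInductiveDimensionLE X 0] {x : X} {U : Set X} (hU : IsOpen U) (hx : x ∈ U) :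
    ∃ V, IsClopen V ∧ x ∈ V ∧ V ⊆ U := by
  obtain ⟨V, hV, hxV, hVU⟩ :=
    (hasSmallInductiveDimensionLT_one_iff.mp h).exists_subset_of_mem_open hx hU
  exact ⟨V, hV, hxV, hVU⟩

theorem hasSmallInductiveDimensionLE_zero_of_isInducing {X : Type u} {Y : Type v}
    [TopologicalSpace X] [TopologicalSpace Y] [h : HasSmallInductiveDimensionLE Y 0] {f : X → Y}
    (hf : IsInducing f) : HasSmallInductiveDimensionLE X 0 := by
  refine hasSmallInductiveDimensionLT_one_iff.mpr
    (isTopologicalBasis_of_isOpen_of_nhds (fun _ hV => hV.isOpen) fun x U hx hU => ?_)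
  obtain ⟨W, hW, rfl⟩ := hf.isOpen_iff.mp hU
  obtain ⟨V, hV, hxV, hVW⟩ := exists_isClopen_mem_subset hW hx
  exact ⟨f ⁻¹' V, hV.preimage hf.continuous, hxV, Set.preimage_mono hVW⟩

theorem hasSmallInductiveDimensionLE_zero_pi {ι : Type u} {E : ι → Type v}
    [∀ i, TopologicalSpace (E i)] [∀ i, DiscreteTopology (E i)] :
    HasSmallInductiveDimensionLE (∀ i, E i) 0 := by
  refine hasSmallInductiveDimensionLT_one_iff.mpr
    (isTopologicalBasis_of_isOpen_of_nhds (fun _ hV => hV.isOpen) fun x U hx hU => ?_)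
  obtain ⟨I, t, ht, hsub⟩ := isOpen_pi_iff.mp hU x hx
  refine ⟨(I : Set ι).pi t, ⟨isClosed_set_pi fun i _ => isClosed_discrete _,
    isOpen_set_pi I.finite_toSet fun i _ => isOpen_discrete _⟩, fun i hi => (ht i hi).2, hsub⟩

theorem hasSmallInductiveDimensionLE_zero_prod {X : Type u} {Y : Type v} [TopologicalSpace X]
    [TopologicalSpace Y] [HasSmallInductiveDimensionLE X 0] [HasSmallInductiveDimensionLE Y 0] :
    HasSmallInductiveDimensionLE (X × Y) 0 := by
  refine hasSmallInductiveDimensionLT_one_iff.mpr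
    (isTopologicalBasis_of_isOpen_of_nhds (fun _ hV => hV.isOpen) fun x U hx hU => ?_)
  obtain ⟨A, B, hA, hB, hxA, hxB, hsub⟩ := isOpen_prod_iff.mp hU x.1 x.2 hx
  obtain ⟨V, hV, hxV, hVA⟩ := exists_isClopen_mem_subset hA hxA
  obtain ⟨W, hW, hxW, hWB⟩ := exists_isClopen_mem_subset hB hxB
  exact ⟨V ×ˢ W, hV.prod hW, ⟨hxV, hxW⟩, (Set.prod_mono hVA hWB).trans hsub⟩

/-! ### A coded family of intervals -/

/-- The first coordinates of an enumeration of `α × ℕ` take every value infinitely often. -/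
theorem exists_recurrent_sequence (α : Type) [Denumerable α] :
    ∃ e : ℕ → α, ∀ p N, ∃ n, N ≤ n ∧ e n = p := by
  refine ⟨fun n => (Denumerable.ofNat (α × ℕ) n).1, fun p N => ?_⟩
  have hinj : Function.Injective fun m : ℕ => Encodable.encode (p, m) := fun m m' h => by
    simpa using h
  obtain ⟨_, ⟨m, rfl⟩, hm⟩ := (Set.infinite_range_of_injective hinj).exists_gt N
  exact ⟨_, hm.le, by simp⟩

/-- A sequence of pairs of rationals in which every pair occurs infinitely often. -/
noncomputable def window : ℕ → ℚ × ℚ := (exists_recurrent_sequence (ℚ × ℚ)).choose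

theorem exists_window_eq (p : ℚ × ℚ) (N : ℕ) : ∃ n, N ≤ n ∧ window n = p :=
  (exists_recurrent_sequence (ℚ × ℚ)).choose_spec p N

/-- The space of codes. -/
abbrev Code : Type := ℕ → Bool

/-- Intersect two intervals, provided that the intersection is nondegenerate. -/
noncomputable def shrink (p q : ℚ × ℚ) : ℚ × ℚ :=
  if max p.1 q.1 < min p.2 q.2 then (max p.1 q.1, min p.2 q.2) else p

theorem shrink_lt {p q : ℚ × ℚ} (hp : p.1 < p.2) : (shrink p q).1 < (shrink p q).2 := by
  unfold shrink; split_ifs with h <;> assumption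

theorem fst_le_shrink (p q : ℚ × ℚ) : p.1 ≤ (shrink p q).1 := by
  unfold shrink; split_ifs with h
  exacts [le_max_left _ _, le_rfl]

theorem shrink_le_snd (p q : ℚ × ℚ) : (shrink p q).2 ≤ p.2 := by
  unfold shrink; split_ifs with h
  exacts [min_le_left _ _, le_rfl]

theorem shrink_eq {p q : ℚ × ℚ} (h1 : p.1 ≤ q.1) (h : q.1 < q.2) (h2 : q.2 ≤ p.2) :
    shrink p q = q := by
  unfold shrink
  rw [max_eq_right h1, min_eq_right h2, if_pos h]

/-- The decreasing sequence of intervals coded by `c`. -/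
noncomputable def ivl (c : Code) : ℕ → ℚ × ℚ
  | 0 => (0, 1)
  | n + 1 => if c n then shrink (ivl c n) (window n) else ivl c n

theorem ivl_lt (c : Code) (n : ℕ) : (ivl c n).1 < (ivl c n).2 := by
  induction n with
  | zero => norm_num [ivl]
  | succ n ih =>
    rw [ivl]; split_ifs
    exacts [shrink_lt ih, ih]

theorem monotone_ivl_fst (c : Code) : Monotone fun n => (ivl c n).1 :=
  monotone_nat_of_le_succ fun n => by
    rw [ivl]; split_ifs
    exacts [fst_le_shrink _ _, le_rfl]

theorem antitone_ivl_snd (c : Code) : Antitone fun n => (ivl c n).2 :=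
  antitone_nat_of_succ_le fun n => by
    rw [ivl]; split_ifs
    exacts [shrink_le_snd _ _, le_rfl]

theorem ivl_fst_lt_snd (c : Code) (m n : ℕ) : (ivl c m).1 < (ivl c n).2 :=
  ((monotone_ivl_fst c (le_max_left m n)).trans_lt (ivl_lt c _)).trans_le
    (antitone_ivl_snd c (le_max_right m n))

theorem ivl_congr {c d : Code} {n : ℕ} (h : d ∈ PiNat.cylinder c n) : ivl d n = ivl c n := by
  induction n with
  | zero => rfl
  | succ n ih =>
    rw [ivl, ivl, h n n.lt_succ_self, ih (PiNat.cylinder_anti c n.le_succ h)]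

theorem isClopen_cylinder (c : Code) (n : ℕ) : IsClopen (PiNat.cylinder c n) := by
  rw [PiNat.cylinder_eq_pi]
  exact ⟨isClosed_set_pi fun i _ => isClosed_discrete _,
    isOpen_set_pi (Finset.finite_toSet _) fun i _ => isOpen_discrete _⟩

theorem exists_cylinder_subset {c : Code} {U : Set Code} (hU : U ∈ 𝓝 c) :
    ∃ n, PiNat.cylinder c n ⊆ U := by
  obtain ⟨V, hV, hcV, hVU⟩ :=
    (PiNat.isTopologicalBasis_cylinders (fun _ : ℕ => Bool)).mem_nhds_iff.mp hU
  obtain ⟨x, n, rfl⟩ := hV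
  exact ⟨n, by rwa [PiNat.mem_cylinder_iff_eq.mp hcV]⟩

theorem continuous_ivl (n : ℕ) : Continuous fun c : Code => ivl c n := by
  refine (IsLocallyConstant.iff_exists_open _).mpr (fun c => ?_) |>.continuous
  exact ⟨_, (isClopen_cylinder c n).isOpen, PiNat.self_mem_cylinder c n, fun d hd => ivl_congr hd⟩

theorem continuous_ivl_fst (n : ℕ) : Continuous fun c : Code => ((ivl c n).1 : ℝ) :=
  Rat.continuous_coe_real.comp (continuous_fst.comp (continuous_ivl n))

theorem continuous_ivl_snd (n : ℕ) : Continuous fun c : Code => ((ivl c n).2 : ℝ) :=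
  Rat.continuous_coe_real.comp (continuous_snd.comp (continuous_ivl n))

/-- The lower end of the interval coded by `c`. -/
noncomputable def lo (c : Code) : ℝ := ⨆ n, ((ivl c n).1 : ℝ)

/-- The upper end of the interval coded by `c`. -/
noncomputable def hi (c : Code) : ℝ := ⨅ n, ((ivl c n).2 : ℝ)

theorem bddAbove_ivl (c : Code) : BddAbove (Set.range fun n => ((ivl c n).1 : ℝ)) :=
  ⟨((ivl c 0).2 : ℝ), by rintro _ ⟨n, rfl⟩; exact Rat.cast_le.mpr (ivl_fst_lt_snd c n 0).le⟩

theorem bddBelow_ivl (c : Code) : BddBelow (Set.range fun n => ((ivl c n).2 : ℝ)) :=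
  ⟨((ivl c 0).1 : ℝ), by rintro _ ⟨n, rfl⟩; exact Rat.cast_le.mpr (ivl_fst_lt_snd c 0 n).le⟩

theorem ivl_fst_le_lo (c : Code) (n : ℕ) : ((ivl c n).1 : ℝ) ≤ lo c := le_ciSup (bddAbove_ivl c) n

theorem hi_le_ivl_snd (c : Code) (n : ℕ) : hi c ≤ ((ivl c n).2 : ℝ) := ciInf_le (bddBelow_ivl c) n

theorem lo_le_iff {c : Code} {t : ℝ} : lo c ≤ t ↔ ∀ n, ((ivl c n).1 : ℝ) ≤ t :=
  ciSup_le_iff (bddAbove_ivl c)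

theorem le_hi_iff {c : Code} {t : ℝ} : t ≤ hi c ↔ ∀ n, t ≤ ((ivl c n).2 : ℝ) :=
  le_ciInf_iff (bddBelow_ivl c)

theorem lo_le_hi (c : Code) : lo c ≤ hi c :=
  lo_le_iff.mpr fun m => le_hi_iff.mpr fun n => by exact_mod_cast (ivl_fst_lt_snd c m n).le

theorem tendsto_ivl_fst (c : Code) :
    Filter.Tendsto (fun n => ((ivl c n).1 : ℝ)) Filter.atTop (𝓝 (lo c)) :=
  tendsto_atTop_ciSup (fun m n h => by exact_mod_cast monotone_ivl_fst c h) (bddAbove_ivl c)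

theorem tendsto_ivl_snd (c : Code) :
    Filter.Tendsto (fun n => ((ivl c n).2 : ℝ)) Filter.atTop (𝓝 (hi c)) :=
  tendsto_atTop_ciInf (fun m n h => by exact_mod_cast antitone_ivl_snd c h) (bddBelow_ivl c)

theorem ivl_fst_le_lo_of_mem {c d : Code} {n : ℕ} (h : d ∈ PiNat.cylinder c n) :
    ((ivl c n).1 : ℝ) ≤ lo d := ivl_congr h ▸ ivl_fst_le_lo d n

theorem hi_le_ivl_snd_of_mem {c d : Code} {n : ℕ} (h : d ∈ PiNat.cylinder c n) :
    hi d ≤ ((ivl c n).2 : ℝ) := ivl_congr h ▸ hi_le_ivl_snd d n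

theorem isClosed_lo_le {X : Type u} [TopologicalSpace X] {f : X → Code} {g : X → ℝ}
    (hf : Continuous f) (hg : Continuous g) : IsClosed {x | lo (f x) ≤ g x} := by
  simp only [lo_le_iff, Set.ofPred_forall]
  exact isClosed_iInter fun n => isClosed_le ((continuous_ivl_fst n).comp hf) hg

theorem isClosed_le_hi {X : Type u} [TopologicalSpace X] {f : X → Code} {g : X → ℝ}
    (hf : Continuous f) (hg : Continuous g) : IsClosed {x | g x ≤ hi (f x)} := by
  simp only [le_hi_iff, Set.ofPred_forall]
  exact isClosed_iInter fun n => isClosed_le hg ((continuous_ivl_snd n).comp hf)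

theorem lo_eq_and_hi_eq {c : Code} {n : ℕ} (h : ∀ m, n ≤ m → c m = false) :
    lo c = (ivl c n).1 ∧ hi c = (ivl c n).2 := by
  have key : ∀ m, n ≤ m → ivl c m = ivl c n := by
    intro m hm
    induction m, hm using Nat.le_induction with
    | base => rfl
    | succ m hm ih => rw [ivl, h m hm, if_neg (by simp), ih]
  constructor
  · refine tendsto_nhds_unique (tendsto_ivl_fst c) (tendsto_const_nhds.congr' ?_)
    filter_upwards [Filter.eventually_ge_atTop n] with m hm
    rw [key m hm]
  · refine tendsto_nhds_unique (tendsto_ivl_snd c) (tendsto_const_nhds.congr' ?_)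
    filter_upwards [Filter.eventually_ge_atTop n] with m hm
    rw [key m hm]

/-- The center of the cylinder of length `n` around `c`. -/
def trunc (c : Code) (n : ℕ) : Code := fun i => if i < n then c i else false

theorem trunc_mem_cylinder (c : Code) (n : ℕ) : trunc c n ∈ PiNat.cylinder c n := fun i hi => by
  simp [trunc, hi]

theorem ivl_trunc (c : Code) (n : ℕ) : ivl (trunc c n) n = ivl c n :=
  ivl_congr (trunc_mem_cylinder c n)

theorem lo_trunc (c : Code) (n : ℕ) : lo (trunc c n) = (ivl c n).1 := by
  rw [← ivl_trunc]
  exact (lo_eq_and_hi_eq fun m hm => by simp [trunc, hm]).1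

theorem hi_trunc (c : Code) (n : ℕ) : hi (trunc c n) = (ivl c n).2 := by
  rw [← ivl_trunc]
  exact (lo_eq_and_hi_eq fun m hm => by simp [trunc, hm]).2

theorem tendsto_trunc (c : Code) : Filter.Tendsto (trunc c) Filter.atTop (𝓝 c) := by
  refine tendsto_pi_nhds.mpr fun i => tendsto_const_nhds.congr' ?_
  filter_upwards [Filter.eventually_gt_atTop i] with n hn
  simp [trunc, hn]

/-- The center of the cylinder of length `n` around `c`, with a further window applied at `j`. -/
def stamp (c : Code) (n j : ℕ) : Code := fun i => if i < n then c i else decide (i = j)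

theorem stamp_mem_cylinder (c : Code) (n j : ℕ) : stamp c n j ∈ PiNat.cylinder c n := fun i hi => by
  simp [stamp, hi]

theorem cylinder_stamp_subset (c : Code) {n j : ℕ} (h : n ≤ j) :
    PiNat.cylinder (stamp c n j) (j + 1) ⊆ PiNat.cylinder c n := fun _ hd i hi =>
  (hd i (by omega)).trans (stamp_mem_cylinder c n j i hi)

theorem ivl_stamp (c : Code) {n j : ℕ} (h : n ≤ j) (h1 : (ivl c n).1 ≤ (window j).1)
    (h2 : (window j).1 < (window j).2) (h3 : (window j).2 ≤ (ivl c n).2) :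
    ivl (stamp c n j) (j + 1) = window j := by
  have key : ∀ m, n ≤ m → m ≤ j → ivl (stamp c n j) m = ivl c n := by
    intro m hm
    induction m, hm using Nat.le_induction with
    | base => exact fun _ => ivl_congr (stamp_mem_cylinder c n j)
    | succ m hm ih =>
      intro hj
      rw [ivl, if_neg, ih (by omega)]
      simp [stamp, hm, show m ≠ j by omega]
  rw [ivl, if_pos, key j h le_rfl, shrink_eq h1 h2 h3]
  simp [stamp, show ¬ j < n by omega]

theorem lo_hi_stamp (c : Code) {n j : ℕ} (h : n ≤ j) (h1 : (ivl c n).1 ≤ (window j).1)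
    (h2 : (window j).1 < (window j).2) (h3 : (window j).2 ≤ (ivl c n).2) :
    lo (stamp c n j) = (window j).1 ∧ hi (stamp c n j) = (window j).2 := by
  rw [← ivl_stamp c h h1 h2 h3]
  exact lo_eq_and_hi_eq fun m hm => by
    simp [stamp, show ¬ m < n by omega, show m ≠ j by omega]

/-- Inside every cylinder there is, avoiding a given finite set of codes, a small cylinder with a
prescribed rational interval. -/
theorem exists_stamp (c : Code) (n N : ℕ) {a b : ℚ} (h1 : (ivl c n).1 ≤ a) (h : a < b)
    (h2 : b ≤ (ivl c n).2) {F : Set Code} (hF : F.Finite) :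
    ∃ j, N ≤ j ∧ n ≤ j ∧ ivl (stamp c n j) (j + 1) = (a, b) ∧
      lo (stamp c n j) = a ∧ hi (stamp c n j) = b ∧
      Disjoint (PiNat.cylinder (stamp c n j) (j + 1)) F := by
  -- Infinitely many positions `j` carry the window `(a, b)`. A given code lies in the cylinder of
  -- at most one of the candidates, because `j` is the position of the first true digit from `n` on.
  -- So all but finitely many positions avoid `F`.
  have hinf : {j | max N n ≤ j ∧ window j = (a, b)}.Infinite :=
    Set.infinite_of_forall_exists_gt fun m => by
      obtain ⟨j, hj, hw⟩ := exists_window_eq (a, b) (max (max N n) (m + 1))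
      exact ⟨j, ⟨(le_max_left _ _).trans hj, hw⟩, (le_max_right _ _).trans hj⟩
  have hfin : (⋃ z ∈ F, {j | n ≤ j ∧ z ∈ PiNat.cylinder (stamp c n j) (j + 1)}).Finite := by
    refine hF.biUnion fun z _ => Set.Subsingleton.finite ?_
    have aux : ∀ j j' : ℕ, n ≤ j → z ∈ PiNat.cylinder (stamp c n j) (j + 1) →
        z ∈ PiNat.cylinder (stamp c n j') (j' + 1) → ¬ j < j' := by
      intro j j' hnj hz hz' hjj
      have h1 := hz j (by omega)
      have h2 := hz' j (by omega)
      simp [stamp, show ¬ j < n by omega] at h1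
      simp [stamp, show ¬ j < n by omega, show j ≠ j' by omega, h1] at h2
    rintro j ⟨hj, hz⟩ j' ⟨hj', hz'⟩
    have := aux j j' hj hz hz'
    have := aux j' j hj' hz' hz
    omega
  obtain ⟨j, ⟨hj, hw⟩, hnot⟩ := (hinf.sdiff hfin).nonempty
  have hnj : n ≤ j := (le_max_right _ _).trans hj
  refine ⟨j, (le_max_left _ _).trans hj, hnj, ?_, ?_, ?_, ?_⟩
  · rw [ivl_stamp c hnj (by simpa [hw]) (by simpa [hw]) (by simpa [hw]), hw]
  · rw [(lo_hi_stamp c hnj (by simpa [hw]) (by simpa [hw]) (by simpa [hw])).1, hw]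
  · rw [(lo_hi_stamp c hnj (by simpa [hw]) (by simpa [hw]) (by simpa [hw])).2, hw]
  · rw [Set.disjoint_left]
    intro z hz hzF
    exact hnot (Set.mem_iUnion₂.mpr ⟨z, hzF, hnj, hz⟩)

/-! ### Rational cuts -/

/-- The space of all sets of rationals, in which the cuts live. -/
abbrev PreCut : Type := ℚ → Bool

/-- A cut: a set of rationals that is closed downwards. -/
def IsCut (k : PreCut) : Prop := ∀ q r, q ≤ r → k r = true → k q = true

/-- The real number determined by a cut. -/
noncomputable def cutVal (k : PreCut) : ℝ := sSup ((fun q : ℚ => (q : ℝ)) '' {q | k q = true})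

/-- The cut of all rationals `≤ q`. -/
def cutLE (q : ℚ) : PreCut := fun r => decide (r ≤ q)

/-- The cut of all rationals `< q`. -/
def cutLT (q : ℚ) : PreCut := fun r => decide (r < q)

theorem isCut_cutLE (q : ℚ) : IsCut (cutLE q) := fun r s hrs hs => by
  simp only [cutLE, decide_eq_true_eq] at *; exact hrs.trans hs

theorem isCut_cutLT (q : ℚ) : IsCut (cutLT q) := fun r s hrs hs => by
  simp only [cutLT, decide_eq_true_eq] at *; exact hrs.trans_lt hs

@[simp] theorem cutLE_eq_true {q r : ℚ} : cutLE q r = true ↔ r ≤ q := by simp [cutLE]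
@[simp] theorem cutLT_eq_true {q r : ℚ} : cutLT q r = true ↔ r < q := by simp [cutLT]
@[simp] theorem cutLE_eq_false {q r : ℚ} : cutLE q r = false ↔ q < r := by simp [cutLE]
@[simp] theorem cutLT_eq_false {q r : ℚ} : cutLT q r = false ↔ q ≤ r := by simp [cutLT]

namespace IsCut

variable {k l : PreCut} {p q r : ℚ}

theorem lt_of_true_of_false (hk : IsCut k) (hp : k p = true) (hq : k q = false) : p < q := by
  by_contra h
  rw [hk _ _ (not_lt.mp h) hp] at hq
  exact Bool.noConfusion hq

theorem le_total (hk : IsCut k) (hl : IsCut l) : k ≤ l ∨ l ≤ k := by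
  by_contra! h
  simp only [Pi.le_def, not_forall] at h
  obtain ⟨⟨q, hq⟩, ⟨r, hr⟩⟩ := h
  have h1 : k q = true ∧ l q = false := by revert hq; cases k q <;> cases l q <;> simp
  have h2 : l r = true ∧ k r = false := by revert hr; cases k r <;> cases l r <;> simp
  exact lt_asymm (hk.lt_of_true_of_false h1.1 h2.2) (hl.lt_of_true_of_false h2.1 h1.2)

theorem bddAbove (hk : IsCut k) (hq : k q = false) :
    BddAbove ((fun q : ℚ => (q : ℝ)) '' {q | k q = true}) :=
  ⟨q, by rintro _ ⟨r, hr, rfl⟩; exact Rat.cast_le.mpr (hk.lt_of_true_of_false hr hq).le⟩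

theorem le_cutVal (hk : IsCut k) (hq : k q = false) (hp : k p = true) : (p : ℝ) ≤ cutVal k :=
  le_csSup (hk.bddAbove hq) ⟨p, hp, rfl⟩

theorem cutVal_le (hk : IsCut k) (hq : k q = false) (hp : k p = true) : cutVal k ≤ q :=
  csSup_le ⟨_, p, hp, rfl⟩ (by
    rintro _ ⟨r, hr, rfl⟩; exact Rat.cast_le.mpr (hk.lt_of_true_of_false hr hq).le)

theorem lt_cutVal_iff (hk : IsCut k) (hq : k q = false) (hp : k p = true) {t : ℝ} :
    t < cutVal k ↔ ∃ s : ℚ, k s = true ∧ t < s := by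
  constructor
  · intro h
    obtain ⟨_, ⟨s, hs, rfl⟩, hts⟩ := exists_lt_of_lt_csSup (Set.Nonempty.image _ ⟨p, hp⟩) h
    exact ⟨s, hs, hts⟩
  · rintro ⟨s, hs, hts⟩
    exact hts.trans_le (hk.le_cutVal hq hs)

theorem cutVal_lt_iff (hk : IsCut k) (hq : k q = false) (hp : k p = true) {t : ℝ} :
    cutVal k < t ↔ ∃ s : ℚ, k s = false ∧ (s : ℝ) < t := by
  constructor
  · intro h
    obtain ⟨s, hs1, hs2⟩ := exists_rat_btwn h
    refine ⟨s, ?_, hs2⟩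
    by_contra hs
    exact (hk.le_cutVal hq (Bool.not_eq_false _ ▸ hs)).not_gt hs1
  · rintro ⟨s, hs, hts⟩
    exact (hk.cutVal_le hs hp).trans_lt hts

theorem cutVal_eq (hk : IsCut k) {t : ℝ} (h1 : ∀ q : ℚ, (q : ℝ) < t → k q = true)
    (h2 : ∀ q : ℚ, t < q → k q = false) : cutVal k = t := by
  obtain ⟨p, hp⟩ := exists_rat_lt t
  obtain ⟨q, hq⟩ := exists_rat_gt t
  refine le_antisymm (le_of_not_gt fun h => ?_) (le_of_not_gt fun h => ?_)
  · obtain ⟨s, hs, hts⟩ := (hk.lt_cutVal_iff (h2 q hq) (h1 p hp)).mp h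
    rw [h2 s hts] at hs
    exact Bool.noConfusion hs
  · obtain ⟨s, hs, hts⟩ := (hk.cutVal_lt_iff (h2 q hq) (h1 p hp)).mp h
    rw [h1 s hts] at hs
    exact Bool.noConfusion hs

/-- Cuts with the same value differ in at most one rational. -/
theorem eq_of_cutVal_eq (hk : IsCut k) (hl : IsCut l) (h : cutVal k = cutVal l)
    (hq : k q = false) (hq' : l q = true) (hr : k r = false) (hr' : l r = true)
    (hkt : ∃ s, k s = true) (hlf : ∃ s, l s = false) : q = r := by
  obtain ⟨s, hs⟩ := hkt
  obtain ⟨s', hs'⟩ := hlf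
  have h1 := hk.cutVal_le hq hs
  have h2 := hl.le_cutVal hs' hr'
  have h3 := hk.cutVal_le hr hs
  have h4 := hl.le_cutVal hs' hq'
  have h5 : (q : ℝ) = r := by linarith
  exact_mod_cast h5

theorem le_of_cutVal_lt (hk : IsCut k) (hl : IsCut l) (h : cutVal k < cutVal l)
    (hkf : ∃ s, k s = false) (hlt : ∃ s, l s = true) : k ≤ l := by
  intro s
  by_contra hs
  have h1 : k s = true ∧ l s = false := by revert hs; cases k s <;> cases l s <;> simp
  obtain ⟨s₁, h₁⟩ := hkf
  obtain ⟨s₂, h₂⟩ := hlt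
  exact ((hl.cutVal_le h1.2 h₂).trans (hk.le_cutVal h₁ h1.1)).not_gt h

end IsCut

theorem cutVal_cutLE (q : ℚ) : cutVal (cutLE q) = q :=
  (isCut_cutLE q).cutVal_eq (fun r hr => cutLE_eq_true.mpr (by exact_mod_cast hr.le))
    (fun r hr => cutLE_eq_false.mpr (by exact_mod_cast hr))

theorem cutVal_cutLT (q : ℚ) : cutVal (cutLT q) = q :=
  (isCut_cutLT q).cutVal_eq (fun r hr => cutLT_eq_true.mpr (by exact_mod_cast hr))
    (fun r hr => cutLT_eq_false.mpr (by exact_mod_cast hr.le))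

theorem cutLT_le_cutLE (q : ℚ) : cutLT q ≤ cutLE q := fun r => by
  by_cases h : r < q
  · rw [cutLE_eq_true.mpr h.le]; exact Bool.le_true _
  · rw [cutLT_eq_false.mpr (not_lt.mp h)]; exact Bool.false_le _

theorem le_apply {k l : PreCut} (h : k ≤ l) {q : ℚ} (hq : k q = true) : l q = true := by
  have := h q
  rw [hq] at this
  exact top_le_iff.mp this

/-! ### The prespace of the Fraïssé fence -/

/-- The cut `k` lies in all the intervals coded by `c`. -/
def Fits (c : Code) (k : PreCut) : Prop :=
  IsCut k ∧ ∀ n, k (ivl c n).1 = true ∧ k (ivl c n).2 = false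

theorem Fits.lo_le {c : Code} {k : PreCut} (h : Fits c k) : lo c ≤ cutVal k :=
  lo_le_iff.mpr fun n => h.1.le_cutVal (h.2 n).2 (h.2 n).1

theorem Fits.le_hi {c : Code} {k : PreCut} (h : Fits c k) : cutVal k ≤ hi c :=
  le_hi_iff.mpr fun n => h.1.cutVal_le (h.2 n).2 (h.2 n).1

theorem exists_fits {c : Code} {t : ℝ} (h1 : lo c ≤ t) (h2 : t ≤ hi c) :
    ∃ k, Fits c k ∧ cutVal k = t := by
  classical
  -- A fitting cut must contain all left ends and omit all right ends. If `t` is a left end, the cut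
  -- has to contain `t`, and `t` is then not a right end; otherwise the cut omitting `t` always
  -- fits.
  by_cases h : ∃ n, ((ivl c n).1 : ℝ) = t
  · obtain ⟨n, hn⟩ := h
    have hc : IsCut fun q : ℚ => decide ((q : ℝ) ≤ t) := fun q r hqr hr => by
      simp only [decide_eq_true_eq] at *
      exact (Rat.cast_le.mpr hqr).trans hr
    refine ⟨fun q => decide ((q : ℝ) ≤ t), ⟨hc, fun m => ⟨?_, ?_⟩⟩, hc.cutVal_eq ?_ ?_⟩
    · simpa using (ivl_fst_le_lo c m).trans h1
    · simpa [← hn] using ivl_fst_lt_snd c n m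
    · intro q hq; simpa using hq.le
    · intro q hq; simpa using hq
  · have hc : IsCut fun q : ℚ => decide ((q : ℝ) < t) := fun q r hqr hr => by
      simp only [decide_eq_true_eq] at *
      exact (Rat.cast_le.mpr hqr).trans_lt hr
    refine ⟨fun q => decide ((q : ℝ) < t), ⟨hc, fun m => ⟨?_, ?_⟩⟩, hc.cutVal_eq ?_ ?_⟩
    · simpa using ((ivl_fst_le_lo c m).trans h1).lt_of_ne fun h' => h ⟨m, h'⟩
    · simpa using h2.trans (hi_le_ivl_snd c m)
    · intro q hq; simpa using hq
    · intro q hq; simpa using hq.le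

theorem continuous_apply_ivl {f : Code → ℚ} (hf : IsLocallyConstant f) :
    Continuous fun p : Code × PreCut => p.2 (f p.1) := by
  refine continuous_iff_continuousAt.mpr fun p => ?_
  have h1 : ContinuousAt (fun x : Code × PreCut => x.2 (f p.1)) p := by fun_prop
  refine h1.congr ?_
  have h2 : {c | f c = f p.1} ∈ 𝓝 p.1 := (hf.isOpen_fiber _).mem_nhds rfl
  filter_upwards [continuousAt_fst.preimage_mem_nhds h2] with x hx
  rw [show f x.1 = f p.1 from hx]

theorem isLocallyConstant_ivl (n : ℕ) : IsLocallyConstant fun c : Code => ivl c n :=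
  (IsLocallyConstant.iff_exists_open _).mpr fun c =>
    ⟨_, (isClopen_cylinder c n).isOpen, PiNat.self_mem_cylinder c n, fun _ hd => ivl_congr hd⟩

theorem isClosed_fits : IsClosed {p : Code × PreCut | Fits p.1 p.2} := by
  have h1 : IsClosed {p : Code × PreCut | IsCut p.2} := by
    simp only [IsCut, Set.ofPred_forall]
    refine isClosed_iInter fun q => isClosed_iInter fun r => isClosed_iInter fun _ => ?_
    have : Continuous fun p : Code × PreCut => (p.2 r, p.2 q) := by fun_prop
    exact (isClosed_discrete {x : Bool × Bool | x.1 = true → x.2 = true}).preimage this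
  refine h1.inter ?_
  rw [show (fun p : Code × PreCut => ∀ n, p.2 (ivl p.1 n).1 = true ∧ p.2 (ivl p.1 n).2 = false) =
    {p : Code × PreCut | ∀ n, p.2 (ivl p.1 n).1 = true ∧ p.2 (ivl p.1 n).2 = false} from rfl]
  simp only [Set.ofPred_forall]
  refine isClosed_iInter fun n => IsClosed.inter ?_ ?_
  · exact isClosed_eq (continuous_apply_ivl ((isLocallyConstant_ivl n).comp Prod.fst))
      continuous_const
  · exact isClosed_eq (continuous_apply_ivl ((isLocallyConstant_ivl n).comp Prod.snd))
      continuous_const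

/-- The points of the prespace: codes together with fitting cuts. -/
abbrev PrefencePt : Type := {p : Code × PreCut // Fits p.1 p.2}

theorem continuous_cutVal : Continuous fun x : PrefencePt => cutVal x.1.2 := by
  refine continuous_iff_continuousAt.mpr fun x => tendsto_order.mpr ⟨fun t ht => ?_, fun t ht => ?_⟩
  · obtain ⟨s, hs, hts⟩ := (x.2.1.lt_cutVal_iff (x.2.2 0).2 (x.2.2 0).1).mp ht
    have : {y : PrefencePt | y.1.2 s = true} ∈ 𝓝 x :=
      ((isOpen_discrete {true}).preimage
        (by fun_prop : Continuous fun y : PrefencePt => y.1.2 s)).mem_nhds hs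
    filter_upwards [this] with y hy
    exact (y.2.1.lt_cutVal_iff (y.2.2 0).2 (y.2.2 0).1).mpr ⟨s, hy, hts⟩
  · obtain ⟨s, hs, hts⟩ := (x.2.1.cutVal_lt_iff (x.2.2 0).2 (x.2.2 0).1).mp ht
    have : {y : PrefencePt | y.1.2 s = false} ∈ 𝓝 x :=
      ((isOpen_discrete {false}).preimage
        (by fun_prop : Continuous fun y : PrefencePt => y.1.2 s)).mem_nhds hs
    filter_upwards [this] with y hy
    exact (y.2.1.cutVal_lt_iff (y.2.2 0).2 (y.2.2 0).1).mpr ⟨s, hy, hts⟩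

/-- The prespace of the Fraïssé fence. -/
noncomputable def prefence : TopStructure.{0} where
  carrier := PrefencePt
  metrizable := IsEmbedding.subtypeVal.metrizableSpace
  compact := isCompact_iff_compactSpace.mp isClosed_fits.isCompact
  zeroDim := by
    have : HasSmallInductiveDimensionLE Code 0 := hasSmallInductiveDimensionLE_zero_pi
    have : HasSmallInductiveDimensionLE PreCut 0 := hasSmallInductiveDimensionLE_zero_pi
    have : HasSmallInductiveDimensionLE (Code × PreCut) 0 := hasSmallInductiveDimensionLE_zero_prod
    exact hasSmallInductiveDimensionLE_zero_of_isInducing IsInducing.subtypeVal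
  R x y := x.1.1 = y.1.1 ∧ cutVal x.1.2 = cutVal y.1.2
  le x y := x.1.1 = y.1.1 ∧ x.1.2 ≤ y.1.2
  isClosed_R := (isClosed_eq (by fun_prop) (by fun_prop)).inter
    (isClosed_eq (continuous_cutVal.comp continuous_fst) (continuous_cutVal.comp continuous_snd))
  isClosed_le := (isClosed_eq (by fun_prop) (by fun_prop)).inter (by
    have : {x : PrefencePt × PrefencePt | x.1.1.2 ≤ x.2.1.2} =
        ⋂ q, {x : PrefencePt × PrefencePt | x.1.1.2 q ≤ x.2.1.2 q} := by
      ext x; simp [Pi.le_def]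
    change IsClosed {x : PrefencePt × PrefencePt | x.1.1.2 ≤ x.2.1.2}
    rw [this]
    refine isClosed_iInter fun q => ?_
    have : Continuous fun p : PrefencePt × PrefencePt => (p.1.1.2 q, p.2.1.2 q) := by fun_prop
    exact (isClosed_discrete {x : Bool × Bool | x.1 ≤ x.2}).preimage this)

/-! ### Finite Hasse forests -/

section HPO

variable {P : TopStructure.{u}}

theorem IsHPO.nextOrEq_refl (hP : IsHPO P) (a : P) : P.NextOrEq a a :=
  ⟨hP.refl a, fun _ h1 h2 => Or.inl (hP.antisymm _ _ h2 h1)⟩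

theorem IsHPO.nextOrEq_of_R_of_le (hP : IsHPO P) {a b : P} (hR : P.R a b) (hle : P.le a b) :
    P.NextOrEq a b := by
  rcases (hP.R_iff a b).mp hR with rfl | h | h
  · exact hP.nextOrEq_refl a
  · exact h
  · rw [hP.antisymm _ _ hle h.1]
    exact hP.nextOrEq_refl b

theorem IsHPO.R_of_nextOrEq (hP : IsHPO P) {a b : P} (h : P.NextOrEq a b) : P.R a b :=
  (hP.R_iff a b).mpr (Or.inr (Or.inl h))

theorem IsHPO.R_symm (hP : IsHPO P) {a b : P} (h : P.R a b) : P.R b a := by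
  rw [hP.R_iff] at h ⊢
  tauto

theorem IsHPO.reflTransGen_nextOrEq [Finite P] (hP : IsHPO P) {a b : P} (h : P.le a b) :
    Relation.ReflTransGen P.NextOrEq a b := by
  let : PartialOrder P :=
    { le := P.le, le_refl := hP.refl, le_trans := hP.trans, le_antisymm := hP.antisymm }
  let := Fintype.ofFinite P
  let : LocallyFiniteOrder P := by classical exact Fintype.toLocallyFiniteOrder
  have h' : Relation.ReflTransGen (fun x y : P => x ⋖ y) a b :=
    le_iff_reflTransGen_covBy.mp (show a ≤ b from h)
  have hcov : ∀ x y : P, x ⋖ y → P.NextOrEq x y := fun x y hxy =>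
    ⟨hxy.le, fun c hxc hcy => hxy.eq_or_eq hxc hcy⟩
  clear h
  induction h' with
  | refl => exact .refl
  | tail _ h ih => exact ih.tail (hcov _ _ h)

/-- In a finite Hasse forest, a point has only one immediate predecessor above a given point. -/
theorem IsFiniteHForest.eq_of_nextOrEq (hP : IsFiniteHForest P) {p x y z : P} (hpx : P.le p x)
    (hxy : P.NextOrEq x y) (hxy' : x ≠ y) (hpz : P.le p z) (hzy : P.NextOrEq z y) (hzy' : z ≠ y) :
    x = z := by
  have := hP.finite
  have hO := hP.hpo
  by_contra hxz
  let G := SimpleGraph.fromRel P.R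
  have hadj : ∀ {u w : P}, P.NextOrEq u w → u ≠ w → G.Adj u w := fun h hne =>
    (SimpleGraph.fromRel_adj _ _ _).mpr ⟨hne, Or.inl (hO.R_of_nextOrEq h)⟩
  have hbridge : G.IsBridge s(x, y) :=
    SimpleGraph.isAcyclic_iff_forall_isBridge.mp hP.acyclic (hadj hxy hxy')
  rw [SimpleGraph.isBridge_iff] at hbridge
  -- A chain of covers from `p` to a point not above `y` never meets `y`, so it survives the removal
  -- of the edge `xy`. Both `x` and `z` are such points, so `x`, `p`, `z`, `y` would give a detour
  -- around a bridge.
  have key : ∀ {q : P}, P.le p q → ¬ P.le y q → (G.deleteEdges {s(x, y)}).Reachable p q := by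
    intro q hpq
    have hchain := hO.reflTransGen_nextOrEq hpq
    clear hpq
    induction hchain with
    | refl => exact fun _ => SimpleGraph.Reachable.refl _
    | @tail u w _ huw ih =>
      intro hyw
      have hyu : ¬ P.le y u := fun h => hyw (hO.trans _ _ _ h huw.1)
      by_cases huw' : u = w
      · exact huw' ▸ ih hyu
      refine (ih hyu).trans (SimpleGraph.Adj.reachable ?_)
      rw [SimpleGraph.deleteEdges_adj]
      refine ⟨hadj huw huw', fun h => ?_⟩
      rcases Sym2.eq_iff.mp (Set.mem_singleton_iff.mp h) with ⟨-, rfl⟩ | ⟨rfl, -⟩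
      · exact hyw (hO.refl _)
      · exact hyu (hO.refl _)
  have hx := key hpx fun h => hxy' (hO.antisymm _ _ hxy.1 h)
  have hz := key hpz fun h => hzy' (hO.antisymm _ _ hzy.1 h)
  refine hbridge (hx.symm.trans (hz.trans (SimpleGraph.Adj.reachable ?_)))
  rw [SimpleGraph.deleteEdges_adj]
  refine ⟨hadj hzy hzy', fun h => ?_⟩
  rcases Sym2.eq_iff.mp (Set.mem_singleton_iff.mp h) with ⟨h, -⟩ | ⟨h, -⟩
  · exact hxz h.symm
  · exact hzy' h

/-- When the predecessors of each point form a chain, the up-set of `y` can be entered from outside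
only at `y`, from its unique immediate predecessor `x`. A walk from `x` that avoids the edge `xy`
therefore never reaches `y`, and every edge is a bridge. -/
theorem IsHPO.isAcyclic (hP : IsHPO P)
    (hlin : ∀ x y z : P, P.le x z → P.le y z → P.le x y ∨ P.le y x) :
    (SimpleGraph.fromRel P.R).IsAcyclic := by
  rw [SimpleGraph.isAcyclic_iff_forall_isBridge]
  have key : ∀ x y : P, P.NextOrEq x y → x ≠ y →
      ¬ ((SimpleGraph.fromRel P.R).deleteEdges {s(x, y)}).Reachable x y := by
    intro x y hxy hne hreach
    have hclosed : ∀ z, Relation.ReflTransGen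
        ((SimpleGraph.fromRel P.R).deleteEdges {s(x, y)}).Adj x z → ¬ P.le y z := by
      intro z hz
      induction hz with
      | refl => exact fun h => hne (hP.antisymm _ _ hxy.1 h)
      | @tail u w _ huw ih =>
        intro hyw
        rw [SimpleGraph.deleteEdges_adj, SimpleGraph.fromRel_adj] at huw
        obtain ⟨⟨huw', hR⟩, he⟩ := huw
        have hR' : P.R u w := hR.elim id hP.R_symm
        rcases (hP.R_iff u w).mp hR' with h | h | h
        · exact huw' h
        · rcases hlin u y w h.1 hyw with h1 | h1
          · rcases h.2 y h1 hyw with h2 | h2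
            · exact ih (h2 ▸ hP.refl _)
            · subst h2
              rcases hlin u x y h.1 hxy.1 with h3 | h3
              · rcases h.2 x h3 hxy.1 with h4 | h4
                · exact he (by rw [h4]; rfl)
                · exact hne h4
              · rcases hxy.2 u h3 h.1 with h4 | h4
                · exact he (by rw [h4]; rfl)
                · exact huw' h4
          · exact ih h1
        · exact ih (hP.trans _ _ _ hyw h.1)
    exact hclosed y ((SimpleGraph.reachable_iff_reflTransGen _ _).mp hreach) (hP.refl y)
  intro e he
  induction e with
  | h x y =>
    rw [SimpleGraph.mem_edgeSet, SimpleGraph.fromRel_adj] at he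
    obtain ⟨hne, hR⟩ := he
    have hR' : P.R x y := hR.elim id hP.R_symm
    rw [SimpleGraph.isBridge_iff]
    rcases (hP.R_iff x y).mp hR' with h | h | h
    · exact absurd h hne
    · exact key x y h hne
    · intro hr
      rw [Sym2.eq_swap] at hr
      exact key y x h hne.symm hr.symm

end HPO

/-! ### Step maps on cuts -/

/-- `IsStepMap P a x₀ ψ τ x`: the map `ψ` climbs in `P` from `x₀` to `x`, each step being taken when
a cut passes one of finitely many rational thresholds in `(a, τ]`. -/
inductive IsStepMap (P : TopStructure.{u}) (a : ℚ) (x₀ : P) : (PreCut → P) → ℚ → P → Prop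
  | const : IsStepMap P a x₀ (fun _ => x₀) a x₀
  | step {ψ : PreCut → P} {τ : ℚ} {x : P} (h : ℚ) (y : P) : IsStepMap P a x₀ ψ τ x → τ < h →
      P.NextOrEq x y → IsStepMap P a x₀ (fun k => if k h = true then y else ψ k) h y

namespace IsStepMap

variable {P : TopStructure.{u}} {a τ : ℚ} {x₀ x : P} {ψ : PreCut → P}

theorem le_threshold (h : IsStepMap P a x₀ ψ τ x) : a ≤ τ := by
  induction h with
  | const => exact le_rfl
  | step _ _ _ h1 _ ih => exact ih.trans h1.le

theorem apply_of_true (h : IsStepMap P a x₀ ψ τ x) {k : PreCut} (hk : k τ = true) : ψ k = x := by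
  cases h with
  | const => rfl
  | step _ _ _ _ _ => exact if_pos hk

theorem apply_of_false (h : IsStepMap P a x₀ ψ τ x) {k : PreCut}
    (hk : ∀ q, a < q → k q = false) : ψ k = x₀ := by
  induction h with
  | const => rfl
  | step q _ h' h1 _ ih =>
    dsimp only
    rw [if_neg (by rw [hk q (h'.le_threshold.trans_lt h1)]; simp), ih]

theorem start_le_end (hP : IsHPO P) (h : IsStepMap P a x₀ ψ τ x) : P.le x₀ x := by
  induction h with
  | const => exact hP.refl _
  | step _ _ _ _ h2 ih => exact hP.trans _ _ _ ih h2.1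

theorem start_le (hP : IsHPO P) (h : IsStepMap P a x₀ ψ τ x) (k : PreCut) : P.le x₀ (ψ k) := by
  induction h with
  | const => exact hP.refl _
  | step _ _ h' _ h2 ih =>
    dsimp only
    split_ifs
    · exact hP.trans _ _ _ (h'.start_le_end hP) h2.1
    · exact ih

theorem le_end (hP : IsHPO P) (h : IsStepMap P a x₀ ψ τ x) (k : PreCut) : P.le (ψ k) x := by
  induction h with
  | const => exact hP.refl _
  | step _ _ h' _ h2 ih =>
    dsimp only
    split_ifs
    · exact hP.refl _
    · exact hP.trans _ _ _ ih h2.1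

theorem le_apply_apply (hP : IsHPO P) (h : IsStepMap P a x₀ ψ τ x) {k l : PreCut} (hkl : k ≤ l) :
    P.le (ψ k) (ψ l) := by
  induction h with
  | const => exact hP.refl _
  | step q _ h' _ h2 ih =>
    dsimp only
    by_cases hl : l q = true
    · rw [if_pos hl]
      split_ifs
      · exact hP.refl _
      · exact hP.trans _ _ _ (h'.le_end hP k) h2.1
    · rw [if_neg hl, if_neg fun h => hl (le_apply hkl h)]
      exact ih

/-- Cuts with the same value differ in at most one rational, so at most one threshold is passed
between them and the map makes at most one step. -/
theorem R_apply_apply_of_le (hP : IsHPO P) (h : IsStepMap P a x₀ ψ τ x) {k l : PreCut}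
    (hk : IsCut k) (hl : IsCut l) (hkl : k ≤ l) (hval : cutVal k = cutVal l)
    (hkt : ∃ s, k s = true) (hlf : ∃ s, l s = false) : P.R (ψ k) (ψ l) := by
  induction h with
  | const => exact hP.R_of_nextOrEq (hP.nextOrEq_refl _)
  | @step ψ τ x q y h' h1 h2 ih =>
    dsimp only
    by_cases hlq : l q = true
    · by_cases hkq : k q = true
      · rw [if_pos hlq, if_pos hkq]
        exact hP.R_of_nextOrEq (hP.nextOrEq_refl _)
      · rw [if_pos hlq, if_neg hkq, h'.apply_of_true (k := k)]
        · exact hP.R_of_nextOrEq h2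
        · by_contra hkτ
          exact h1.ne (hk.eq_of_cutVal_eq hl hval (Bool.not_eq_true _ ▸ hkτ) (hl _ _ h1.le hlq)
            (Bool.not_eq_true _ ▸ hkq) hlq hkt hlf)
    · rw [if_neg hlq, if_neg fun h => hlq (le_apply hkl h)]
      exact ih

theorem R_apply_apply (hP : IsHPO P) (h : IsStepMap P a x₀ ψ τ x) {k l : PreCut}
    (hk : IsCut k) (hl : IsCut l) (hval : cutVal k = cutVal l)
    (hkt : ∃ s, k s = true) (hkf : ∃ s, k s = false) (hlt : ∃ s, l s = true)
    (hlf : ∃ s, l s = false) : P.R (ψ k) (ψ l) := by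
  rcases hk.le_total hl with hkl | hkl
  · exact h.R_apply_apply_of_le hP hk hl hkl hval hkt hlf
  · exact hP.R_symm (h.R_apply_apply_of_le hP hl hk hkl hval.symm hlt hkf)

theorem continuous [Finite P] (h : IsStepMap P a x₀ ψ τ x) : Continuous ψ := by
  induction h with
  | const => exact continuous_const
  | step q y _ _ _ ih =>
    have h1 : Continuous fun p : Bool × P => if p.1 = true then y else p.2 :=
      continuous_of_discreteTopology
    exact h1.comp ((continuous_apply q).prodMk ih)

/-- A climb between two adjacent points has exactly one nontrivial step. The two cuts at its
threshold have the same value, so they provide an `R`-related pair over the two points. -/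
theorem exists_jump (h : IsStepMap P a x₀ ψ τ x) (hP : IsHPO P) (hne : x₀ ≠ x)
    (hx : P.NextOrEq x₀ x) : ∃ q, a < q ∧ q ≤ τ ∧ ψ (cutLT q) = x₀ ∧ ψ (cutLE q) = x := by
  induction h with
  | const => exact absurd rfl hne
  | @step ψ τ x q y h' h1 h2 ih =>
    rcases hx.2 x (h'.start_le_end hP) h2.1 with h3 | h3
    · subst h3
      refine ⟨q, h'.le_threshold.trans_lt h1, le_rfl, ?_, if_pos (by simp)⟩
      dsimp only
      rw [if_neg (by simp), h'.apply_of_true (by simpa using h1)]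
    · subst h3
      obtain ⟨r, hr1, hr2, hr3, hr4⟩ := ih hne hx
      refine ⟨r, hr1, (hr2.trans_lt h1).le, ?_, ?_⟩
      · dsimp only
        rw [if_neg (by simpa using (hr2.trans_lt h1).le), hr3]
      · dsimp only
        rw [if_neg (by simpa using hr2.trans_lt h1), hr4]

end IsStepMap

/-- The cut `k` lies between the rationals `a` and `b`. -/
def Between (a b : ℚ) (k : PreCut) : Prop := IsCut k ∧ k a = true ∧ k b = false

/-- Induction on the largest rational `h` that matters. If `h` is outside `(a, b)` it has no
influence. Otherwise the cuts omitting `h` are covered by the induction hypothesis on `(a, h)`,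
while all cuts containing `h` have the same image. The passage from one kind to the other is a
single step, since `cutLT h` and `cutLE h` have the same value. -/
theorem exists_isStepMap {P : TopStructure.{u}} (hP : IsHPO P) (S : Finset ℚ) {a b : ℚ}
    (hab : a < b) (Φ : PreCut → P)
    (hdep : ∀ k l, Between a b k → Between a b l → (∀ q ∈ S, k q = l q) → Φ k = Φ l)
    (hmono : ∀ k l, Between a b k → Between a b l → k ≤ l → P.le (Φ k) (Φ l))
    (hR : ∀ k l, Between a b k → Between a b l → cutVal k = cutVal l → P.R (Φ k) (Φ l)) :
    ∃ ψ τ x, IsStepMap P a (Φ (cutLE a)) ψ τ x ∧ τ < b ∧ ∀ k, Between a b k → ψ k = Φ k := by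
  have hba : ∀ q, a ≤ q → q < b → Between a b (cutLE q) := fun q h1 h2 =>
    ⟨isCut_cutLE q, by simpa, by simpa⟩
  induction S using Finset.induction_on_max generalizing b with
  | empty =>
    refine ⟨_, _, _, IsStepMap.const, hab, fun k hk => ?_⟩
    exact hdep _ _ (hba a le_rfl hab) hk (by simp)
  | insert h S hS ih =>
    rcases le_or_gt b h with hbh | hbh
    · refine ih hab (fun k l hk hl hkl => hdep k l hk hl fun q hq => ?_) hmono hR hba
      rcases Finset.mem_insert.mp hq with rfl | hq
      · have h1 : ∀ {k}, Between a b k → k q = false := fun {k} hk => by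
          by_contra hkq
          have := hk.1 _ _ hbh ((Bool.not_eq_false _).mp hkq)
          simp [hk.2.2] at this
        rw [h1 hk, h1 hl]
      · exact hkl q hq
    rcases le_or_gt h a with hha | hha
    · refine ih hab (fun k l hk hl hkl => hdep k l hk hl fun q hq => ?_) hmono hR hba
      rcases Finset.mem_insert.mp hq with rfl | hq
      · rw [hk.1 _ _ hha hk.2.1, hl.1 _ _ hha hl.2.1]
      · exact hkl q hq
    have hsub : ∀ {k}, Between a h k → Between a b k := fun {k} hk => ⟨hk.1, hk.2.1, by
      by_contra hkb
      have := hk.1 _ _ hbh.le ((Bool.not_eq_false _).mp hkb)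
      simp [hk.2.2] at this⟩
    obtain ⟨ψ, τ, x, hψ, hτ, heq⟩ := ih hha
      (fun k l hk hl hkl => hdep k l (hsub hk) (hsub hl) fun q hq => by
        rcases Finset.mem_insert.mp hq with rfl | hq
        · rw [hk.2.2, hl.2.2]
        · exact hkl q hq)
      (fun k l hk hl => hmono k l (hsub hk) (hsub hl))
      (fun k l hk hl => hR k l (hsub hk) (hsub hl))
      (fun q h1 h2 => ⟨isCut_cutLE q, by simpa, by simpa⟩)
    have hlt : Between a h (cutLT h) := ⟨isCut_cutLT h, by simpa, by simp⟩
    have hx : x = Φ (cutLT h) := by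
      rw [← heq _ hlt, hψ.apply_of_true (by simpa using hτ)]
    have hle : Between a b (cutLE h) := hba h hha.le hbh
    refine ⟨_, _, _, IsStepMap.step h (Φ (cutLE h)) hψ hτ (hx ▸ hP.nextOrEq_of_R_of_le ?_ ?_),
      hbh, fun k hk => ?_⟩
    · exact hR _ _ (hsub hlt) hle (by rw [cutVal_cutLE, cutVal_cutLT])
    · exact hmono _ _ (hsub hlt) hle (cutLT_le_cutLE h)
    · split_ifs with hkh
      · refine hdep _ _ hle hk fun q hq => ?_
        have hqh : q ≤ h := by
          rcases Finset.mem_insert.mp hq with rfl | hq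
          exacts [le_rfl, (hS q hq).le]
        rw [hk.1 _ _ hqh hkh]
        simpa using hqh
      · exact heq k ⟨hk.1, hk.2.1, (Bool.not_eq_true _).mp hkh⟩

/-- Step maps lift along maps onto Hasse forests, as soon as their ends do. -/
theorem IsStepMap.exists_lift {A : TopStructure.{u}} {B : TopStructure.{v}}
    (hA : IsFiniteHForest A) {g : B → A} (hB : IsHPO B) (hgR : ∀ b b', B.R b b' → A.R (g b) (g b'))
    (hgle : ∀ b b', B.le b b' → A.le (g b) (g b')) {a : ℚ} {b₀ b : B}
    (hchain : Relation.ReflTransGen B.NextOrEq b₀ b) {φ : PreCut → A} {τ : ℚ}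
    (hφ : IsStepMap A a (g b₀) φ τ (g b)) {c : ℚ} (hc : τ < c) :
    ∃ ψ τ', IsStepMap B a b₀ ψ τ' b ∧ τ' < c ∧ ∀ k, IsCut k → g (ψ k) = φ k := by
  have hO := hA.hpo
  induction hchain generalizing φ τ c with
  | refl =>
    refine ⟨_, _, .const, hφ.le_threshold.trans_lt hc, fun k _ => ?_⟩
    exact hO.antisymm _ _ (hφ.start_le hO k) (hφ.le_end hO k)
  | @tail b₁ b hch hnext ih =>
    have hle₁ : A.le (g b₀) (g b₁) := by
      have : B.le b₀ b₁ := by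
        clear ih hφ hnext
        induction hch with
        | refl => exact hB.refl _
        | tail _ h ih => exact hB.trans _ _ _ ih h.1
      exact hgle _ _ this
    -- A last step of `B` that `g` collapses is taken at an additional threshold above `τ`, where
    -- `φ` has already reached its end.
    by_cases hgb : g b₁ = g b
    · rw [← hgb] at hφ
      obtain ⟨ψ, τ', hψ, hτ', heq⟩ := ih hφ hc
      obtain ⟨h, hh1, hh2⟩ := exists_between (max_lt hc hτ')
      refine ⟨_, _, .step h b hψ ((le_max_right _ _).trans_lt hh1) hnext, hh2, fun k hk => ?_⟩
      split_ifs with hkh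
      · rw [← hgb, hφ.apply_of_true (hk _ _ ((le_max_left _ _).trans_lt hh1).le hkh)]
      · exact heq k hk
    · have hgnext : A.NextOrEq (g b₁) (g b) :=
        hO.nextOrEq_of_R_of_le (hgR _ _ (hB.R_of_nextOrEq hnext)) (hgle _ _ hnext.1)
      -- Otherwise the last step of `B` must lie over the last nontrivial step of `φ`. The inner
      -- induction discards the trivial final steps of `φ`; the nontrivial one starts at `g b₁`,
      -- because in a forest `g b` has only one immediate predecessor above `g b₀`.
      generalize hy : g b = y at hφ
      induction hφ generalizing c with
      | const => exact absurd (hO.antisymm _ _ hgnext.1 (hy ▸ hle₁)) hgb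
      | @step φ τ x h y hφ' hτh hxy ih' =>
        by_cases hxy' : x = y
        · obtain ⟨ψ, τ', hψ, hτ', heq⟩ := ih' (hτh.trans hc) (hy.trans hxy'.symm)
          refine ⟨ψ, τ', hψ, hτ', fun k hk => ?_⟩
          rw [heq k hk]
          dsimp only
          split_ifs with hkh
          · rw [hφ'.apply_of_true (hk _ _ hτh.le hkh), hxy']
          · rfl
        · have hx : x = g b₁ := by
            subst hy
            exact hA.eq_of_nextOrEq (hφ'.start_le_end hO) hxy hxy' hle₁ hgnext hgb
          subst hx
          obtain ⟨ψ, τ', hψ, hτ', heq⟩ := ih hφ' hτh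
          refine ⟨_, _, .step h b hψ hτ' hnext, hc, fun k hk => ?_⟩
          dsimp only
          split_ifs
          · exact hy
          · exact heq k hk

/-! ### The extension property of the prespace -/

theorem fits_trunc {c : Code} {n : ℕ} {k : PreCut}
    (h : Between (ivl c n).1 (ivl c n).2 k) : Fits (trunc c n) k := by
  refine ⟨h.1, fun m => ?_⟩
  obtain ⟨h1, h2⟩ : (ivl (trunc c n) m).1 ≤ (ivl c n).1 ∧ (ivl c n).2 ≤ (ivl (trunc c n) m).2 := by
    have h1 := lo_trunc c n ▸ ivl_fst_le_lo (trunc c n) m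
    have h2 := hi_trunc c n ▸ hi_le_ivl_snd (trunc c n) m
    exact ⟨by exact_mod_cast h1, by exact_mod_cast h2⟩
  refine ⟨h.1 _ _ h1 h.2.1, ?_⟩
  by_contra hk
  have := h.1 _ _ h2 ((Bool.not_eq_false _).mp hk)
  simp [h.2.2] at this

theorem between_of_mem_cylinder {c : Code} {n : ℕ} {x : PrefencePt}
    (h : x.1.1 ∈ PiNat.cylinder c n) : Between (ivl c n).1 (ivl c n).2 x.1.2 := by
  have := x.2.2 n
  rw [ivl_congr h] at this
  exact ⟨x.2.1, this⟩

theorem agreement_mem_nhds (x : PrefencePt) (n : ℕ) (S : Finset ℚ) :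
    {y : PrefencePt | y.1.1 ∈ PiNat.cylinder x.1.1 n ∧ ∀ q ∈ S, y.1.2 q = x.1.2 q} ∈ 𝓝 x := by
  refine Filter.inter_mem ?_ ?_
  · exact (by fun_prop : Continuous fun y : PrefencePt => y.1.1).continuousAt.preimage_mem_nhds
      ((isClopen_cylinder _ _).isOpen.mem_nhds (PiNat.self_mem_cylinder _ _))
  · refine (Filter.eventually_all_finset S).mpr fun q _ => ?_
    exact ((isOpen_discrete {x.1.2 q}).preimage
      (by fun_prop : Continuous fun y : PrefencePt => y.1.2 q)).mem_nhds rfl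

/-- A Lebesgue number argument for the basic neighbourhoods given by finitely many digits and
finitely many rationals. -/
theorem exists_uniform_refinement {𝒰 : Set (Set PrefencePt)} (hopen : ∀ V ∈ 𝒰, IsOpen V)
    (hcover : ⋃₀ 𝒰 = Set.univ) :
    ∃ (n : ℕ) (S : Finset ℚ), ∀ x : PrefencePt, ∃ V ∈ 𝒰, ∀ y : PrefencePt,
      y.1.1 ∈ PiNat.cylinder x.1.1 n → (∀ q ∈ S, y.1.2 q = x.1.2 q) → y ∈ V := by
  have hloc : ∀ x : PrefencePt, ∃ (n : ℕ) (S : Finset ℚ), ∃ V ∈ 𝒰, ∀ y : PrefencePt,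
      y.1.1 ∈ PiNat.cylinder x.1.1 n → (∀ q ∈ S, y.1.2 q = x.1.2 q) → y ∈ V := by
    intro x
    obtain ⟨V, hV, hxV⟩ := Set.mem_sUnion.mp (hcover ▸ Set.mem_univ x)
    obtain ⟨W, hW, rfl⟩ := isOpen_induced_iff.mp (hopen V hV)
    obtain ⟨A, B, hA, hB, hxA, hxB, hAB⟩ := isOpen_prod_iff.mp hW x.1.1 x.1.2 hxV
    obtain ⟨n, hn⟩ := exists_cylinder_subset (hA.mem_nhds hxA)
    obtain ⟨S, t, ht, hS⟩ := isOpen_pi_iff.mp hB _ hxB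
    refine ⟨n, S, _, hV, fun y hy1 hy2 => hAB ⟨hn hy1, hS fun q hq => ?_⟩⟩
    rw [hy2 q hq]
    exact (ht q hq).2
  choose n S V hV hVs using hloc
  have : CompactSpace PrefencePt := isCompact_iff_compactSpace.mp isClosed_fits.isCompact
  obtain ⟨t, -, ht⟩ := isCompact_univ.elim_nhds_subcover _ fun x _ =>
    agreement_mem_nhds x (n x) (S x)
  refine ⟨t.sup n, t.biUnion S, fun x => ?_⟩
  obtain ⟨z, hz, hxz⟩ := Set.mem_iUnion₂.mp (ht (Set.mem_univ x))
  refine ⟨V z, hV z, fun y hy1 hy2 => hVs z y ?_ fun q hq => ?_⟩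
  · intro i hi
    exact (hy1 i (hi.trans_le (Finset.le_sup (f := n) hz))).trans (hxz.1 i hi)
  · rw [hy2 q (Finset.mem_biUnion.mpr ⟨z, hz, hq⟩), hxz.2 q hq]

theorem exists_uniform_agreement {A : Type v} [TopologicalSpace A] [DiscreteTopology A]
    {φ : PrefencePt → A} (hφ : Continuous φ) :
    ∃ (n : ℕ) (S : Finset ℚ), ∀ x y : PrefencePt, y.1.1 ∈ PiNat.cylinder x.1.1 n →
      (∀ q ∈ S, y.1.2 q = x.1.2 q) → φ y = φ x := by
  obtain ⟨n, S, h⟩ := exists_uniform_refinement (𝒰 := Set.range fun a => φ ⁻¹' {a})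
    (by rintro _ ⟨a, rfl⟩; exact (isOpen_discrete _).preimage hφ)
    (Set.eq_univ_of_forall fun x => ⟨_, ⟨φ x, rfl⟩, rfl⟩)
  refine ⟨n, S, fun x y h1 h2 => ?_⟩
  obtain ⟨_, ⟨a, rfl⟩, ha⟩ := h x
  exact (ha y h1 h2).trans (ha x (PiNat.self_mem_cylinder _ _) fun _ _ => rfl).symm

/-- Continuous and preserving both relations. -/
structure IsHom {B : TopStructure.{v}} (ψ : PrefencePt → B) : Prop where
  continuous : Continuous ψ
  map_R : ∀ x y : PrefencePt, prefence.R x y → B.R (ψ x) (ψ y)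
  map_le : ∀ x y : PrefencePt, prefence.le x y → B.le (ψ x) (ψ y)

/-- Both relations of the prespace hold only between points over the same code, so maps may be
pasted along a clopen partition of the codes. -/
theorem IsHom.of_local {B : TopStructure.{v}} {ψ : PrefencePt → B}
    (h : ∀ c : Code, ∃ m, ∃ χ : PrefencePt → B, IsHom χ ∧
      ∀ x : PrefencePt, x.1.1 ∈ PiNat.cylinder c m → ψ x = χ x) : IsHom ψ := by
  refine ⟨continuous_iff_continuousAt.mpr fun x => ?_, fun x y hxy => ?_, fun x y hxy => ?_⟩
  · obtain ⟨m, χ, hχ, heq⟩ := h x.1.1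
    refine hχ.continuous.continuousAt.congr ?_
    have : x.1.1 ∈ PiNat.cylinder x.1.1 m := PiNat.self_mem_cylinder _ _
    filter_upwards [(by fun_prop : Continuous fun y : PrefencePt => y.1.1).continuousAt
      |>.preimage_mem_nhds ((isClopen_cylinder _ _).isOpen.mem_nhds this)] with y hy
    exact (heq y hy).symm
  · obtain ⟨m, χ, hχ, heq⟩ := h x.1.1
    rw [heq x (PiNat.self_mem_cylinder _ _), heq y (hxy.1 ▸ PiNat.self_mem_cylinder _ _)]
    exact hχ.map_R x y hxy
  · obtain ⟨m, χ, hχ, heq⟩ := h x.1.1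
    rw [heq x (PiNat.self_mem_cylinder _ _), heq y (hxy.1 ▸ PiNat.self_mem_cylinder _ _)]
    exact hχ.map_le x y hxy

theorem IsStepMap.isHom {B : TopStructure.{v}} [Finite B] (hB : IsHPO B) {a τ : ℚ} {b₀ b : B}
    {ψ : PreCut → B} (h : IsStepMap B a b₀ ψ τ b) : IsHom fun x : PrefencePt => ψ x.1.2 where
  continuous := h.continuous.comp (by fun_prop)
  map_R x y hxy := h.R_apply_apply hB x.2.1 y.2.1 hxy.2 ⟨_, (x.2.2 0).1⟩ ⟨_, (x.2.2 0).2⟩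
    ⟨_, (y.2.2 0).1⟩ ⟨_, (y.2.2 0).2⟩
  map_le x y hxy := h.le_apply_apply hB hxy.2

theorem IsEpimorphism.isHom {B : TopStructure.{v}} {φ : PrefencePt → B}
    (h : IsEpimorphism (A := prefence) φ) : IsHom φ where
  continuous := h.continuous
  map_R x y hxy := (h.R_iff _ _).mpr ⟨x, y, rfl, rfl, hxy⟩
  map_le x y hxy := (h.le_iff _ _).mpr ⟨x, y, rfl, rfl, hxy⟩

/-- A point over the center of a cylinder. -/
def centerPt (c : Code) (n : ℕ) (k : PreCut) (h : Between (ivl c n).1 (ivl c n).2 k) :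
    PrefencePt := ⟨(trunc c n, k), fits_trunc h⟩

theorem between_cutLE {a b q : ℚ} (h1 : a ≤ q) (h2 : q < b) : Between a b (cutLE q) :=
  ⟨isCut_cutLE q, by simpa, by simpa⟩

theorem between_cutLT {a b q : ℚ} (h1 : a < q) (h2 : q ≤ b) : Between a b (cutLT q) :=
  ⟨isCut_cutLT q, by simpa, by simpa⟩

section Extension

variable {A : TopStructure.{u}} {B : TopStructure.{v}} {g : B → A} {φ : PrefencePt → A}

/-- The center of a cylinder has the largest fibre over it, and `φ` does not see digits beyond `n`,
so over the whole cylinder `φ` is determined by its values over the center. There it is a step map,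
which lifts with both ends prescribed. -/
theorem exists_local_lift (hA : IsFiniteHForest A) (hB : IsFiniteHForest B)
    (hg : IsEpimorphism g) (hφ : IsHom φ) {n : ℕ} {S : Finset ℚ}
    (hagree : ∀ x y : PrefencePt, y.1.1 ∈ PiNat.cylinder x.1.1 n →
      (∀ q ∈ S, y.1.2 q = x.1.2 q) → φ y = φ x)
    (c : Code) {m : ℕ} (hnm : n ≤ m) {b₀ b₁ : B} (hle : B.le b₀ b₁)
    (h0 : g b₀ = φ (centerPt c m _ (between_cutLE le_rfl (ivl_lt c m))))
    (h1 : g b₁ = φ (centerPt c m _ (between_cutLT (ivl_lt c m) le_rfl))) :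
    ∃ ψ τ, IsStepMap B (ivl c m).1 b₀ ψ τ b₁ ∧ τ < (ivl c m).2 ∧
      ∀ x : PrefencePt, x.1.1 ∈ PiNat.cylinder c m → g (ψ x.1.2) = φ x := by
  classical
  have := hB.finite
  set a := (ivl c m).1
  set b := (ivl c m).2
  have hab : a < b := ivl_lt c m
  let Φ : PreCut → A := fun k => if h : Between a b k then φ (centerPt c m k h) else g b₀
  have hΦ : ∀ {k} (h : Between a b k), Φ k = φ (centerPt c m k h) := fun h => dif_pos h
  obtain ⟨χ, τ, x, hχ, hτ, heq⟩ := exists_isStepMap hA.hpo S hab Φ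
    (fun k l hk hl hkl => by
      rw [hΦ hk, hΦ hl]
      exact hagree _ _ (PiNat.self_mem_cylinder _ _) hkl)
    (fun k l hk hl hkl => by
      rw [hΦ hk, hΦ hl]
      exact hφ.map_le _ _ ⟨rfl, hkl⟩)
    (fun k l hk hl hkl => by
      rw [hΦ hk, hΦ hl]
      exact hφ.map_R _ _ ⟨rfl, hkl⟩)
  have hx : x = g b₁ := by
    rw [h1, ← hΦ, ← heq _ (between_cutLT hab le_rfl), hχ.apply_of_true (by simpa using hτ)]
  have h0' : Φ (cutLE a) = g b₀ := by rw [h0, ← hΦ]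
  rw [h0', hx] at hχ
  obtain ⟨ψ, τ', hψ, hτ', hgψ⟩ := hχ.exists_lift hA hB.hpo
    (fun b b' h => (hg.R_iff _ _).mpr ⟨b, b', rfl, rfl, h⟩)
    (fun b b' h => (hg.le_iff _ _).mpr ⟨b, b', rfl, rfl, h⟩) (hB.hpo.reflTransGen_nextOrEq hle) hτ
  refine ⟨ψ, τ', hψ, hτ', fun y hy => ?_⟩
  have hby := between_of_mem_cylinder hy
  rw [hgψ _ hby.1, heq _ hby, hΦ hby]
  refine hagree _ _ (fun i hi => ?_) fun _ _ => rfl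
  rw [hy i (hi.trans_le hnm)]
  exact trunc_mem_cylinder c m i (hi.trans_le hnm)

theorem exists_isHom_lift (hA : IsFiniteHForest A) (hB : IsFiniteHForest B)
    (hg : IsEpimorphism g) (hφ : IsHom φ) {n : ℕ} {S : Finset ℚ}
    (hagree : ∀ x y : PrefencePt, y.1.1 ∈ PiNat.cylinder x.1.1 n →
      (∀ q ∈ S, y.1.2 q = x.1.2 q) → φ y = φ x) :
    ∃ ψ : PrefencePt → B, IsHom ψ ∧ ∀ x, g (ψ x) = φ x := by
  have := hB.finite
  have h : ∀ c : Code, ∃ ψ : PreCut → B, IsHom (fun x : PrefencePt => ψ x.1.2) ∧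
      ∀ x : PrefencePt, x.1.1 ∈ PiNat.cylinder c n → g (ψ x.1.2) = φ x := by
    intro c
    obtain ⟨b₀, b₁, h0, h1, hle⟩ := (hg.le_iff _ _).mp
      (hφ.map_le (centerPt c n _ (between_cutLE le_rfl (ivl_lt c n)))
        (centerPt c n _ (between_cutLT (ivl_lt c n) le_rfl)) ⟨rfl, fun q => by
          change cutLE _ q ≤ cutLT _ q
          by_cases hq : q ≤ (ivl c n).1
          · rw [cutLT_eq_true.mpr (hq.trans_lt (ivl_lt c n))]; exact Bool.le_true _
          · rw [cutLE_eq_false.mpr (not_le.mp hq)]; exact Bool.false_le _⟩)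
    obtain ⟨ψ, τ, hψ, -, hgψ⟩ := exists_local_lift hA hB hg hφ hagree c le_rfl hle h0 h1
    exact ⟨ψ, hψ.isHom hB.hpo, hgψ⟩
  choose ψ hψ hgψ using h
  have htr : ∀ {c d : Code}, d ∈ PiNat.cylinder c n → trunc d n = trunc c n := fun hd => by
    funext i
    simp only [trunc]
    split_ifs with hi
    exacts [hd i hi, rfl]
  refine ⟨fun x => ψ (trunc x.1.1 n) x.1.2, IsHom.of_local fun c =>
    ⟨n, _, hψ (trunc c n), fun x hx => by rw [htr hx]⟩, fun x => hgψ _ _ ?_⟩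
  exact fun i hi => (trunc_mem_cylinder x.1.1 n i hi).symm

/-- Over the codes in `W`, the map `ψ` attains the pair `p`, as far as it is related. -/
def Attains (ψ : PrefencePt → B) (W : Set Code) (p : B × B) : Prop :=
  (∃ x y : PrefencePt, x.1.1 ∈ W ∧ prefence.le x y ∧ ψ x = p.1 ∧ ψ y = p.2) ∧
    (B.NextOrEq p.1 p.2 →
      ∃ x y : PrefencePt, x.1.1 ∈ W ∧ prefence.R x y ∧ ψ x = p.1 ∧ ψ y = p.2)

/-- The pairs are treated one at a time. The image of a pair under `g` is attained by `φ` at two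
points of one fibre. The part of the fibre between them is reproduced over a small new cylinder
nearby, over which the lift is replaced by a climb from `p.1` to `p.2`. The finite set `W` collects
the codes used so far; the new cylinder avoids it, so earlier pairs remain attained. -/
theorem exists_isHom_lift_attaining (hA : IsFiniteHForest A) (hB : IsFiniteHForest B)
    (hg : IsEpimorphism g) (hφ : IsEpimorphism (A := prefence) φ) (T : Finset (B × B)) :
    ∃ ψ : PrefencePt → B, IsHom ψ ∧ (∀ x, g (ψ x) = φ x) ∧
      ∃ W : Set Code, W.Finite ∧ ∀ p ∈ T, B.le p.1 p.2 → Attains ψ W p := by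
  classical
  have := hA.finite
  have := hB.finite
  obtain ⟨n, S, hagree⟩ := exists_uniform_agreement hφ.continuous
  induction T using Finset.induction_on with
  | empty =>
    obtain ⟨ψ, h1, h2⟩ := exists_isHom_lift hA hB hg hφ.isHom hagree
    exact ⟨ψ, h1, h2, ∅, Set.finite_empty, by simp⟩
  | insert p T _ ih =>
    obtain ⟨ψ, hψ, hgψ, W, hW, hWT⟩ := ih
    by_cases hp : B.le p.1 p.2
    swap
    · refine ⟨ψ, hψ, hgψ, W, hW, fun p' hp' hle => ?_⟩
      rcases Finset.mem_insert.mp hp' with rfl | hp'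
      exacts [absurd hle hp, hWT p' hp' hle]
    obtain ⟨x, y, hx, hy, hxy⟩ := (hφ.le_iff _ _).mp ((hg.le_iff _ _).mpr ⟨_, _, rfl, rfl, hp⟩)
    obtain ⟨⟨c, k⟩, hk⟩ := x
    obtain ⟨⟨c', l⟩, hl⟩ := y
    obtain ⟨rfl, hkl⟩ : c = c' ∧ k ≤ l := hxy
    -- `a` is the largest relevant rational in the cut `k`, and `b` the smallest one not in `l`.
    -- Hence `φ` cannot distinguish `k` from `cutLE a`, nor `l` from `cutLT b`, and these are the
    -- extreme cuts over the new cylinder.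
    let Sa := insert (ivl c n).1 (S.filter fun q => k q = true)
    let Sb := insert (ivl c n).2 (S.filter fun q => l q = false)
    let a := Sa.max' (Finset.insert_nonempty _ _)
    let b := Sb.min' (Finset.insert_nonempty _ _)
    have hka : k a = true := by
      rcases Finset.mem_insert.mp (Sa.max'_mem (Finset.insert_nonempty _ _)) with h | h
      · exact (congrArg k h).trans (hk.2 n).1
      · exact (Finset.mem_filter.mp h).2
    have hlb : l b = false := by
      rcases Finset.mem_insert.mp (Sb.min'_mem (Finset.insert_nonempty _ _)) with h | h
      · exact (congrArg l h).trans (hl.2 n).2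
      · exact (Finset.mem_filter.mp h).2
    have hab : a < b := hl.1.lt_of_true_of_false (le_apply hkl hka) hlb
    obtain ⟨j, -, hnj, hivl, -, -, hdisj⟩ := exists_stamp c n 0 (a := a) (b := b)
      (Finset.le_max' _ _ (Finset.mem_insert_self _ _)) hab
      (Finset.min'_le _ _ (Finset.mem_insert_self _ _)) hW
    set d := stamp c n j
    have hi1 : (ivl d (j + 1)).1 = a := by rw [hivl]
    have hi2 : (ivl d (j + 1)).2 = b := by rw [hivl]
    have hdc : ∀ i < n, trunc d (j + 1) i = c i := fun i hi => by
      rw [trunc_mem_cylinder d (j + 1) i (by omega)]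
      exact stamp_mem_cylinder c n j i hi
    have hlift := exists_local_lift hA hB hg hφ.isHom hagree d (m := j + 1)
      (by omega) hp (hx.symm.trans ?_) (hy.symm.trans ?_)
    rotate_left
    · refine hagree _ _ (fun i hi => (hdc i hi).symm) fun q hq => ?_
      change k q = cutLE _ q
      rw [hi1]
      by_cases hkq : k q = true
      · rw [hkq, eq_comm, cutLE_eq_true]
        exact Finset.le_max' _ _ (Finset.mem_insert_of_mem (Finset.mem_filter.mpr ⟨hq, hkq⟩))
      · rw [(Bool.not_eq_true _).mp hkq, eq_comm, cutLE_eq_false]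
        exact hk.1.lt_of_true_of_false hka ((Bool.not_eq_true _).mp hkq)
    · refine hagree _ _ (fun i hi => (hdc i hi).symm) fun q hq => ?_
      change l q = cutLT _ q
      rw [hi2]
      by_cases hlq : l q = true
      · rw [hlq, eq_comm, cutLT_eq_true]
        exact hl.1.lt_of_true_of_false hlq hlb
      · rw [(Bool.not_eq_true _).mp hlq, eq_comm, cutLT_eq_false]
        exact Finset.min'_le _ _ (Finset.mem_insert_of_mem
          (Finset.mem_filter.mpr ⟨hq, (Bool.not_eq_true _).mp hlq⟩))
    obtain ⟨χ, τ, hχ, hτ, hgχ⟩ := hlift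
    let ψ' : PrefencePt → B := fun x =>
      if x.1.1 ∈ PiNat.cylinder d (j + 1) then χ x.1.2 else ψ x
    have hψ'1 : ∀ x : PrefencePt, x.1.1 ∈ PiNat.cylinder d (j + 1) → ψ' x = χ x.1.2 :=
      fun x hx => if_pos hx
    have hψ'2 : ∀ x : PrefencePt, x.1.1 ∉ PiNat.cylinder d (j + 1) → ψ' x = ψ x :=
      fun x hx => if_neg hx
    have hcen : ∀ q (h : Between (ivl d (j + 1)).1 (ivl d (j + 1)).2 q),
        ψ' (centerPt d (j + 1) q h) = χ q := fun q h => hψ'1 _ (trunc_mem_cylinder d (j + 1))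
    refine ⟨ψ', IsHom.of_local fun z => ?_, fun x => ?_, insert (trunc d (j + 1)) W, hW.insert _,
      fun p' hp' hle => ?_⟩
    · by_cases hz : z ∈ PiNat.cylinder d (j + 1)
      · exact ⟨j + 1, _, hχ.isHom hB.hpo, fun x hx =>
          hψ'1 x (PiNat.mem_cylinder_iff_eq.mp hz ▸ hx)⟩
      · refine ⟨j + 1, ψ, hψ, fun x hx => hψ'2 x fun hx' => hz ?_⟩
        rw [PiNat.mem_cylinder_iff_eq] at hx hx' ⊢
        exact hx.symm.trans hx'
    · by_cases hx : x.1.1 ∈ PiNat.cylinder d (j + 1)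
      · rw [hψ'1 x hx, hgχ x hx]
      · rw [hψ'2 x hx, hgψ]
    · rcases Finset.mem_insert.mp hp' with rfl | hp'
      · have e1 : χ (cutLE (ivl d (j + 1)).1) = p'.1 := hχ.apply_of_false fun q hq => by simpa
        have e2 : χ (cutLT (ivl d (j + 1)).2) = p'.2 := hχ.apply_of_true (by simpa)
        constructor
        · refine ⟨centerPt d (j + 1) _ (between_cutLE le_rfl (ivl_lt _ _)),
            centerPt d (j + 1) _ (between_cutLT (ivl_lt _ _) le_rfl), Set.mem_insert _ _,
            ⟨rfl, fun q => ?_⟩, ?_, ?_⟩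
          · change cutLE _ q ≤ cutLT _ q
            by_cases hq : q ≤ (ivl d (j + 1)).1
            · rw [cutLT_eq_true.mpr (hq.trans_lt (ivl_lt _ _))]; exact Bool.le_true _
            · rw [cutLE_eq_false.mpr (not_le.mp hq)]; exact Bool.false_le _
          · rw [hcen, e1]
          · rw [hcen, e2]
        · intro hnext
          by_cases hne : p'.1 = p'.2
          · refine ⟨centerPt d (j + 1) _ (between_cutLE le_rfl (ivl_lt _ _)), _,
              Set.mem_insert _ _, ⟨rfl, rfl⟩, ?_, ?_⟩
            · rw [hcen, e1]
            · rw [hcen, e1, hne]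
          -- The climb from `p'.1` to the adjacent point `p'.2` jumps at a rational `q`, whose two
          -- cuts are `R`-related.
          · obtain ⟨q, hq1, hq2, hq3, hq4⟩ := hχ.exists_jump hB.hpo hne hnext
            refine ⟨centerPt d (j + 1) (cutLT q) (between_cutLT hq1 (hq2.trans hτ.le)),
              centerPt d (j + 1) (cutLE q) (between_cutLE hq1.le (hq2.trans_lt hτ)),
              Set.mem_insert _ _, ⟨rfl, ?_⟩, ?_, ?_⟩
            · exact (cutVal_cutLT q).trans (cutVal_cutLE q).symm
            · rw [hcen, hq3]
            · rw [hcen, hq4]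
      · have hW' : ∀ x : PrefencePt, x.1.1 ∈ W → ψ' x = ψ x := fun x hx =>
          hψ'2 x fun h => Set.disjoint_left.mp hdisj h hx
        obtain ⟨⟨x, y, hx, hxy, hx1, hy1⟩, h2⟩ := hWT p' hp' hle
        refine ⟨⟨x, y, Set.mem_insert_of_mem _ hx, hxy, (hW' x hx).trans hx1,
          (hW' y (hxy.1 ▸ hx)).trans hy1⟩, fun hnext => ?_⟩
        obtain ⟨x, y, hx, hxy, hx1, hy1⟩ := h2 hnext
        exact ⟨x, y, Set.mem_insert_of_mem _ hx, hxy, (hW' x hx).trans hx1,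
          (hW' y (hxy.1 ▸ hx)).trans hy1⟩

theorem prefence_exists_lift (hA : IsFiniteHForest A) (hB : IsFiniteHForest B)
    (hg : IsEpimorphism g) (hφ : IsEpimorphism (A := prefence) φ) :
    ∃ ψ : PrefencePt → B, IsEpimorphism (A := prefence) ψ ∧ ∀ x, g (ψ x) = φ x := by
  classical
  have := hB.finite
  have := Fintype.ofFinite B
  obtain ⟨ψ, hψ, hgψ, W, -, hW⟩ := exists_isHom_lift_attaining hA hB hg hφ Finset.univ
  have hW' : ∀ b b', B.le b b' → Attains ψ W (b, b') := fun b b' h => hW (b, b') (by simp) h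
  have hnext : ∀ b b', B.NextOrEq b b' →
      ∃ x y : PrefencePt, ψ x = b ∧ ψ y = b' ∧ prefence.R x y := fun b b' h => by
    obtain ⟨x, y, -, hxy, hx, hy⟩ := (hW' b b' h.1).2 h
    exact ⟨x, y, hx, hy, hxy⟩
  refine ⟨ψ, ⟨hψ.continuous, fun b => ?_, fun b b' => ⟨fun h => ?_, ?_⟩,
    fun b b' => ⟨fun h => ?_, ?_⟩⟩, hgψ⟩
  · obtain ⟨x, -, -, -, hx, -⟩ := (hW' b b (hB.hpo.refl b)).1
    exact ⟨x, hx⟩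
  · rcases (hB.hpo.R_iff b b').mp h with rfl | h | h
    · exact hnext b b (hB.hpo.nextOrEq_refl b)
    · exact hnext b b' h
    · obtain ⟨x, y, hx, hy, hxy⟩ := hnext b' b h
      exact ⟨y, x, hy, hx, hxy.1.symm, hxy.2.symm⟩
  · rintro ⟨x, y, rfl, rfl, h⟩; exact hψ.map_R x y h
  · obtain ⟨x, y, -, hxy, hx, hy⟩ := (hW' b b' h).1
    exact ⟨x, y, hx, hy, hxy⟩
  · rintro ⟨x, y, rfl, rfl, h⟩; exact hψ.map_le x y h

end Extension

/-! ### Finite chains as quotients of the prespace -/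

/-- A finite partially ordered set, as a discrete topological structure with the Hasse relation. -/
@[reducible] def hasseStructure (α : Type u) [PartialOrder α] [Finite α] : TopStructure.{u} :=
  letI : TopologicalSpace α := ⊥
  haveI : DiscreteTopology α := ⟨rfl⟩
  { carrier := α
    top := ⊥
    zeroDim := hasSmallInductiveDimensionLT_one_iff.mpr
      (isTopologicalBasis_of_isOpen_of_nhds (fun _ hV => hV.isOpen)
        fun _ U hx _ => ⟨U, isClopen_discrete U, hx, subset_rfl⟩)
    R := fun a b => a = b ∨ (a ≤ b ∧ ∀ c, a ≤ c → c ≤ b → c = a ∨ c = b) ∨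
      (b ≤ a ∧ ∀ c, b ≤ c → c ≤ a → c = b ∨ c = a)
    le := fun a b => a ≤ b
    isClosed_R := isClosed_discrete _
    isClosed_le := isClosed_discrete _ }

theorem isHPO_hasseStructure (α : Type u) [PartialOrder α] [Finite α] :
    IsHPO (hasseStructure α) where
  refl := le_refl (α := α)
  antisymm := fun _ _ => le_antisymm (α := α)
  trans := fun _ _ _ => le_trans (α := α)
  R_iff := fun _ _ => Iff.rfl

/-- The levels of the prespace determined by the first `n` digits of the code and by the finite set
`S` of rationals. -/
@[ext] structure Block (n : ℕ) (S : Finset ℚ) : Type where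
  code : Code
  height : ℚ
  code_eq : trunc code n = code
  height_mem : height = (ivl code n).1 ∨
    height ∈ S ∧ (ivl code n).1 < height ∧ height < (ivl code n).2

namespace Block

variable {n : ℕ} {S : Finset ℚ}

instance : PartialOrder (Block n S) where
  le x y := x.code = y.code ∧ x.height ≤ y.height
  le_refl x := ⟨rfl, le_rfl⟩
  le_trans x y z h h' := ⟨h.1.trans h'.1, h.2.trans h'.2⟩
  le_antisymm x y h h' := Block.ext h.1 (le_antisymm h.2 h'.2)

theorem fst_le_height (x : Block n S) : (ivl x.code n).1 ≤ x.height :=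
  x.height_mem.elim (fun h => h.ge) fun h => h.2.1.le

theorem height_lt_snd (x : Block n S) : x.height < (ivl x.code n).2 :=
  x.height_mem.elim (fun h => h ▸ ivl_lt _ _) fun h => h.2.2

instance : Finite (Block n S) := by
  classical
  let f : Block n S → (Fin n → Bool) × Option S := fun x => (fun i => x.code i,
    if h : x.height ∈ S ∧ (ivl x.code n).1 < x.height then some ⟨x.height, h.1⟩ else none)
  refine Finite.of_injective f fun x y hxy => ?_
  have hc : x.code = y.code := by
    rw [← x.code_eq, ← y.code_eq]
    funext i
    simp only [trunc]
    split_ifs with hi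
    exacts [congrFun (congrArg Prod.fst hxy) ⟨i, hi⟩, rfl]
  have hh : (f x).2 = (f y).2 := congrArg Prod.snd hxy
  refine Block.ext hc ?_
  simp only [f] at hh
  split_ifs at hh with h1 h2 h2
  · simpa using hh
  · have hx : x.height = (ivl x.code n).1 := x.height_mem.resolve_right fun h => h1 ⟨h.1, h.2.1⟩
    have hy : y.height = (ivl y.code n).1 := y.height_mem.resolve_right fun h => h2 ⟨h.1, h.2.1⟩
    rw [hx, hy, hc]

theorem isFiniteHForest : IsFiniteHForest (hasseStructure (Block n S)) where
  finite := inferInstanceAs (Finite (Block n S))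
  nonempty := ⟨⟨trunc (fun _ => false) n, _, by funext i; simp [trunc], Or.inl rfl⟩⟩
  hpo := isHPO_hasseStructure _
  acyclic := (isHPO_hasseStructure _).isAcyclic fun x y z (hxz : x ≤ z) (hyz : y ≤ z) =>
    (le_total x.height y.height).imp (fun h => ⟨hxz.1.trans hyz.1.symm, h⟩)
      fun h => ⟨hyz.1.trans hxz.1.symm, h⟩

theorem exists_isGreatest (n : ℕ) (S : Finset ℚ) (x : PrefencePt) :
    ∃ q, IsGreatest {q : ℚ | (q = (ivl x.1.1 n).1 ∨
      q ∈ S ∧ (ivl x.1.1 n).1 < q ∧ q < (ivl x.1.1 n).2) ∧ x.1.2 q = true} q := by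
  have hfin : {q : ℚ | (q = (ivl x.1.1 n).1 ∨
      q ∈ S ∧ (ivl x.1.1 n).1 < q ∧ q < (ivl x.1.1 n).2) ∧ x.1.2 q = true}.Finite :=
    (S.finite_toSet.insert (ivl x.1.1 n).1).subset fun q hq => hq.1.imp id fun h => h.1
  obtain ⟨q, hq⟩ := hfin.exists_maximal ⟨_, Or.inl rfl, (x.2.2 n).1⟩
  refine ⟨q, hq.1, fun r hr => ?_⟩
  by_contra h
  exact h (hq.2 hr (not_le.mp h).le)

/-- The quotient map to the blocks. -/
noncomputable def proj (n : ℕ) (S : Finset ℚ) (x : PrefencePt) : Block n S where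
  code := trunc x.1.1 n
  height := (exists_isGreatest n S x).choose
  code_eq := by funext i; simp [trunc]
  height_mem := by
    rw [ivl_trunc]
    exact (exists_isGreatest n S x).choose_spec.1.1

theorem apply_height (x : PrefencePt) : x.1.2 (proj n S x).height = true :=
  (exists_isGreatest n S x).choose_spec.1.2

theorem le_height {x : PrefencePt} (y : Block n S) (hc : y.code = trunc x.1.1 n)
    (hk : x.1.2 y.height = true) : y.height ≤ (proj n S x).height := by
  refine (exists_isGreatest n S x).choose_spec.2 ⟨?_, hk⟩
  have := y.height_mem
  rwa [hc, ivl_trunc] at this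

theorem mem_cylinder_of_proj_eq {x y : PrefencePt} (h : proj n S x = proj n S y) :
    y.1.1 ∈ PiNat.cylinder x.1.1 n := fun i hi => by
  have := congrFun (congrArg Block.code h) i
  simpa [proj, trunc, hi] using this.symm

theorem apply_eq_of_proj_eq {x y : PrefencePt} (h : proj n S x = proj n S y) {q : ℚ} (hq : q ∈ S) :
    y.1.2 q = x.1.2 q := by
  have hc := mem_cylinder_of_proj_eq h
  have hx := between_of_mem_cylinder (PiNat.self_mem_cylinder x.1.1 n)
  have hy := between_of_mem_cylinder hc
  rcases le_or_gt q (ivl x.1.1 n).1 with h1 | h1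
  · rw [hx.1 _ _ h1 hx.2.1, hy.1 _ _ h1 hy.2.1]
  rcases le_or_gt (ivl x.1.1 n).2 q with h2 | h2
  · have aux : ∀ {k}, Between (ivl x.1.1 n).1 (ivl x.1.1 n).2 k → k q = false := fun {k} hk => by
      by_contra hkq
      have := hk.1 _ _ h2 ((Bool.not_eq_false _).mp hkq)
      simp [hk.2.2] at this
    rw [aux hx, aux hy]
  have hq : ∀ z : PrefencePt, z.1.1 ∈ PiNat.cylinder x.1.1 n →
      (z.1.2 q = true ↔ q ≤ (proj n S z).height) := by
    intro z hz
    have htr : ivl (trunc z.1.1 n) n = ivl x.1.1 n := by rw [ivl_trunc, ivl_congr hz]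
    refine ⟨fun h => le_height ⟨trunc z.1.1 n, q, by funext i; simp [trunc],
      Or.inr ⟨hq, by rwa [htr], by rwa [htr]⟩⟩ rfl h, fun h => z.2.1 _ _ h (apply_height z)⟩
  have := hq x (PiNat.self_mem_cylinder _ _)
  have := hq y hc
  rw [← h] at this
  rw [Bool.eq_iff_iff]
  tauto

theorem proj_eq_of_agreement {x y : PrefencePt} (h1 : y.1.1 ∈ PiNat.cylinder x.1.1 n)
    (h2 : ∀ q ∈ S, y.1.2 q = x.1.2 q) : proj n S y = proj n S x := by
  have hc : trunc y.1.1 n = trunc x.1.1 n := by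
    funext i
    simp only [trunc]
    split_ifs with hi
    exacts [h1 i hi, rfl]
  have hivl := ivl_congr h1
  have hxn := (x.2.2 n).1
  have hyn := (y.2.2 n).1
  have aux : ∀ b : Block n S, b.code = trunc x.1.1 n → x.1.2 b.height = y.1.2 b.height := by
    intro b hb
    rcases b.height_mem with h | h
    · rw [hb, ivl_trunc] at h
      rw [h, hxn, ← hivl, hyn]
    · exact (h2 _ h.1).symm
  refine Block.ext hc (le_antisymm ?_ ?_)
  · exact le_height _ hc ((aux _ hc).trans (apply_height y))
  · exact le_height _ hc.symm ((aux _ rfl).symm.trans (apply_height x))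

theorem proj_le_proj {x y : PrefencePt} (h : prefence.le x y) : proj n S x ≤ proj n S y := by
  refine ⟨congrArg (trunc · n) h.1, le_height _ (congrArg (trunc · n) h.1) ?_⟩
  exact le_apply h.2 (apply_height x)

/-- A block strictly between the two projections would give two rationals that belong to the cut of
`y` but not to that of `x`, whereas cuts with the same value differ in at most one. -/
theorem R_proj_of_le {x y : PrefencePt} (h : prefence.R x y) (hle : x.1.2 ≤ y.1.2) :
    (hasseStructure (Block n S)).R (proj n S x) (proj n S y) := by
  refine Or.inr (Or.inl ⟨proj_le_proj ⟨h.1, hle⟩, fun z hxz hzy => ?_⟩)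
  by_contra! hne
  have h1 : (proj n S x).height < z.height :=
    hxz.2.lt_of_ne fun h => hne.1 (Block.ext hxz.1.symm h.symm)
  have h2 : z.height < (proj n S y).height :=
    hzy.2.lt_of_ne fun h => hne.2 (Block.ext hzy.1 h)
  have hy : y.1.2 (proj n S y).height = true := apply_height y
  have hyz : y.1.2 z.height = true := y.2.1 _ _ h2.le hy
  have hxz' : x.1.2 z.height = false := by
    by_contra hx
    exact (le_height z hxz.1.symm ((Bool.not_eq_false _).mp hx)).not_gt h1
  have hxy : x.1.2 (proj n S y).height = false := by
    by_contra hx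
    rw [x.2.1 _ _ h2.le ((Bool.not_eq_false _).mp hx)] at hxz'
    exact Bool.noConfusion hxz'
  exact h2.ne (x.2.1.eq_of_cutVal_eq y.2.1 h.2 hxz' hyz hxy hy ⟨_, (x.2.2 0).1⟩ ⟨_, (y.2.2 0).2⟩)

theorem proj_centerPt (b : Block n S) (k : PreCut) (h : Between (ivl b.code n).1 (ivl b.code n).2 k)
    (hb : k b.height = true) (hmax : ∀ z : Block n S, z.code = b.code → k z.height = true →
      z.height ≤ b.height) : proj n S (centerPt b.code n k h) = b := by
  have hcode : (proj n S (centerPt b.code n k h)).code = b.code := by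
    change trunc (trunc b.code n) n = b.code
    rw [b.code_eq, b.code_eq]
  refine Block.ext hcode (le_antisymm (hmax _ hcode
    (apply_height (centerPt b.code n k h))) ?_)
  exact le_height (x := centerPt b.code n k h) b hcode.symm hb

theorem isEpimorphism_proj :
    IsEpimorphism (A := prefence) (B := hasseStructure (Block n S)) (proj n S) := by
  have hLE : ∀ b : Block n S, Between (ivl b.code n).1 (ivl b.code n).2 (cutLE b.height) :=
    fun b => between_cutLE b.fst_le_height b.height_lt_snd
  have hproj : ∀ b : Block n S, proj n S (centerPt b.code n _ (hLE b)) = b := fun b =>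
    proj_centerPt b _ _ (by simp) fun z _ hz => by simpa using hz
  have hnext : ∀ b b' : Block n S, b ≤ b' → (∀ c, b ≤ c → c ≤ b' → c = b ∨ c = b') →
      ∃ x y : PrefencePt, proj n S x = b ∧ proj n S y = b' ∧ prefence.R x y := by
    intro b b' hle hbb
    by_cases hne : b.height = b'.height
    · obtain rfl : b = b' := Block.ext hle.1 hne
      exact ⟨_, _, hproj b, hproj b, rfl, rfl⟩
    obtain ⟨c, q, hc, hq⟩ := b
    obtain ⟨c', q', hc', hq'⟩ := b'
    obtain ⟨rfl, hqq⟩ : c = c' ∧ q ≤ q' := hle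
    have hlt : q < q' := hqq.lt_of_ne hne
    have hbq := fst_le_height ⟨c, q, hc, hq⟩
    -- The two cuts at the upper height `q'` have the same value. Since no block lies strictly
    -- between, the lower cut projects to the lower block.
    refine ⟨centerPt c n (cutLT q') (between_cutLT (hbq.trans_lt hlt)
      (height_lt_snd ⟨c, q', hc', hq'⟩).le), _, ?_, hproj ⟨c, q', hc', hq'⟩, rfl, ?_⟩
    · refine proj_centerPt ⟨c, q, hc, hq⟩ _ _ (by simpa) fun z hz hz' => ?_
      by_contra hlt'
      have hzq : z.height < q' := by simpa using hz'
      rcases hbb z ⟨hz.symm, (not_le.mp hlt').le⟩ ⟨hz, hzq.le⟩ with rfl | rfl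
      · exact hlt' le_rfl
      · exact lt_irrefl _ hzq
    · exact (cutVal_cutLT q').trans (cutVal_cutLE q').symm
  refine ⟨?_, fun b => ⟨_, hproj b⟩, fun b b' => ⟨?_, ?_⟩, fun b b' => ⟨fun h => ?_, ?_⟩⟩
  · let : TopologicalSpace (Block n S) := ⊥
    have : IsLocallyConstant (proj n S) := (IsLocallyConstant.iff_eventually_eq _).mpr fun x => by
      filter_upwards [agreement_mem_nhds x n S] with y hy
      exact proj_eq_of_agreement hy.1 hy.2
    exact this.continuous
  · rintro (rfl | h | h)
    · exact ⟨_, _, hproj b, hproj b, rfl, rfl⟩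
    · exact hnext b b' h.1 h.2
    · obtain ⟨x, y, hx, hy, hxy⟩ := hnext b' b h.1 h.2
      exact ⟨y, x, hy, hx, hxy.1.symm, hxy.2.symm⟩
  · rintro ⟨x, y, rfl, rfl, h⟩
    rcases x.2.1.le_total y.2.1 with hle | hle
    · exact R_proj_of_le h hle
    · exact (isHPO_hasseStructure _).R_symm (R_proj_of_le ⟨h.1.symm, h.2.symm⟩ hle)
  · exact ⟨_, _, hproj b, hproj b', by
      change trunc b.code n = trunc b'.code n
      rw [show b.code = b'.code from h.1], fun q => by
        change cutLE b.height q ≤ cutLE b'.height q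
        by_cases hq : q ≤ b.height
        · rw [cutLE_eq_true.mpr (hq.trans h.2)]; exact Bool.le_true _
        · rw [cutLE_eq_false.mpr (not_le.mp hq)]; exact Bool.false_le _⟩
  · rintro ⟨x, y, rfl, rfl, h⟩
    exact proj_le_proj h

end Block

theorem prefence_exists_refining {𝒰 : Set (Set PrefencePt)} (hopen : ∀ V ∈ 𝒰, IsOpen V)
    (hcover : ⋃₀ 𝒰 = Set.univ) :
    ∃ A : TopStructure.{0}, IsFiniteHForest A ∧ ∃ φ : PrefencePt → A,
      IsEpimorphism (A := prefence) φ ∧ Refines (A := prefence) φ 𝒰 := by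
  obtain ⟨n, S, h⟩ := exists_uniform_refinement hopen hcover
  refine ⟨hasseStructure (Block n S), Block.isFiniteHForest, Block.proj n S,
    Block.isEpimorphism_proj, fun b => ?_⟩
  obtain ⟨x, rfl⟩ := (Block.isEpimorphism_proj (n := n) (S := S)).surjective b
  obtain ⟨V, hV, hxV⟩ := h x
  exact ⟨V, hV, fun y hy => hxV y (Block.mem_cylinder_of_proj_eq (Eq.symm hy))
    fun q hq => Block.apply_eq_of_proj_eq (Eq.symm hy) hq⟩

/-- The structure with one point. -/
@[reducible] def pointStructure : TopStructure.{0} := hasseStructure Unit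

theorem isFiniteHForest_pointStructure : IsFiniteHForest pointStructure where
  finite := inferInstanceAs (Finite Unit)
  nonempty := ⟨()⟩
  hpo := isHPO_hasseStructure _
  acyclic := (isHPO_hasseStructure _).isAcyclic fun _ _ _ _ _ => Or.inl (le_refl ())

theorem isEpimorphism_pointStructure {A : TopStructure.{u}} (x : A) (hR : A.R x x)
    (hle : A.le x x) : IsEpimorphism (A := A) (B := pointStructure) fun _ => () where
  continuous := continuous_const
  surjective := fun _ => ⟨x, rfl⟩
  R_iff := fun _ _ => ⟨fun _ => ⟨x, x, rfl, rfl, hR⟩, fun _ => Or.inl rfl⟩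
  le_iff := fun _ _ => ⟨fun _ => ⟨x, x, rfl, rfl, hle⟩, fun _ => le_refl ()⟩

/-- Universality is the lifting property over the one-point structure. -/
theorem prefence_exists_isEpimorphism {A : TopStructure.{v}} (hA : IsFiniteHForest A) :
    ∃ φ : PrefencePt → A, IsEpimorphism (A := prefence) φ := by
  obtain ⟨a⟩ := hA.nonempty
  obtain ⟨k, hk, -⟩ := exists_fits (c := fun _ => false) le_rfl (lo_le_hi _)
  obtain ⟨φ, hφ, -⟩ := prefence_exists_lift isFiniteHForest_pointStructure hA
    (isEpimorphism_pointStructure a ((hA.hpo.R_iff a a).mpr (Or.inl rfl)) (hA.hpo.refl a))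
    (isEpimorphism_pointStructure (A := prefence) ⟨(fun _ => false, k), hk⟩ ⟨rfl, rfl⟩
      ⟨rfl, le_rfl⟩)
  exact ⟨φ, hφ⟩

end FraisseFence

universe w

namespace FraisseFence

/-! ### Uniqueness of the projective Fraïssé limit -/

/-- Approximability by finite Hasse forests together with the lifting property. -/
structure HasLifts (F : TopStructure.{u}) : Prop where
  refine : ∀ 𝒰 : Set (Set F), (∀ V ∈ 𝒰, IsClopen V) → ⋃₀ 𝒰 = Set.univ →
    ∃ A : TopStructure.{0}, IsFiniteHForest A ∧ ∃ φ : F → A, IsEpimorphism φ ∧ Refines φ 𝒰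
  lift : ∀ (A B : TopStructure.{0}), IsFiniteHForest A → IsFiniteHForest B → ∀ (g : B → A)
    (φ : F → A), IsEpimorphism g → IsEpimorphism φ →
    ∃ ψ : F → B, IsEpimorphism ψ ∧ ∀ x, g (ψ x) = φ x

theorem IsEpimorphism.comp {A : TopStructure.{u}} {B : TopStructure.{v}}
    {C : TopStructure.{w}} {g : B → C} {f : A → B}
    (hg : IsEpimorphism g) (hf : IsEpimorphism f) : IsEpimorphism (g ∘ f) where
  continuous := hg.continuous.comp hf.continuous
  surjective := hg.surjective.comp hf.surjective
  R_iff c c' := by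
    rw [hg.R_iff]
    constructor
    · rintro ⟨b, b', rfl, rfl, h⟩
      obtain ⟨a, a', rfl, rfl, h'⟩ := (hf.R_iff _ _).mp h
      exact ⟨a, a', rfl, rfl, h'⟩
    · rintro ⟨a, a', rfl, rfl, h⟩
      exact ⟨_, _, rfl, rfl, (hf.R_iff _ _).mpr ⟨a, a', rfl, rfl, h⟩⟩
  le_iff c c' := by
    rw [hg.le_iff]
    constructor
    · rintro ⟨b, b', rfl, rfl, h⟩
      obtain ⟨a, a', rfl, rfl, h'⟩ := (hf.le_iff _ _).mp h
      exact ⟨a, a', rfl, rfl, h'⟩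
    · rintro ⟨a, a', rfl, rfl, h⟩
      exact ⟨_, _, rfl, rfl, (hf.le_iff _ _).mpr ⟨a, a', rfl, rfl, h⟩⟩

theorem IsEpimorphism.of_comp {F : TopStructure.{u}} {A B : TopStructure.{v}} [Finite B] {g : B → A}
    {ψ : F → B} {φ : F → A} (hφ : IsEpimorphism φ) (hψ : IsEpimorphism ψ)
    (h : ∀ x, g (ψ x) = φ x) : IsEpimorphism g where
  continuous := continuous_of_discreteTopology
  surjective a := by
    obtain ⟨x, rfl⟩ := hφ.surjective a
    exact ⟨ψ x, h x⟩
  R_iff a a' := by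
    rw [hφ.R_iff]
    constructor
    · rintro ⟨x, x', rfl, rfl, hx⟩
      exact ⟨_, _, h x, h x', (hψ.R_iff _ _).mpr ⟨x, x', rfl, rfl, hx⟩⟩
    · rintro ⟨b, b', rfl, rfl, hb⟩
      obtain ⟨x, x', rfl, rfl, hx⟩ := (hψ.R_iff _ _).mp hb
      exact ⟨x, x', (h x).symm, (h x').symm, hx⟩
  le_iff a a' := by
    rw [hφ.le_iff]
    constructor
    · rintro ⟨x, x', rfl, rfl, hx⟩
      exact ⟨_, _, h x, h x', (hψ.le_iff _ _).mpr ⟨x, x', rfl, rfl, hx⟩⟩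
    · rintro ⟨b, b', rfl, rfl, hb⟩
      obtain ⟨x, x', rfl, rfl, hx⟩ := (hψ.le_iff _ _).mp hb
      exact ⟨x, x', (h x).symm, (h x').symm, hx⟩

/-- Any epimorphism `χ` onto `B` becomes a lift of `φ` after composition with the automorphism that
ultrahomogeneity provides for `g ∘ χ` and `φ`. -/
theorem IsProjectiveFraisseLimit.hasLifts {F : TopStructure.{u}}
    (hF : IsProjectiveFraisseLimit IsFiniteHForest.{0} F) : HasLifts F where
  refine := hF.refine
  lift A B hA hB g φ hg hφ := by
    obtain ⟨χ, hχ⟩ := hF.universal B hB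
    obtain ⟨ψ, hψ, heq⟩ := hF.ultrahomogeneous A hA (g ∘ χ) φ (hg.comp hχ) hφ
    exact ⟨χ ∘ ψ, hχ.comp hψ.1, fun x => (congrFun heq x).symm⟩

theorem hasLifts_prefence : HasLifts prefence where
  refine _ h1 h2 := prefence_exists_refining (fun V hV => (h1 V hV).isOpen) h2
  lift _ _ hA hB _ _ hg hφ := prefence_exists_lift hA hB hg hφ

/-- The covering used consists of small clopen sets, each inside one fibre of `φ`; a map refining it
has small fibres, and `φ` factors through it. -/
theorem HasLifts.exists_fine {F : TopStructure.{u}} [m : MetricSpace F]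
    (hm : m.toUniformSpace.toTopologicalSpace = F.top) (hF : HasLifts F)
    {A : TopStructure.{0}} (hA : IsFiniteHForest A) {φ : F → A} (hφ : IsEpimorphism φ) {ε : ℝ}
    (hε : 0 < ε) :
    ∃ B : TopStructure.{0}, IsFiniteHForest B ∧ ∃ (ψ : F → B) (g : B → A), IsEpimorphism ψ ∧
      IsEpimorphism g ∧ (∀ x, g (ψ x) = φ x) ∧ ∀ x y, ψ x = ψ y → dist x y < ε := by
  have := hA.finite
  obtain ⟨B, hB, ψ, hψ, hr⟩ := hF.refine
    {V | IsClopen V ∧ (∃ a, V ⊆ φ ⁻¹' {a}) ∧ ∀ x ∈ V, ∀ y ∈ V, dist x y < ε}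
    (fun V hV => hV.1) (Set.eq_univ_of_forall fun x => by
      have hball : @IsOpen F m.toUniformSpace.toTopologicalSpace (Metric.ball x (ε / 2)) :=
        Metric.isOpen_ball
      rw [hm] at hball
      obtain ⟨V, hV, hxV, hVs⟩ := exists_isClopen_mem_subset
        (((isOpen_discrete {φ x}).preimage hφ.continuous).inter hball)
        ⟨rfl, Metric.mem_ball_self (half_pos hε)⟩
      refine ⟨V, ⟨hV, ⟨φ x, fun y hy => (hVs hy).1⟩, fun y hy z hz => ?_⟩, hxV⟩
      have h1 := Metric.mem_ball.mp (hVs hy).2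
      have h2 := Metric.mem_ball'.mp (hVs hz).2
      linarith [dist_triangle y x z])
  have := hB.finite
  have hfac : ∀ b : B, ∃ a, ∀ x, ψ x = b → φ x = a := fun b => by
    obtain ⟨V, ⟨-, ⟨a, ha⟩, -⟩, hbV⟩ := hr b
    exact ⟨a, fun x hx => ha (hbV hx)⟩
  choose g hg using hfac
  have hgψ : ∀ x, g (ψ x) = φ x := fun x => (hg _ x rfl).symm
  refine ⟨B, hB, ψ, g, hψ, hφ.of_comp hψ hgψ, hgψ, fun x y hxy => ?_⟩
  obtain ⟨V, ⟨-, -, hd⟩, hbV⟩ := hr (ψ x)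
  exact hd x (hbV rfl) y (hbV hxy.symm)

theorem rel_of_forall_dist_lt {X : Type u} [MetricSpace X] {r : X → X → Prop}
    (hr : IsClosed {p : X × X | r p.1 p.2}) {x y : X}
    (h : ∀ ε > 0, ∃ a a', r a a' ∧ dist x a < ε ∧ dist y a' < ε) : r x y := by
  have : (x, y) ∈ closure {p : X × X | r p.1 p.2} := by
    rw [Metric.mem_closure_iff]
    intro ε hε
    obtain ⟨a, a', haa, h1, h2⟩ := h ε hε
    exact ⟨(a, a'), haa, by simpa [Prod.dist_eq] using ⟨h1, h2⟩⟩
  rwa [hr.closure_eq] at this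

/-- Back-and-forth through fibre products over finite forests. To refine one, a fine quotient of `F`
is lifted to `G`, then a fine quotient of `G` is lifted back to `F`. Related pairs correspond up to
arbitrarily small errors, so the closed relations correspond exactly in the limit. -/
theorem HasLifts.exists_homeomorph {F : TopStructure.{u}} {G : TopStructure.{v}} (hF : HasLifts F)
    (hG : HasLifts G) {A : TopStructure.{0}} (hA : IsFiniteHForest A) {φ : F → A} {φ' : G → A}
    (hφ : IsEpimorphism φ) (hφ' : IsEpimorphism φ') :
    ∃ f : F ≃ₜ G, (∀ x, φ' (f x) = φ x) ∧ (∀ x y, F.R x y ↔ G.R (f x) (f y)) ∧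
      ∀ x y, F.le x y ↔ G.le (f x) (f y) := by
  let mF := metrizableSpaceMetric F
  let mG := metrizableSpaceMetric G
  let 𝒜 : Set (F × G) → Prop := fun Z => ∃ A : TopStructure.{0}, IsFiniteHForest A ∧
    ∃ (φ : F → A) (φ' : G → A), IsEpimorphism φ ∧ IsEpimorphism φ' ∧ Z = {p | φ p.1 = φ' p.2}
  obtain ⟨f, hf0, hf⟩ := exists_homeomorph_of_back_and_forth 𝒜
    (by
      rintro _ ⟨A, -, φ, φ', hφ, hφ', rfl⟩
      exact isClosed_eq (hφ.continuous.comp continuous_fst) (hφ'.continuous.comp continuous_snd))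
    (by
      rintro _ ⟨A, -, φ, φ', hφ, hφ', rfl⟩ x
      obtain ⟨y, hy⟩ := hφ'.surjective (φ x)
      exact ⟨y, hy.symm⟩)
    (by
      rintro _ ⟨A, -, φ, φ', hφ, hφ', rfl⟩ y
      obtain ⟨x, hx⟩ := hφ.surjective (φ' y)
      exact ⟨x, hx⟩)
    (by
      rintro _ ⟨A, hA, φ, φ', hφ, hφ', rfl⟩ ε hε
      obtain ⟨B, hB, ψ, g, hψ, hg, hgψ, hsm⟩ := hF.exists_fine rfl hA hφ hε
      obtain ⟨ψ', hψ', hgψ'⟩ := hG.lift A B hA hB g φ' hg hφ'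
      obtain ⟨D, hD, χ', h, hχ', hh, hhχ', hsm'⟩ := hG.exists_fine rfl hB hψ' hε
      obtain ⟨χ, hχ, hhχ⟩ := hF.lift B D hB hD h ψ hh hψ
      refine ⟨{p | χ p.1 = χ' p.2}, fun p (hp : χ p.1 = χ' p.2) => ?_,
        ⟨D, hD, χ, χ', hχ, hχ', rfl⟩, fun x x' y (h1 : χ x = χ' y) (h2 : χ x' = χ' y) => ?_,
        fun x y y' (h1 : χ x = χ' y) (h2 : χ x = χ' y') => hsm' y y' (h1.symm.trans h2)⟩
      · change φ p.1 = φ' p.2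
        rw [← hgψ, ← hhχ, hp, hhχ', hgψ']
      · refine hsm x x' ?_
        rw [← hhχ, ← hhχ, h1, h2])
    {p | φ p.1 = φ' p.2} ⟨A, hA, φ, φ', hφ, hφ', rfl⟩
  refine ⟨f, fun x => (hf0 x).symm, fun x y => ⟨?_, fun h => ?_⟩, fun x y => ⟨?_, fun h => ?_⟩⟩
  · refine fun hxy => rel_of_forall_dist_lt G.isClosed_R fun ε hε => ?_
    obtain ⟨_, ⟨A, hA, φ, φ', hφ, hφ', rfl⟩, hsm, hfZ⟩ := hf ε hε
    obtain ⟨a, a', ha, ha', haa⟩ := (hφ'.R_iff _ _).mp ((hφ.R_iff _ _).mpr ⟨x, y, rfl, rfl, hxy⟩)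
    exact ⟨a, a', haa, hsm.2 x _ _ (hfZ x) ha.symm, hsm.2 y _ _ (hfZ y) ha'.symm⟩
  · refine rel_of_forall_dist_lt F.isClosed_R fun ε hε => ?_
    obtain ⟨_, ⟨A, hA, φ, φ', hφ, hφ', rfl⟩, hsm, hfZ⟩ := hf ε hε
    obtain ⟨a, a', ha, ha', haa⟩ := (hφ.R_iff _ _).mp ((hφ'.R_iff _ _).mpr ⟨_, _, rfl, rfl, h⟩)
    exact ⟨a, a', haa, hsm.1 x a (f x) (hfZ x) ha, hsm.1 y a' (f y) (hfZ y) ha'⟩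
  · refine fun hxy => rel_of_forall_dist_lt G.isClosed_le fun ε hε => ?_
    obtain ⟨_, ⟨A, hA, φ, φ', hφ, hφ', rfl⟩, hsm, hfZ⟩ := hf ε hε
    obtain ⟨a, a', ha, ha', haa⟩ := (hφ'.le_iff _ _).mp ((hφ.le_iff _ _).mpr ⟨x, y, rfl, rfl, hxy⟩)
    exact ⟨a, a', haa, hsm.2 x _ _ (hfZ x) ha.symm, hsm.2 y _ _ (hfZ y) ha'.symm⟩
  · refine rel_of_forall_dist_lt F.isClosed_le fun ε hε => ?_
    obtain ⟨_, ⟨A, hA, φ, φ', hφ, hφ', rfl⟩, hsm, hfZ⟩ := hf ε hε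
    obtain ⟨a, a', ha, ha', haa⟩ := (hφ.le_iff _ _).mp ((hφ'.le_iff _ _).mpr ⟨_, _, rfl, rfl, h⟩)
    exact ⟨a, a', haa, hsm.1 x a (f x) (hfZ x) ha, hsm.1 y a' (f y) (hfZ y) ha'⟩

theorem isProjectiveFraisseLimit_prefence :
    IsProjectiveFraisseLimit IsFiniteHForest.{0} prefence where
  universal _ hA := prefence_exists_isEpimorphism hA
  refine := hasLifts_prefence.refine
  ultrahomogeneous A hA φ₁ φ₂ h₁ h₂ := by
    obtain ⟨f, hf, hR, hle⟩ := hasLifts_prefence.exists_homeomorph hasLifts_prefence hA h₂ h₁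
    refine ⟨f, ⟨⟨f.continuous, f.surjective, fun x y => ?_, fun x y => ?_⟩, f.injective⟩,
      funext fun x => (hf x).symm⟩
    · constructor
      · intro h
        refine ⟨f.symm x, f.symm y, f.apply_symm_apply x, f.apply_symm_apply y, ?_⟩
        rwa [hR, f.apply_symm_apply, f.apply_symm_apply]
      · rintro ⟨a, b, rfl, rfl, h⟩
        exact (hR a b).mp h
    · constructor
      · intro h
        refine ⟨f.symm x, f.symm y, f.apply_symm_apply x, f.apply_symm_apply y, ?_⟩
        rwa [hle, f.apply_symm_apply, f.apply_symm_apply]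
      · rintro ⟨a, b, rfl, rfl, h⟩
        exact (hle a b).mp h

/-- Every limit maps onto the concrete fence, the fibres being the classes of `R`. -/
theorem IsProjectiveFraisseLimit.exists_projection {F : TopStructure.{u}}
    (hF : IsProjectiveFraisseLimit IsFiniteHForest.{0} F) :
    ∃ π : F → Code × ℝ, Continuous π ∧ Set.range π = {p | lo p.1 ≤ p.2 ∧ p.2 ≤ hi p.1} ∧
      (∀ x y, F.R x y ↔ π x = π y) ∧
      (∀ x y, F.le x y → (π x).1 = (π y).1 ∧ (π x).2 ≤ (π y).2) ∧
      ∀ p q : Code × ℝ, lo p.1 ≤ p.2 → q.2 ≤ hi q.1 → p.1 = q.1 → p.2 ≤ q.2 →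
        ∃ x y, π x = p ∧ π y = q ∧ F.le x y := by
  obtain ⟨φ, hφ⟩ := hF.universal _ isFiniteHForest_pointStructure
  obtain ⟨φ', hφ'⟩ := prefence_exists_isEpimorphism isFiniteHForest_pointStructure
  obtain ⟨f, -, hR, hle⟩ := hF.hasLifts.exists_homeomorph hasLifts_prefence
    isFiniteHForest_pointStructure hφ hφ'
  let f' : F → PrefencePt := f
  have hf' : Continuous f' := f.continuous
  have hsurj : ∀ z : PrefencePt, ∃ x, f' x = z := f.surjective
  have hR' : ∀ x y, F.R x y ↔ (f' x).1.1 = (f' y).1.1 ∧ cutVal (f' x).1.2 = cutVal (f' y).1.2 := hR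
  have hle' : ∀ x y, F.le x y ↔ (f' x).1.1 = (f' y).1.1 ∧ (f' x).1.2 ≤ (f' y).1.2 := hle
  have hmono : ∀ x y, F.le x y → cutVal (f' x).1.2 ≤ cutVal (f' y).1.2 := by
    intro x y hxy
    by_contra h
    -- A strict inequality of values in the wrong direction would order the cuts both ways and thus
    -- make them equal.
    have h1 := (f' y).2.1.le_of_cutVal_lt (f' x).2.1 (not_le.mp h) ⟨_, ((f' y).2.2 0).2⟩
      ⟨_, ((f' x).2.2 0).1⟩
    exact h (congrArg cutVal (le_antisymm ((hle' x y).mp hxy).2 h1)).le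
  refine ⟨fun x => ((f' x).1.1, cutVal (f' x).1.2), ?_, ?_, fun x y => ?_, fun x y hxy => ?_, ?_⟩
  · exact (by fun_prop : Continuous fun x => (f' x).1.1).prodMk (continuous_cutVal.comp hf')
  · ext p
    constructor
    · rintro ⟨x, rfl⟩
      exact ⟨(f' x).2.lo_le, (f' x).2.le_hi⟩
    · rintro ⟨h1, h2⟩
      obtain ⟨k, hk, hval⟩ := exists_fits h1 h2
      obtain ⟨x, hx⟩ := hsurj ⟨(p.1, k), hk⟩
      exact ⟨x, by dsimp only; rw [hx]; exact Prod.ext rfl hval⟩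
  · rw [hR', Prod.ext_iff]
  · exact ⟨((hle' x y).mp hxy).1, hmono _ _ hxy⟩
  · rintro ⟨c, s⟩ ⟨c', t⟩ h1 h2 (rfl : c = c') (hst : s ≤ t)
    obtain ⟨k, hk, hks⟩ := exists_fits h1 (hst.trans h2)
    obtain ⟨x, hx⟩ := hsurj ⟨(c, k), hk⟩
    rcases hst.eq_or_lt with rfl | hlt
    · refine ⟨x, x, ?_, ?_, (hle' x x).mpr ⟨rfl, le_rfl⟩⟩ <;> dsimp only <;> rw [hx] <;>
        exact Prod.ext rfl hks
    · obtain ⟨l, hl, hlt'⟩ := exists_fits (h1.trans hst) h2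
      obtain ⟨y, hy⟩ := hsurj ⟨(c, l), hl⟩
      refine ⟨x, y, by dsimp only; rw [hx]; exact Prod.ext rfl hks,
        by dsimp only; rw [hy]; exact Prod.ext rfl hlt', ?_⟩
      rw [hle', hx, hy]
      exact ⟨rfl, hk.1.le_of_cutVal_lt hl.1 (by rwa [hks, hlt']) ⟨_, (hk.2 0).2⟩ ⟨_, (hl.2 0).1⟩⟩

/-! ### Full clopen sets of codes -/

/-- A clopen set of codes, one of which has the interval `[a, b]` while the intervals of all the
others are contained in `[a, b]`. -/
structure IsFull (N : Set Code) (a b : ℚ) : Prop where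
  isClopen : IsClopen N
  lt : a < b
  exists_center : ∃ m ∈ N, lo m = a ∧ hi m = b
  le_lo : ∀ d ∈ N, (a : ℝ) ≤ lo d
  hi_le : ∀ d ∈ N, hi d ≤ b

theorem isFull_cylinder (c : Code) (n : ℕ) :
    IsFull (PiNat.cylinder c n) (ivl c n).1 (ivl c n).2 where
  isClopen := isClopen_cylinder c n
  lt := ivl_lt c n
  exists_center := ⟨trunc c n, trunc_mem_cylinder c n, lo_trunc c n, hi_trunc c n⟩
  le_lo _ h := ivl_fst_le_lo_of_mem h
  hi_le _ h := hi_le_ivl_snd_of_mem h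

theorem mem_cylinder_trunc {c d : Code} {n : ℕ} :
    d ∈ PiNat.cylinder c n ↔ trunc d n = trunc c n := by
  constructor
  · intro h
    funext i
    simp only [trunc]
    split_ifs with hi
    exacts [h i hi, rfl]
  · intro h i hi
    simpa [trunc, hi] using congrFun h i

theorem finite_range_trunc (n : ℕ) : (Set.range fun c => trunc c n).Finite := by
  refine (Set.finite_range fun (f : Fin n → Bool) (i : ℕ) =>
    if h : i < n then f ⟨i, h⟩ else false).subset ?_
  rintro _ ⟨c, rfl⟩
  refine ⟨fun i => c i, funext fun i => ?_⟩
  by_cases h : i < n <;> simp [trunc, h]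

namespace IsFull

variable {N : Set Code} {a b : ℚ}

theorem ivl_eq (hN : IsFull N a b) {m : Code} (hlo : lo m = a) (hhi : hi m = b) {n : ℕ}
    (hn : PiNat.cylinder m n ⊆ N) : ivl m n = (a, b) := by
  have h1 := ivl_fst_le_lo m n
  have h2 := hi_le_ivl_snd m n
  have h3 := hN.le_lo _ (hn (trunc_mem_cylinder m n))
  have h4 := hN.hi_le _ (hn (trunc_mem_cylinder m n))
  rw [lo_trunc] at h3
  rw [hi_trunc] at h4
  rw [hlo] at h1
  rw [hhi] at h2
  exact Prod.ext (by exact_mod_cast le_antisymm h1 h3) (by exact_mod_cast le_antisymm h4 h2)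

theorem exists_subset (hN : IsFull N a b) {a' b' : ℚ} (h1 : a ≤ a') (h : a' < b') (h2 : b' ≤ b)
    {F : Set Code} (hF : F.Finite) : ∃ M ⊆ N, IsFull M a' b' ∧ Disjoint M F := by
  obtain ⟨m, hm, hlo, hhi⟩ := hN.exists_center
  obtain ⟨n, hn⟩ := exists_cylinder_subset (hN.isClopen.isOpen.mem_nhds hm)
  have hivl := hN.ivl_eq hlo hhi hn
  obtain ⟨j, -, hnj, hj, -, -, hdisj⟩ := exists_stamp m n 0 (a := a') (b := b')
    (by rwa [hivl]) h (by rwa [hivl]) hF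
  refine ⟨_, (cylinder_stamp_subset m hnj).trans hn, ?_, hdisj⟩
  have := isFull_cylinder (stamp m n j) (j + 1)
  rwa [hj] at this

theorem sdiff (hN : IsFull N a b) {M : Set Code} (hM : IsClopen M)
    (h : ∃ m ∈ N \ M, lo m = a ∧ hi m = b) : IsFull (N \ M) a b where
  isClopen := hN.isClopen.diff hM
  lt := hN.lt
  exists_center := h
  le_lo d hd := hN.le_lo d hd.1
  hi_le d hd := hN.hi_le d hd.1

theorem exists_disjoint_subsets {ι : Type u} (T : Finset ι) {α β : ι → ℚ}
    (h : ∀ t ∈ T, a ≤ α t ∧ α t < β t ∧ β t ≤ b) (hN : IsFull N a b) :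
    ∃ E : ι → Set Code, (∀ t ∈ T, E t ⊆ N ∧ IsFull (E t) (α t) (β t)) ∧
      (∀ t ∈ T, ∀ t' ∈ T, t ≠ t' → Disjoint (E t) (E t')) ∧ IsFull (N \ ⋃ t ∈ T, E t) a b := by
  classical
  induction T using Finset.induction_on with
  | empty => exact ⟨fun _ => ∅, by simp, by simp, by simpa⟩
  | insert t T ht ih =>
    obtain ⟨E, hE1, hE2, hE3⟩ := ih fun t' ht' => h t' (Finset.mem_insert_of_mem ht')
    obtain ⟨m, hm, hlo, hhi⟩ := hE3.exists_center
    obtain ⟨h1, h2, h3⟩ := h t (Finset.mem_insert_self _ _)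
    -- The new set omits the center `m` of what is left, so the remainder stays full with the same
    -- interval.
    obtain ⟨M, hM, hMfull, hdisj⟩ := hE3.exists_subset h1 h2 h3 (Set.finite_singleton m)
    have hne : ∀ t' ∈ T, t' ≠ t := fun t' ht' h => ht (h ▸ ht')
    have hU : ∀ t' ∈ T, Disjoint M (E t') := fun t' ht' => Set.disjoint_left.mpr fun x hx hx' =>
      (hM hx).2 (Set.mem_iUnion₂.mpr ⟨t', ht', hx'⟩)
    have hEM : ∀ t' ∈ T, Function.update E t M t' = E t' := fun t' ht' =>
      Function.update_of_ne (hne t' ht') _ _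
    refine ⟨Function.update E t M, fun t' ht' => ?_, fun t₁ h₁ t₂ h₂ h₁₂ => ?_, ?_⟩
    · rcases Finset.mem_insert.mp ht' with rfl | ht'
      · rw [Function.update_self]
        exact ⟨hM.trans Set.sdiff_subset, hMfull⟩
      · rw [hEM t' ht']
        exact hE1 t' ht'
    · rcases Finset.mem_insert.mp h₁ with e₁ | h₁ <;> rcases Finset.mem_insert.mp h₂ with e₂ | h₂
      · exact absurd (e₁.trans e₂.symm) h₁₂
      · rw [e₁, Function.update_self, hEM _ h₂]
        exact hU _ h₂
      · rw [e₂, Function.update_self, hEM _ h₁]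
        exact (hU _ h₁).symm
      · rw [hEM _ h₁, hEM _ h₂]
        exact hE2 _ h₁ _ h₂ h₁₂
    · have : N \ ⋃ t' ∈ insert t T, Function.update E t M t' = (N \ ⋃ t' ∈ T, E t') \ M := by
        rw [Finset.set_biUnion_insert, Function.update_self, Set.iUnion₂_congr hEM,
          Set.sdiff_sdiff, Set.union_comm]
      rw [this]
      exact hE3.sdiff hMfull.isClopen
        ⟨m, ⟨hm, fun h => Set.disjoint_left.mp hdisj h rfl⟩, hlo, hhi⟩

theorem exists_uniform_cylinder (hN : IsFull N a b) (n : ℕ) :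
    ∃ l, n ≤ l ∧ ∀ x ∈ N, PiNat.cylinder x l ⊆ N := by
  have hloc : ∀ x ∈ N, ∃ k, PiNat.cylinder x k ⊆ N := fun x hx =>
    exists_cylinder_subset (hN.isClopen.isOpen.mem_nhds hx)
  choose! k hk using hloc
  obtain ⟨t, ht, hcov⟩ := hN.isClopen.isClosed.isCompact.elim_nhds_subcover
    (fun x => PiNat.cylinder x (k x))
    fun x _ => (isClopen_cylinder x _).isOpen.mem_nhds (PiNat.self_mem_cylinder x _)
  refine ⟨max n (t.sup k), le_max_left _ _, fun x hx => ?_⟩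
  obtain ⟨z, hz, hxz⟩ := Set.mem_iUnion₂.mp (hcov hx)
  have h1 : k z ≤ max n (t.sup k) := (Finset.le_sup hz).trans (le_max_right _ _)
  refine (PiNat.cylinder_anti x h1).trans ?_
  rw [PiNat.mem_cylinder_iff_eq.mp hxz]
  exact hk z (ht z hz)

end IsFull

/-! ### Matchings of full clopen sets -/

/-- `M × M'` is a block of the relation `Z`. -/
def IsBlock (Z : Set (Code × Code)) (M M' : Set Code) : Prop :=
  ∀ y y', y ∈ M ∨ y' ∈ M' → ((y, y') ∈ Z ↔ y ∈ M ∧ y' ∈ M')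

/-- A block both sides of which are full, with intervals related by `q ↦ r * q + s`. -/
def IsFullBlock (r s : ℚ) (Z : Set (Code × Code)) (M M' : Set Code) : Prop :=
  IsBlock Z M M' ∧ ∃ a b, IsFull M a b ∧ IsFull M' (r * a + s) (r * b + s)

/-- The relation `Z` between `N` and `N'` consists of blocks. -/
structure IsMatching (r s : ℚ) (N N' : Set Code) (Z : Set (Code × Code)) : Prop where
  subset : Z ⊆ N ×ˢ N'
  left : ∀ x ∈ N, ∃ M M', x ∈ M ∧ IsFullBlock r s Z M M'
  right : ∀ x' ∈ N', ∃ M M', x' ∈ M' ∧ IsFullBlock r s Z M M'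

/-- Points related to a common point agree in the first `n` digits. -/
def LeftFine (n : ℕ) (Z : Set (Code × Code)) : Prop :=
  ∀ x y x', (x, x') ∈ Z → (y, x') ∈ Z → y ∈ PiNat.cylinder x n

theorem isMatching_prod {r s : ℚ} {N N' : Set Code} {a b : ℚ} (hN : IsFull N a b)
    (hN' : IsFull N' (r * a + s) (r * b + s)) : IsMatching r s N N' (N ×ˢ N') := by
  have : IsFullBlock r s (N ×ˢ N') N N' := ⟨fun y y' _ => Iff.rfl, a, b, hN, hN'⟩
  exact ⟨subset_rfl, fun x hx => ⟨N, N', hx, this⟩, fun x hx => ⟨N, N', hx, this⟩⟩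

/-- `N` is divided into short cylinders, which are full. Each one other than that of the center `m`
is matched with a full subset of `N'` carrying the corresponding smaller interval, these subsets
being disjoint. The cylinder of `m` has the whole interval `[a, b]` and is matched with the rest of
`N'`, which is still full with the whole interval. -/
theorem exists_leftFine_matching {r s : ℚ} (hr : 0 < r) {N N' : Set Code} {a b : ℚ}
    (hN : IsFull N a b) (hN' : IsFull N' (r * a + s) (r * b + s)) (n : ℕ) :
    ∃ D, IsMatching r s N N' D ∧ LeftFine n D := by
  classical
  obtain ⟨l, hnl, hl⟩ := hN.exists_uniform_cylinder n
  obtain ⟨m, hm, hlo, hhi⟩ := hN.exists_center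
  have htrN : ∀ x ∈ N, trunc x l ∈ N := fun x hx => hl x hx (trunc_mem_cylinder x l)
  have hmono : ∀ {p q : ℚ}, p ≤ q → r * p + s ≤ r * q + s := fun h => by
    have := mul_le_mul_of_nonneg_left h hr.le; linarith
  have hmono' : ∀ {p q : ℚ}, p < q → r * p + s < r * q + s := fun h => by
    have := mul_lt_mul_of_pos_left h hr; linarith
  let T : Finset Code := ((finite_range_trunc l).toFinset.filter (· ∈ N)).erase (trunc m l)
  have hT : ∀ t, t ∈ T ↔ t ≠ trunc m l ∧ (∃ c, trunc c l = t) ∧ t ∈ N := fun t => by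
    simp [T]
  obtain ⟨E, hE1, hE2, hE3⟩ := hN'.exists_disjoint_subsets T
    (α := fun t => r * (ivl t l).1 + s) (β := fun t => r * (ivl t l).2 + s) fun t ht => by
      obtain ⟨-, -, htN⟩ := (hT t).mp ht
      have h1 := hN.le_lo _ (htrN t htN)
      have h2 := hN.hi_le _ (htrN t htN)
      rw [lo_trunc] at h1
      rw [hi_trunc] at h2
      exact ⟨hmono (by exact_mod_cast h1), hmono' (ivl_lt t l), hmono (by exact_mod_cast h2)⟩
  let E' : Code → Set Code := fun t => if t = trunc m l then N' \ ⋃ t ∈ T, E t else E t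
  have hE0 : E' (trunc m l) = N' \ ⋃ t ∈ T, E t := if_pos rfl
  have hET : ∀ t ∈ T, E' t = E t := fun t ht => if_neg ((hT t).mp ht).1
  have hcase : ∀ x ∈ N, trunc x l = trunc m l ∨ trunc x l ∈ T := fun x hx => by
    by_cases h : trunc x l = trunc m l
    · exact Or.inl h
    · exact Or.inr ((hT _).mpr ⟨h, ⟨x, rfl⟩, htrN x hx⟩)
  have hE'sub : ∀ x ∈ N, E' (trunc x l) ⊆ N' := fun x hx => by
    rcases hcase x hx with h | h
    · rw [h, hE0]; exact Set.sdiff_subset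
    · rw [hET _ h]; exact (hE1 _ h).1
  have hfull : ∀ x ∈ N, IsFull (E' (trunc x l)) (r * (ivl x l).1 + s) (r * (ivl x l).2 + s) := by
    intro x hx
    rcases hcase x hx with h | h
    · have := hN.ivl_eq hlo hhi (hl m hm)
      rw [h, hE0, ← ivl_trunc x, h, ivl_trunc, this]
      exact hE3
    · rw [hET _ h, ← ivl_trunc x]
      exact (hE1 _ h).2
  have hdisj : ∀ x ∈ N, ∀ y ∈ N, ∀ x', x' ∈ E' (trunc x l) → x' ∈ E' (trunc y l) →
      trunc x l = trunc y l := by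
    intro x hx y hy x' h1 h2
    rcases hcase x hx with h | h <;> rcases hcase y hy with h' | h'
    · rw [h, h']
    · rw [h, hE0] at h1
      rw [hET _ h'] at h2
      exact absurd (Set.mem_iUnion₂.mpr ⟨_, h', h2⟩) h1.2
    · rw [h', hE0] at h2
      rw [hET _ h] at h1
      exact absurd (Set.mem_iUnion₂.mpr ⟨_, h, h1⟩) h2.2
    · rw [hET _ h] at h1
      rw [hET _ h'] at h2
      by_contra hne
      exact Set.disjoint_left.mp (hE2 _ h _ h' hne) h1 h2
  have hblock : ∀ x ∈ N, IsFullBlock r s {p | p.1 ∈ N ∧ p.2 ∈ E' (trunc p.1 l)}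
      (PiNat.cylinder x l) (E' (trunc x l)) := by
    refine fun x hx => ⟨fun y y' h => ⟨fun hy => ?_, fun hy => ?_⟩, _, _, isFull_cylinder x l,
      hfull x hx⟩
    · rcases h with h | h
      · exact ⟨h, mem_cylinder_trunc.mp h ▸ hy.2⟩
      · exact ⟨mem_cylinder_trunc.mpr (hdisj y hy.1 x hx y' hy.2 h), h⟩
    · refine ⟨hl x hx hy.1, ?_⟩
      change y' ∈ E' (trunc y l)
      rw [mem_cylinder_trunc.mp hy.1]
      exact hy.2
  refine ⟨{p | p.1 ∈ N ∧ p.2 ∈ E' (trunc p.1 l)}, ⟨fun p hp => ⟨hp.1, hE'sub _ hp.1 hp.2⟩,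
    fun x hx => ⟨_, _, PiNat.self_mem_cylinder x l, hblock x hx⟩, fun x' hx' => ?_⟩,
    fun x y x' hx hy => ?_⟩
  · by_cases h : ∃ t ∈ T, x' ∈ E t
    · obtain ⟨t, ht, hx'⟩ := h
      obtain ⟨-, ⟨c, rfl⟩, hcN⟩ := (hT t).mp ht
      have := hblock _ hcN
      have htt : trunc (trunc c l) l = trunc c l := mem_cylinder_trunc.mp (trunc_mem_cylinder c l)
      refine ⟨_, _, ?_, this⟩
      rwa [htt, hET _ ht]
    · refine ⟨_, _, ?_, hblock m hm⟩
      rw [hE0]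
      exact ⟨hx', fun hU => h (by simpa using hU)⟩
  · exact PiNat.cylinder_anti x hnl
      (mem_cylinder_trunc.mpr (hdisj x hx.1 y hy.1 x' hx.2 hy.2).symm)

theorem IsFullBlock.eq_sets {r s : ℚ} {Z : Set (Code × Code)} {M M' : Set Code}
    (h : IsFullBlock r s Z M M') {x : Code} (hx : x ∈ M) :
    {y' | (x, y') ∈ Z} = M' ∧ {y | ∃ y', (y, y') ∈ Z ∧ (x, y') ∈ Z} = M := by
  obtain ⟨hb, a, b, -, hM'⟩ := h
  have h1 : ∀ y', (x, y') ∈ Z ↔ y' ∈ M' := fun y' => by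
    rw [hb x y' (Or.inl hx)]; simp [hx]
  refine ⟨Set.ext h1, Set.ext fun y => ⟨?_, fun hy => ?_⟩⟩
  · rintro ⟨y', h2, h3⟩
    exact ((hb y y' (Or.inr ((h1 y').mp h3))).mp h2).1
  · obtain ⟨m', hm', -⟩ := hM'.exists_center
    exact ⟨m', (hb y m' (Or.inl hy)).mpr ⟨hy, hm'⟩, (h1 m').mpr hm'⟩

theorem IsMatching.exists_mem {r s : ℚ} {N N' : Set Code} {Z : Set (Code × Code)}
    (hZ : IsMatching r s N N' Z) {p : Code × Code} (hp : p ∈ Z) :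
    ∃ M M', p.1 ∈ M ∧ p.2 ∈ M' ∧ IsFullBlock r s Z M M' := by
  obtain ⟨M, M', hx, hb⟩ := hZ.left p.1 (hZ.subset hp).1
  exact ⟨M, M', hx, ((hb.1 p.1 p.2 (Or.inl hx)).mp hp).2, hb⟩

/-- Matchings can be refined block by block. -/
theorem IsMatching.exists_refinement {r s : ℚ} {N N' : Set Code} {Z : Set (Code × Code)}
    (hZ : IsMatching r s N N' Z) {n : ℕ}
    (h : ∀ {M M' : Set Code} {a b : ℚ}, IsFull M a b → IsFull M' (r * a + s) (r * b + s) →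
      ∃ D, IsMatching r s M M' D ∧ LeftFine n D) :
    ∃ Z' ⊆ Z, IsMatching r s N N' Z' ∧ LeftFine n Z' := by
  have hD : ∀ M M', IsFullBlock r s Z M M' → ∃ D, IsMatching r s M M' D ∧ LeftFine n D := by
    rintro M M' ⟨-, a, b, h1, h2⟩
    exact h h1 h2
  choose! D hDm hDf using hD
  -- The two sets recover from `Z` alone the block containing `p`, so that the same refinement `D`
  -- is used throughout each block.
  let Z' : Set (Code × Code) := {p | p ∈ Z ∧
    p ∈ D {y | ∃ y', (y, y') ∈ Z ∧ (p.1, y') ∈ Z} {y' | (p.1, y') ∈ Z}}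
  have hmem : ∀ {M M'}, IsFullBlock r s Z M M' → ∀ p : Code × Code, p.1 ∈ M →
      (p ∈ Z' ↔ p ∈ D M M') := by
    intro M M' hb p hp
    change p ∈ Z ∧ p ∈ D _ _ ↔ _
    rw [(hb.eq_sets hp).1, (hb.eq_sets hp).2]
    refine ⟨fun h => h.2, fun h => ⟨?_, h⟩⟩
    exact (hb.1 p.1 p.2 (Or.inl hp)).mpr ((hDm M M' hb).subset h)
  have hblock : ∀ {M M' K K'}, IsFullBlock r s Z M M' → IsFullBlock r s (D M M') K K' →
      IsFullBlock r s Z' K K' := by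
    intro M M' K K' hb hK
    have hsub : K ⊆ M ∧ K' ⊆ M' := by
      obtain ⟨hKb, a, b, hKf, hKf'⟩ := hK
      obtain ⟨m, hm, -⟩ := hKf.exists_center
      obtain ⟨m', hm', -⟩ := hKf'.exists_center
      exact ⟨fun x hx => ((hDm M M' hb).subset ((hKb x m' (Or.inl hx)).mpr ⟨hx, hm'⟩)).1,
        fun x hx => ((hDm M M' hb).subset ((hKb m x (Or.inr hx)).mpr ⟨hm, hx⟩)).2⟩
    refine ⟨fun y y' hyy => ?_, hK.2⟩
    by_cases hy : y ∈ M
    · rw [hmem hb (y, y') hy]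
      exact hK.1 y y' hyy
    · have hy' : y' ∈ M' := hsub.2 (hyy.resolve_left fun h => hy (hsub.1 h))
      constructor
      · rintro ⟨h1, -⟩
        exact absurd ((hb.1 y y' (Or.inr hy')).mp h1).1 hy
      · rintro ⟨h1, -⟩
        exact absurd (hsub.1 h1) hy
  refine ⟨Z', fun p hp => hp.1, ⟨fun p hp => hZ.subset hp.1, fun x hx => ?_, fun x' hx' => ?_⟩,
    fun x y x' hx hy => ?_⟩
  · obtain ⟨M, M', hxM, hb⟩ := hZ.left x hx
    obtain ⟨K, K', hxK, hK⟩ := (hDm M M' hb).left x hxM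
    exact ⟨K, K', hxK, hblock hb hK⟩
  · obtain ⟨M, M', hxM, hb⟩ := hZ.right x' hx'
    obtain ⟨K, K', hxK, hK⟩ := (hDm M M' hb).right x' hxM
    exact ⟨K, K', hxK, hblock hb hK⟩
  · obtain ⟨M, M', hxM, hxM', hb⟩ := hZ.exists_mem hx.1
    have hyM : y ∈ M := ((hb.1 y x' (Or.inr hxM')).mp hy.1).1
    exact hDf M M' hb x y x' ((hmem hb (x, x') hxM).mp hx) ((hmem hb (y, x') hyM).mp hy)

theorem IsMatching.swap {r s : ℚ} (hr : r ≠ 0) {N N' : Set Code} {Z : Set (Code × Code)}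
    (hZ : IsMatching r s N N' Z) :
    IsMatching r⁻¹ (-(r⁻¹ * s)) N' N (Prod.swap ⁻¹' Z) := by
  have hb : ∀ {M M'}, IsFullBlock r s Z M M' →
      IsFullBlock r⁻¹ (-(r⁻¹ * s)) (Prod.swap ⁻¹' Z) M' M := by
    rintro M M' ⟨hb, a, b, h1, h2⟩
    refine ⟨fun y y' h => ?_, _, _, h2, ?_⟩
    · rw [Set.mem_preimage, Prod.swap_prod_mk, hb y' y h.symm, and_comm]
    · have : ∀ q : ℚ, r⁻¹ * (r * q + s) + -(r⁻¹ * s) = q := fun q => by field_simp; ring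
      rwa [this, this]
  refine ⟨fun p hp => (hZ.subset hp).symm, fun x hx => ?_, fun x hx => ?_⟩
  · obtain ⟨M, M', h1, h2⟩ := hZ.right x hx
    exact ⟨M', M, h1, hb h2⟩
  · obtain ⟨M, M', h1, h2⟩ := hZ.left x hx
    exact ⟨M', M, h1, hb h2⟩

theorem IsMatching.exists_fine {r s : ℚ} (hr : 0 < r) {N N' : Set Code} {Z : Set (Code × Code)}
    (hZ : IsMatching r s N N' Z) (n : ℕ) :
    ∃ Z' ⊆ Z, IsMatching r s N N' Z' ∧ LeftFine n Z' ∧ LeftFine n (Prod.swap ⁻¹' Z') := by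
  obtain ⟨Z₁, h1, hZ₁, hf₁⟩ := hZ.exists_refinement (n := n) fun h h' =>
    exists_leftFine_matching hr h h' n
  obtain ⟨Z₂, h2, hZ₂, hf₂⟩ := (hZ₁.swap hr.ne').exists_refinement (n := n) fun h h' =>
    exists_leftFine_matching (inv_pos.mpr hr) h h' n
  refine ⟨Prod.swap ⁻¹' Z₂, fun p hp => h1 (h2 hp), ?_, fun x y x' hx hy => ?_, hf₂⟩
  · have := hZ₂.swap (inv_ne_zero hr.ne')
    rwa [inv_inv, show -(r * -(r⁻¹ * s)) = s by field_simp] at this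
  · exact hf₁ x y x' (h2 hx) (h2 hy)

theorem exists_cylinder_dist_lt {X : Type u} [MetricSpace X] [CompactSpace X] {j : X → Code}
    (hj : Continuous j) (hinj : Function.Injective j) {ε : ℝ} (hε : 0 < ε) :
    ∃ n, ∀ x y, j y ∈ PiNat.cylinder (j x) n → dist x y < ε := by
  by_contra! h
  have hcl : ∀ n, IsClosed {p : X × X | j p.2 ∈ PiNat.cylinder (j p.1) n ∧ ε ≤ dist p.1 p.2} := by
    refine fun n => IsClosed.inter ?_ (isClosed_le continuous_const continuous_dist)
    change IsClosed {p : X × X | ∀ i < n, j p.2 i = j p.1 i}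
    simp only [Set.ofPred_forall]
    exact isClosed_iInter fun i => isClosed_iInter fun _ => isClosed_eq
      ((continuous_apply i).comp (hj.comp continuous_snd))
      ((continuous_apply i).comp (hj.comp continuous_fst))
  obtain ⟨p, hp⟩ := IsCompact.nonempty_iInter_of_sequence_nonempty_isCompact_isClosed
    (fun n => {p : X × X | j p.2 ∈ PiNat.cylinder (j p.1) n ∧ ε ≤ dist p.1 p.2})
    (fun n p hp => ⟨PiNat.cylinder_anti _ n.le_succ hp.1, hp.2⟩)
    (fun n => by obtain ⟨x, y, h1, h2⟩ := h n; exact ⟨(x, y), h1, h2⟩) (hcl 0).isCompact hcl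
  simp only [Set.mem_iInter, Set.mem_ofPred_eq] at hp
  have heq : p.1 = p.2 := hinj (funext fun i => ((hp (i + 1)).1 i i.lt_succ_self).symm)
  have := (hp 0).2
  rw [heq, dist_self] at this
  linarith

/-- Back-and-forth through ever finer matchings. Each matching pairs blocks whose largest intervals
correspond under `q ↦ r * q + s`, and these intervals converge to the fibres over `x` and `f x`. -/
theorem IsFull.exists_homeomorph {r s : ℚ} (hr : 0 < r) {N N' : Set Code} {a b : ℚ}
    (hN : IsFull N a b) (hN' : IsFull N' (r * a + s) (r * b + s)) :
    ∃ f : N ≃ₜ N', ∀ x : N, lo (f x).1 = r * lo x.1 + s ∧ hi (f x).1 = r * hi x.1 + s := by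
  have : CompactSpace N := isCompact_iff_compactSpace.mp hN.isClopen.isClosed.isCompact
  have : CompactSpace N' := isCompact_iff_compactSpace.mp hN'.isClopen.isClosed.isCompact
  let m₁ := metrizableSpaceMetric N
  let m₂ := metrizableSpaceMetric N'
  let ι : N × N' → Code × Code := fun p => (p.1.1, p.2.1)
  obtain ⟨f, -, hf⟩ := exists_homeomorph_of_back_and_forth
    (fun Z : Set (N × N') => ∃ W, IsMatching r s N N' W ∧ Z = ι ⁻¹' W)
    (by
      rintro _ ⟨W, hW, rfl⟩
      rw [← isOpen_compl_iff, isOpen_iff_mem_nhds]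
      intro p hp
      obtain ⟨M, M', hM, hb, a, b, hf, hf'⟩ := hW.left p.1.1 p.1.2
      have h1 : p.2.1 ∉ M' := fun h => hp ((hb _ _ (Or.inl hM)).mpr ⟨hM, h⟩)
      have h2 : {q : N × N' | q.1.1 ∈ M ∧ q.2.1 ∈ M'ᶜ} ∈ 𝓝 p :=
        ((hf.isClopen.isOpen.preimage (by fun_prop : Continuous fun q : N × N' => q.1.1)).inter
          (hf'.isClopen.compl.isOpen.preimage
            (by fun_prop : Continuous fun q : N × N' => q.2.1))).mem_nhds ⟨hM, h1⟩
      filter_upwards [h2] with q hq hqW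
      exact hq.2 ((hb _ _ (Or.inl hq.1)).mp hqW).2)
    (by
      rintro _ ⟨W, hW, rfl⟩ x
      obtain ⟨M, M', hM, hb, a, b, hf, hf'⟩ := hW.left x.1 x.2
      obtain ⟨m', hm', -⟩ := hf'.exists_center
      have : (x.1, m') ∈ W := (hb _ _ (Or.inl hM)).mpr ⟨hM, hm'⟩
      exact ⟨⟨m', (hW.subset this).2⟩, this⟩)
    (by
      rintro _ ⟨W, hW, rfl⟩ y
      obtain ⟨M, M', hM, hb, a, b, hf, hf'⟩ := hW.right y.1 y.2
      obtain ⟨m, hm, -⟩ := hf.exists_center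
      have : (m, y.1) ∈ W := (hb _ _ (Or.inr hM)).mpr ⟨hm, hM⟩
      exact ⟨⟨m, (hW.subset this).1⟩, this⟩)
    (by
      rintro _ ⟨W, hW, rfl⟩ ε hε
      obtain ⟨n₁, h₁⟩ := exists_cylinder_dist_lt (X := N) continuous_subtype_val
        Subtype.val_injective hε
      obtain ⟨n₂, h₂⟩ := exists_cylinder_dist_lt (X := N') continuous_subtype_val
        Subtype.val_injective hε
      obtain ⟨W', hsub, hW', hl, hr'⟩ := hW.exists_fine hr (max n₁ n₂)
      refine ⟨ι ⁻¹' W', Set.preimage_mono hsub, ⟨W', hW', rfl⟩, fun x x' y h h' => ?_,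
        fun x y y' h h' => ?_⟩
      · exact h₁ x x' (PiNat.cylinder_anti _ (le_max_left _ _) (hl _ _ _ h h'))
      · exact h₂ y y' (PiNat.cylinder_anti _ (le_max_right _ _) (hr' _ _ x.1 h h')))
    (ι ⁻¹' (N ×ˢ N')) ⟨_, isMatching_prod hN hN', rfl⟩
  refine ⟨f, fun x => ?_⟩
  -- Here `[a, b]` is the interval of a block containing `x` that is small enough for its center to
  -- share `n` digits with `x`. It then lies between the fibre over `x` and the n-th interval of
  -- `x`, and likewise on the side of `f x`; both bounds converge to the ends of the fibres.
  have key : ∀ n, ∃ a b : ℚ, ((ivl x.1 n).1 ≤ (a : ℝ) ∧ (a : ℝ) ≤ lo x.1) ∧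
      ((ivl (f x).1 n).1 ≤ ((r * a + s : ℚ) : ℝ) ∧ ((r * a + s : ℚ) : ℝ) ≤ lo (f x).1) ∧
      (hi x.1 ≤ (b : ℝ) ∧ (b : ℝ) ≤ (ivl x.1 n).2) ∧
      (hi (f x).1 ≤ ((r * b + s : ℚ) : ℝ) ∧ ((r * b + s : ℚ) : ℝ) ≤ (ivl (f x).1 n).2) := by
    intro n
    have hnb : ∀ {K : Set Code} (z : K), Subtype.val ⁻¹' PiNat.cylinder z.1 n ∈ 𝓝 z := fun z =>
      continuous_subtype_val.continuousAt.preimage_mem_nhds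
        ((isClopen_cylinder _ _).isOpen.mem_nhds (PiNat.self_mem_cylinder _ _))
    obtain ⟨ε₁, hε₁, h₁⟩ := Metric.mem_nhds_iff.mp (hnb x)
    obtain ⟨ε₂, hε₂, h₂⟩ := Metric.mem_nhds_iff.mp (hnb (f x))
    obtain ⟨_, ⟨W, hW, rfl⟩, hsm, hfZ⟩ := hf (min ε₁ ε₂) (lt_min hε₁ hε₂)
    obtain ⟨M, M', hM, hM', hb, a, b, hfull, hfull'⟩ := hW.exists_mem (hfZ x)
    obtain ⟨m, hm, hlo, hhi⟩ := hfull.exists_center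
    obtain ⟨m', hm', hlo', hhi'⟩ := hfull'.exists_center
    have hmW : (m, (f x).1) ∈ W := (hb _ _ (Or.inl hm)).mpr ⟨hm, hM'⟩
    have hmW' : (x.1, m') ∈ W := (hb _ _ (Or.inr hm')).mpr ⟨hM, hm'⟩
    have hmx : m ∈ PiNat.cylinder x.1 n := @h₁ ⟨m, (hW.subset hmW).1⟩ (Metric.mem_ball'.mpr
      ((hsm.1 x ⟨m, (hW.subset hmW).1⟩ (f x) (hfZ x) hmW).trans_le (min_le_left _ _)))
    have hmx' : m' ∈ PiNat.cylinder (f x).1 n := @h₂ ⟨m', (hW.subset hmW').2⟩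
      (Metric.mem_ball'.mpr ((hsm.2 x (f x) ⟨m', (hW.subset hmW').2⟩ (hfZ x) hmW').trans_le
        (min_le_right _ _)))
    refine ⟨a, b, ⟨?_, hfull.le_lo _ hM⟩, ⟨?_, hfull'.le_lo _ hM'⟩, ⟨hfull.hi_le _ hM, ?_⟩,
      ⟨hfull'.hi_le _ hM', ?_⟩⟩
    · exact hlo ▸ ivl_fst_le_lo_of_mem hmx
    · exact hlo' ▸ ivl_fst_le_lo_of_mem hmx'
    · exact hhi ▸ hi_le_ivl_snd_of_mem hmx
    · exact hhi' ▸ hi_le_ivl_snd_of_mem hmx'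
  choose a b ha ha' hb hb' using key
  constructor
  · refine tendsto_nhds_unique (f := fun n => ((r * a n + s : ℚ) : ℝ)) (l := Filter.atTop) ?_ ?_
    · exact tendsto_of_tendsto_of_tendsto_of_le_of_le (tendsto_ivl_fst _) tendsto_const_nhds
        (fun n => (ha' n).1) fun n => (ha' n).2
    · have : Filter.Tendsto (fun n => (a n : ℝ)) Filter.atTop (𝓝 (lo x.1)) :=
        tendsto_of_tendsto_of_tendsto_of_le_of_le (tendsto_ivl_fst _) tendsto_const_nhds
          (fun n => (ha n).1) fun n => (ha n).2
      simpa using (this.const_mul (r : ℝ)).add_const (s : ℝ)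
  · refine tendsto_nhds_unique (f := fun n => ((r * b n + s : ℚ) : ℝ)) (l := Filter.atTop) ?_ ?_
    · exact tendsto_of_tendsto_of_tendsto_of_le_of_le tendsto_const_nhds (tendsto_ivl_snd _)
        (fun n => (hb' n).1) fun n => (hb' n).2
    · have : Filter.Tendsto (fun n => (b n : ℝ)) Filter.atTop (𝓝 (hi x.1)) :=
        tendsto_of_tendsto_of_tendsto_of_le_of_le tendsto_const_nhds (tendsto_ivl_snd _)
          (fun n => (hb n).1) fun n => (hb n).2
      simpa using (this.const_mul (r : ℝ)).add_const (s : ℝ)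

/-! ### Gluing homeomorphisms of full clopen sets around a point -/

/-- The neighbourhood filter of `c` in the topology making `c ↦ (c, hi c)` an embedding. -/
noncomputable def topNhds (c : Code) : Filter Code := 𝓝 c ⊓ Filter.comap hi (𝓝 (hi c))

/-- The clopen sets `cylinder c (n i) \ cylinder c (n (i + 1))`. -/
def shell (c : Code) (n : ℕ → ℕ) (i : ℕ) : Set Code :=
  PiNat.cylinder c (n i) \ PiNat.cylinder c (n (i + 1))

theorem isClopen_shell (c : Code) (n : ℕ → ℕ) (i : ℕ) : IsClopen (shell c n i) :=
  (isClopen_cylinder c _).diff (isClopen_cylinder c _)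

theorem notMem_shell (c : Code) (n : ℕ → ℕ) (i : ℕ) : c ∉ shell c n i := fun h =>
  h.2 (PiNat.self_mem_cylinder c _)

theorem le_of_mem_shell {c d : Code} {n : ℕ → ℕ} (hn : StrictMono n) {i j : ℕ}
    (h : d ∈ shell c n i) (hj : d ∈ PiNat.cylinder c (n j)) : j ≤ i := by
  by_contra! hij
  exact h.2 (PiNat.cylinder_anti c (hn.monotone hij) hj)

theorem shell_injective {c d : Code} {n : ℕ → ℕ} (hn : StrictMono n) {i j : ℕ}
    (h : d ∈ shell c n i) (h' : d ∈ shell c n j) : i = j :=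
  le_antisymm (le_of_mem_shell hn h' h.1) (le_of_mem_shell hn h h'.1)

theorem exists_mem_shell {c d : Code} {n : ℕ → ℕ} (hn : StrictMono n) (h0 : n 0 = 0)
    (h : d ≠ c) : ∃ i, d ∈ shell c n i := by
  classical
  have hex : ∃ i, d ∉ PiNat.cylinder c (n i) := by
    by_contra! hall
    exact h (funext fun i => hall (i + 1) i (i.lt_succ_self.trans_le hn.le_apply))
  obtain ⟨i, hi⟩ : ∃ i, Nat.find hex = i + 1 := by
    refine Nat.exists_eq_succ_of_ne_zero fun h0' => Nat.find_spec hex ?_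
    rw [h0', h0, PiNat.cylinder_zero]
    trivial
  refine ⟨i, not_not.mp (Nat.find_min hex (m := i) (by omega)), ?_⟩
  rw [← hi]
  exact Nat.find_spec hex

/-- A cylinder around `c` contains a second code with the full interval, away from `c`. The next
level is chosen deep enough to leave that code in the shell. -/
theorem exists_isFull_shells (c : Code) : ∃ n : ℕ → ℕ, StrictMono n ∧ n 0 = 0 ∧
    ∀ i, IsFull (shell c n i) (ivl c (n i)).1 (ivl c (n i)).2 := by
  have hstep : ∀ n, ∃ n', n < n' ∧
      IsFull (PiNat.cylinder c n \ PiNat.cylinder c n') (ivl c n).1 (ivl c n).2 := by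
    intro n
    obtain ⟨M, hM, hfull, hdisj⟩ := (isFull_cylinder c n).exists_subset le_rfl (ivl_lt c n) le_rfl
      (Set.finite_singleton c)
    obtain ⟨k, hk⟩ := exists_cylinder_subset (c := c)
      (hfull.isClopen.compl.isOpen.mem_nhds fun h => Set.disjoint_left.mp hdisj h rfl)
    obtain ⟨m, hm, h⟩ := hfull.exists_center
    refine ⟨max k (n + 1), by omega, (isFull_cylinder c n).sdiff (isClopen_cylinder c _)
      ⟨m, ⟨hM hm, fun h' => ?_⟩, h⟩⟩
    exact hk (PiNat.cylinder_anti c (le_max_left _ _) h') hm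
  choose g hg hfull using hstep
  refine ⟨fun i => g^[i] 0, strictMono_nat_of_lt_succ fun i => ?_, rfl, fun i => ?_⟩
  · rw [Function.iterate_succ_apply']
    exact hg _
  · rw [shell, Function.iterate_succ_apply']
    exact hfull _

/-- The hypothesis `hσ` says that `σ i` preserves the distance from `hi` to the top of the shell's
interval, relative to the length of that interval. Away from `c` this makes the glued map continuous
for the graph topology. At `c` the danger is that short intervals are stretched to long ones, so
that small distances become large; `hdeg` excludes exactly a degenerate `c` with a nondegenerate
`c'`. -/
theorem exists_tendsto_of_shells {c c' : Code} {n n' : ℕ → ℕ} (hn : StrictMono n) (h0 : n 0 = 0)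
    (hn' : StrictMono n') (σ : ∀ i, shell c n i ≃ₜ shell c' n' i)
    (hσ : ∀ i x, ((ivl c' (n' i)).2 - hi (σ i x).1) * ((ivl c (n i)).2 - (ivl c (n i)).1) =
      ((ivl c (n i)).2 - hi x.1) * ((ivl c' (n' i)).2 - (ivl c' (n' i)).1))
    (hdeg : lo c < hi c ∨ lo c' = hi c') :
    ∃ f : Code → Code, f c = c' ∧ (∀ i (x : shell c n i), f x = σ i x) ∧
      ∀ d, Filter.Tendsto f (topNhds d) (topNhds (f d)) := by
  classical
  let f : Code → Code := fun d =>
    if h : ∃ i, d ∈ shell c n i then (σ h.choose ⟨d, h.choose_spec⟩).1 else c'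
  have hf : ∀ i (x : shell c n i), f x = σ i x := by
    intro i x
    have h : ∃ i, x.1 ∈ shell c n i := ⟨i, x.2⟩
    have hk : ∀ k (hk : x.1 ∈ shell c n k), (σ k ⟨x, hk⟩).1 = σ i x := by
      intro k hk
      obtain rfl := shell_injective hn x.2 hk
      rfl
    exact (dif_pos h).trans (hk _ h.choose_spec)
  have hfc : f c = c' := dif_neg fun ⟨i, h⟩ => notMem_shell c n i h
  refine ⟨f, hfc, hf, fun d => ?_⟩
  suffices h : Filter.Tendsto f (𝓝 d) (𝓝 (f d)) ∧
      Filter.Tendsto (hi ∘ f) (topNhds d) (𝓝 (hi (f d))) from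
    Filter.tendsto_inf.mpr ⟨h.1.mono_left inf_le_left, Filter.tendsto_comap_iff.mpr h.2⟩
  have hlen : ∀ (c : Code) (n : ℕ), (0 : ℝ) < (ivl c n).2 - (ivl c n).1 := fun c n => by
    have : ((ivl c n).1 : ℝ) < (ivl c n).2 := by exact_mod_cast ivl_lt c n
    linarith
  by_cases hd : d = c
  · subst hd
    rw [hfc]
    have hmaps : ∀ i, ∀ e ∈ PiNat.cylinder d (n i), e = d ∨
        ∃ j, i ≤ j ∧ ∃ h : e ∈ shell d n j, f e = σ j ⟨e, h⟩ := by
      intro i e he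
      by_cases hed : e = d
      · exact Or.inl hed
      · obtain ⟨j, hj⟩ := exists_mem_shell hn h0 hed
        exact Or.inr ⟨j, le_of_mem_shell hn hj he, hj, hf j ⟨e, hj⟩⟩
    have hcyl : ∀ i, PiNat.cylinder d (n i) ∈ 𝓝 d := fun i =>
      (isClopen_cylinder d _).isOpen.mem_nhds (PiNat.self_mem_cylinder d _)
    constructor
    · intro V hV
      obtain ⟨k, hk⟩ := exists_cylinder_subset hV
      rw [Filter.mem_map]
      filter_upwards [hcyl k] with e he
      obtain rfl | ⟨j, hj, h, hfe⟩ := hmaps k e he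
      · rw [Set.mem_preimage, hfc]
        exact mem_of_mem_nhds hV
      · rw [Set.mem_preimage, hfe]
        exact hk (PiNat.cylinder_anti c' (hj.trans hn'.le_apply) (σ j ⟨e, h⟩).2.1)
    · have hb := (tendsto_ivl_snd c').comp hn'.tendsto_atTop
      rw [tendsto_order]
      refine ⟨fun t ht => ?_, fun t ht => ?_⟩
      · rcases hdeg with hdeg | hdeg
        -- The intervals around `d` are at least as long as its nondegenerate fibre, so the
        -- stretching factors have a common bound `K`. It suffices that `hi e` and the upper ends of
        -- the intervals be within `(hi c' - t) / (2 * K)` of `hi d`.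
        · obtain ⟨K, hK0, hK⟩ : ∃ K : ℝ, 0 < K ∧ ∀ j, ((ivl c' (n' j)).2 - (ivl c' (n' j)).1 : ℝ) ≤
              K * ((ivl d (n j)).2 - (ivl d (n j)).1) := by
            have hpos : 0 < hi d - lo d := by linarith
            refine ⟨((ivl c' 0).2 - (ivl c' 0).1) / (hi d - lo d),
              div_pos (hlen _ _) hpos, fun j => ?_⟩
            rw [div_mul_eq_mul_div, le_div_iff₀ hpos]
            have h1 : ((ivl c' 0).1 : ℝ) ≤ (ivl c' (n' j)).1 := by
              exact_mod_cast monotone_ivl_fst c' (Nat.zero_le _)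
            have h2 : ((ivl c' (n' j)).2 : ℝ) ≤ (ivl c' 0).2 := by
              exact_mod_cast antitone_ivl_snd c' (Nat.zero_le _)
            have h3 := ivl_fst_le_lo d (n j)
            have h4 := hi_le_ivl_snd d (n j)
            exact mul_le_mul (by linarith) (by linarith) hpos.le (hlen _ _).le
          have hδ : 0 < (hi c' - t) / (2 * K) := div_pos (by linarith) (by linarith)
          obtain ⟨j₀, hj₀⟩ := Filter.eventually_atTop.mp
            (((tendsto_ivl_snd d).comp hn.tendsto_atTop).eventually_lt_const
              (show hi d < hi d + (hi c' - t) / (2 * K) by linarith))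
          have hev : ∀ᶠ e in topNhds d, hi d - (hi c' - t) / (2 * K) < hi e :=
            Filter.eventually_inf_principal.mp (by
              refine Filter.Eventually.filter_mono inf_le_left ?_
              exact Filter.Eventually.filter_mono inf_le_right
                (Filter.Eventually.comap (lt_mem_nhds (by linarith)) hi)) |>.mono
              fun e he => he trivial
          filter_upwards [hev, Filter.mem_inf_of_left (hcyl j₀)] with e h1 h2
          obtain rfl | ⟨j, hj, h, hfe⟩ := hmaps j₀ e h2
          · rwa [Function.comp_apply, hfc]
          · rw [Function.comp_apply, hfe]
            have h3 := hσ j ⟨e, h⟩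
            have h4 := hj₀ j hj
            have h5 := hi_le_ivl_snd c' (n' j)
            have h6 : (ivl d (n j)).2 - hi e < (hi c' - t) / K := by
              have : (hi c' - t) / K = 2 * ((hi c' - t) / (2 * K)) := by field_simp
              simp only [Function.comp_apply] at h4
              linarith
            rw [lt_div_iff₀ hK0] at h6
            have h7 : ((ivl d (n j)).2 - hi e) * ((ivl c' (n' j)).2 - (ivl c' (n' j)).1) ≤
                ((ivl d (n j)).2 - hi e) * (K * ((ivl d (n j)).2 - (ivl d (n j)).1)) :=
              mul_le_mul_of_nonneg_left (hK j) (sub_nonneg.mpr (hi_le_ivl_snd_of_mem h.1))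
            rw [← h3, ← mul_assoc] at h7
            have := le_of_mul_le_mul_right h7 (hlen d (n j))
            linarith
        -- If the fibre over `c'` is a point, the intervals shrink to it, and the left ends alone
        -- bound `hi (f e)` from below.
        · have ha := (tendsto_ivl_fst c').comp hn'.tendsto_atTop
          obtain ⟨j₀, hj₀⟩ := Filter.eventually_atTop.mp (ha.eventually_const_lt (hdeg ▸ ht))
          filter_upwards [Filter.mem_inf_of_left (hcyl j₀)] with e he
          obtain rfl | ⟨j, hj, h, hfe⟩ := hmaps j₀ e he
          · rwa [Function.comp_apply, hfc]
          · rw [Function.comp_apply, hfe]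
            exact (hj₀ j hj).trans_le
              ((ivl_fst_le_lo_of_mem (σ j ⟨e, h⟩).2.1).trans (lo_le_hi _))
      -- The upper bound is free: it is the upper semicontinuity of `hi` at `c'`.
      · obtain ⟨j₀, hj₀⟩ := Filter.eventually_atTop.mp (hb.eventually_lt_const ht)
        filter_upwards [Filter.mem_inf_of_left (hcyl j₀)] with e he
        obtain rfl | ⟨j, hj, h, hfe⟩ := hmaps j₀ e he
        · rwa [Function.comp_apply, hfc]
        · rw [Function.comp_apply, hfe]
          exact (hi_le_ivl_snd_of_mem (σ j ⟨e, h⟩).2.1).trans_lt (hj₀ j hj)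
  · obtain ⟨i, hi_mem⟩ := exists_mem_shell hn h0 hd
    have hmem := (isClopen_shell c n i).isOpen.mem_nhds hi_mem
    constructor
    · refine ContinuousOn.continuousAt (s := shell c n i) ?_ hmem
      rw [continuousOn_iff_continuous_domRestrict]
      have : (shell c n i).domRestrict f = fun x => (σ i x).1 := funext fun x => hf i x
      rw [this]
      exact continuous_subtype_val.comp (σ i).continuous
    · have key : ∀ e ∈ shell c n i, hi (f e) = (ivl c' (n' i)).2 - ((ivl c (n i)).2 - hi e) *
          ((ivl c' (n' i)).2 - (ivl c' (n' i)).1) / ((ivl c (n i)).2 - (ivl c (n i)).1) := by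
        intro e he
        rw [hf i ⟨e, he⟩, ← hσ i ⟨e, he⟩, mul_div_cancel_right₀ _ (hlen c (n i)).ne']
        ring
      have hlim : Filter.Tendsto hi (topNhds d) (𝓝 (hi d)) :=
        Filter.tendsto_comap.mono_left inf_le_right
      rw [key d hi_mem]
      refine Filter.Tendsto.congr' ?_ ((((hlim.const_sub _).mul_const _).div_const _).const_sub _)
      filter_upwards [Filter.mem_inf_of_left hmem] with e he using (key e he).symm

theorem exists_equiv_tendsto {c c' : Code} (h : lo c < hi c ↔ lo c' < hi c') :
    ∃ τ : Code ≃ Code, τ c = c' ∧ (∀ d, lo (τ d) < hi (τ d) ↔ lo d < hi d) ∧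
      (∀ d, Filter.Tendsto τ (topNhds d) (topNhds (τ d))) ∧
      ∀ d, Filter.Tendsto τ.symm (topNhds d) (topNhds (τ.symm d)) := by
  obtain ⟨n, hn, h0, hfull⟩ := exists_isFull_shells c
  obtain ⟨n', hn', h0', hfull'⟩ := exists_isFull_shells c'
  have hσ : ∀ i, ∃ σ : shell c n i ≃ₜ shell c' n' i, ∀ x,
      (((ivl c' (n' i)).2 - hi (σ x).1) * ((ivl c (n i)).2 - (ivl c (n i)).1) =
        ((ivl c (n i)).2 - hi x.1) * ((ivl c' (n' i)).2 - (ivl c' (n' i)).1)) ∧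
      (lo (σ x).1 < hi (σ x).1 ↔ lo x.1 < hi x.1) := by
    intro i
    have hp := sub_pos.mpr (ivl_lt c (n i))
    have hp' := sub_pos.mpr (ivl_lt c' (n' i))
    have hr := div_pos hp' hp
    set a := (ivl c (n i)).1
    set b := (ivl c (n i)).2
    set a' := (ivl c' (n' i)).1
    set b' := (ivl c' (n' i)).2
    have ha : a' = (b' - a') / (b - a) * a + (a' - (b' - a') / (b - a) * a) := by ring
    have hb : b' = (b' - a') / (b - a) * b + (a' - (b' - a') / (b - a) * a) := by
      field_simp [hp.ne']
      ring
    obtain ⟨σ, hσ⟩ := (hfull i).exists_homeomorph hr (N' := shell c' n' i)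
      (s := a' - (b' - a') / (b - a) * a) (by rw [← ha, ← hb]; exact hfull' i)
    refine ⟨σ, fun x => ⟨?_, ?_⟩⟩
    · rw [(hσ x).2]
      have hp : ((b : ℝ) - a) ≠ 0 := by exact_mod_cast hp.ne'
      push_cast
      field_simp
      ring
    · have hr' : (0 : ℝ) < (((b' - a') / (b - a) : ℚ) : ℝ) := by exact_mod_cast hr
      rw [(hσ x).1, (hσ x).2, add_lt_add_iff_right, mul_lt_mul_iff_right₀ hr']
  choose σ hσ using hσ
  obtain ⟨f, hfc, hf, hfl⟩ := exists_tendsto_of_shells hn h0 hn' σ (fun i x => (hσ i x).1)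
    ((lo_le_hi c').lt_or_eq.imp_left h.mpr)
  obtain ⟨g, hgc, hg, hgl⟩ := exists_tendsto_of_shells hn' h0' hn (fun i => (σ i).symm)
    (fun i x => by simpa using (hσ i ((σ i).symm x)).1.symm)
    ((lo_le_hi c).lt_or_eq.imp_left h.mp)
  refine ⟨⟨f, g, fun d => ?_, fun d => ?_⟩, hfc, fun d => ?_, hfl, hgl⟩
  · by_cases hd : d = c
    · rw [hd, hfc, hgc]
    · obtain ⟨i, hi⟩ := exists_mem_shell hn h0 hd
      rw [hf i ⟨d, hi⟩, hg, Homeomorph.symm_apply_apply]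
  · by_cases hd : d = c'
    · rw [hd, hgc, hfc]
    · obtain ⟨i, hi⟩ := exists_mem_shell hn' h0' hd
      rw [hg i ⟨d, hi⟩, hf, Homeomorph.apply_symm_apply]
  · change lo (f d) < hi (f d) ↔ _
    by_cases hd : d = c
    · rw [hd, hfc, h]
    · obtain ⟨i, hi⟩ := exists_mem_shell hn h0 hd
      rw [hf i ⟨d, hi⟩]
      exact (hσ i ⟨d, hi⟩).2

/-! ### Open sets do not separate the two ends of a nondegenerate fibre -/

theorem exists_cylinder_prod_subset {c : Code} {t : ℝ} {W : Set (Code × ℝ)} (hW : W ∈ 𝓝 (c, t)) :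
    ∃ n, ∃ δ > 0, ∀ d ∈ PiNat.cylinder c n, ∀ s, |s - t| < δ → (d, s) ∈ W := by
  obtain ⟨A, hA, B, hB, h⟩ := mem_nhds_prod_iff.mp hW
  obtain ⟨n, hn⟩ := exists_cylinder_subset hA
  obtain ⟨δ, hδ, hB⟩ := Metric.mem_nhds_iff.mp hB
  exact ⟨n, δ, hδ, fun d hd s hs => h ⟨hn hd, hB hs⟩⟩

theorem ivl_eq_of_le {c : Code} {n m : ℕ} {a b : ℚ} (hivl : ivl c n = (a, b)) (hlo : lo c = a)
    (hhi : hi c = b) (hm : n ≤ m) : ivl c m = (a, b) := by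
  have h1 := ivl_fst_le_lo c m
  have h2 := hi_le_ivl_snd c m
  have h3 := monotone_ivl_fst c hm
  have h4 := antitone_ivl_snd c hm
  simp only [hivl] at h3 h4
  rw [hlo] at h1
  rw [hhi] at h2
  exact Prod.ext (le_antisymm (by exact_mod_cast h1) h3) (le_antisymm h4 (by exact_mod_cast h2))

/-- The interval is shortened from the top down to a height just above the highest point of the
fibre over `c` that is a limit of tops in `V`. At this height tops still belong to `U`, yet tops in
`V` come within `δ`. -/
theorem exists_stamp_step {U V : Set (Code × ℝ)} (hU : IsOpen U) (hV : IsOpen V)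
    (hUV : ∀ c, lo c < hi c → (c, hi c) ∈ U ∨ (c, hi c) ∈ V)
    (hdisj : ∀ c, lo c < hi c → (c, hi c) ∈ U → (c, hi c) ∉ V)
    {c : Code} {n : ℕ} {a b : ℚ} (hab : a < b) (hivl : ivl c n = (a, b)) (hlo : lo c = a)
    (hhi : hi c = b) (hbU : (c, (b : ℝ)) ∈ U) (haV : (c, (a : ℝ)) ∈ V) {δ : ℝ} (hδ : 0 < δ) :
    ∃ c' n' b', n < n' ∧ a < b' ∧ c' ∈ PiNat.cylinder c n ∧ ivl c' n' = (a, b') ∧ lo c' = a ∧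
      hi c' = b' ∧ (c', (b' : ℝ)) ∈ U ∧
      ∃ d ∈ PiNat.cylinder c n, lo d < hi d ∧ (d, hi d) ∈ V ∧ |hi d - b'| < δ := by
  have hab' : (a : ℝ) < b := by exact_mod_cast hab
  have hivl' := fun m => ivl_eq_of_le (m := m) hivl hlo hhi
  set S : Set (Code × ℝ) := {p | p ∈ V ∧ lo p.1 < hi p.1 ∧ p.2 = hi p.1} with hS
  -- `T` contains `a`, because nearby codes with short intervals `[a, q]` have their tops in `V`. It
  -- omits `b`, because `(c, b)` has the neighbourhood `U`, which contains no tops in `V`.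
  set T : Set ℝ := {t | a ≤ t ∧ t ≤ b ∧ (c, t) ∈ closure S} with hT
  have hbT : ∀ t ∈ T, t ≤ b := fun t ht => ht.2.1
  have haT : (a : ℝ) ∈ T := by
    refine ⟨le_rfl, hab'.le, mem_closure_iff_nhds.mpr fun W hW => ?_⟩
    obtain ⟨k, ε, hε, hk⟩ := exists_cylinder_prod_subset (Filter.inter_mem hW (hV.mem_nhds haV))
    obtain ⟨q, hq1, hq2⟩ := exists_rat_btwn (show (a : ℝ) < min (b : ℝ) (a + ε) from
      lt_min hab' (by linarith))
    have hm := hivl' (max n k) (le_max_left _ _)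
    obtain ⟨j, -, -, -, hl, hh, -⟩ := exists_stamp c (max n k) 0 (a := a) (b := q) (by rw [hm])
      (by exact_mod_cast hq1) (by rw [hm]; exact_mod_cast (lt_min_iff.mp hq2).1.le) Set.finite_empty
    have hmem := hk _ (PiNat.cylinder_anti c (le_max_right _ _) (stamp_mem_cylinder c (max n k) j))
      q (by rw [abs_lt]; constructor <;> linarith [(lt_min_iff.mp hq2).2])
    refine ⟨(stamp c (max n k) j, q), hmem.1, hmem.2, ?_, hh.symm⟩
    rw [hl, hh]
    exact hq1
  have hcl : IsClosed T := (isClosed_le continuous_const continuous_id).inter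
    ((isClosed_le continuous_id continuous_const).inter
      (isClosed_closure.preimage (by fun_prop : Continuous fun t : ℝ => (c, t))))
  have hz : sSup T ∈ T := hcl.csSup_mem ⟨_, haT⟩ ⟨b, hbT⟩
  have hzb : sSup T < b := by
    refine lt_of_le_of_ne hz.2.1 fun h => ?_
    obtain ⟨p, hpU, hpV, hlt, hp⟩ := mem_closure_iff_nhds.mp hz.2.2 U (hU.mem_nhds (h ▸ hbU))
    obtain ⟨d, t⟩ := p
    obtain rfl : t = hi d := hp
    exact hdisj d hlt hpU hpV
  obtain ⟨b', hb1, hb2⟩ := exists_rat_btwn (show sSup T < min (b : ℝ) (sSup T + δ / 2) from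
    lt_min hzb (by linarith))
  obtain ⟨hb2, hb3⟩ := lt_min_iff.mp hb2
  have hab'' : (a : ℝ) < b' := hz.1.trans_lt hb1
  have hb' : (c, (b' : ℝ)) ∉ closure S := fun h => hb1.not_ge
    (le_csSup ⟨b, hbT⟩ ⟨hab''.le, hb2.le, h⟩)
  obtain ⟨k, ε, hε, hk⟩ := exists_cylinder_prod_subset
    (isClosed_closure.isOpen_compl.mem_nhds hb')
  have hm := hivl' (max n k) (le_max_left _ _)
  obtain ⟨j, -, hj, hij, hl, hh, -⟩ := exists_stamp c (max n k) 0 (a := a) (b := b') (by rw [hm])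
    (by exact_mod_cast hab'') (by rw [hm]; exact_mod_cast hb2.le) Set.finite_empty
  have hlt : lo (stamp c (max n k) j) < hi (stamp c (max n k) j) := by rwa [hl, hh]
  have hmem := stamp_mem_cylinder c (max n k) j
  refine ⟨stamp c (max n k) j, j + 1, b', by omega, by exact_mod_cast hab'',
    PiNat.cylinder_anti c (le_max_left _ _) hmem, hij, hl, hh, ?_, ?_⟩
  · rw [← hh]
    refine (hUV _ hlt).resolve_right fun h => ?_
    refine hk _ (PiNat.cylinder_anti c (le_max_right _ _) hmem) b' (by simpa using hε)
      (subset_closure ⟨hh ▸ h, hlt, hh.symm⟩)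
  · have hW : PiNat.cylinder c n ×ˢ Metric.ball (sSup T) (δ / 2) ∈ 𝓝 (c, sSup T) :=
      prod_mem_nhds ((isClopen_cylinder c n).isOpen.mem_nhds (PiNat.self_mem_cylinder c n))
        (Metric.ball_mem_nhds _ (by linarith))
    obtain ⟨⟨d, t⟩, ⟨hd, ht⟩, hdV, hdlt, hdt⟩ := mem_closure_iff_nhds.mp hz.2.2 _ hW
    obtain rfl : t = hi d := hdt
    refine ⟨d, hd, hdlt, hdV, ?_⟩
    rw [Metric.mem_ball, Real.dist_eq, abs_lt] at ht
    rw [abs_lt]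
    constructor <;> linarith [ht.1, ht.2]

/-- A truncation of `c` first makes the interval rational. Iterating `exists_stamp_step` then yields
codes with a fixed lower end `a`, decreasing upper ends and tops in `U`, converging to a code `e`,
together with codes that have tops in `V` and converge to the same top. The top of `e` is thus a
limit of tops from both sides, but it must belong to one of the two disjoint parts. -/
theorem false_of_separated {U V : Set (Code × ℝ)} (hU : IsOpen U) (hV : IsOpen V)
    (hUV : ∀ c, lo c < hi c → (c, hi c) ∈ U ∨ (c, hi c) ∈ V)
    (hdisj : ∀ c, lo c < hi c → (c, hi c) ∈ U → (c, hi c) ∉ V)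
    {c : Code} (hcU : (c, hi c) ∈ U) (hcV : (c, lo c) ∈ V) : False := by
  have hev : ∀ᶠ n in Filter.atTop, (trunc c n, hi (trunc c n)) ∈ U ∧
      (trunc c n, lo (trunc c n)) ∈ V := by
    simp only [lo_trunc, hi_trunc]
    exact (((tendsto_trunc c).prodMk_nhds (tendsto_ivl_snd c)).eventually (hU.mem_nhds hcU)).and
      (((tendsto_trunc c).prodMk_nhds (tendsto_ivl_fst c)).eventually (hV.mem_nhds hcV))
  obtain ⟨c₀, m, a, b, hab, hivl, hlo, hhi, hbU, haV⟩ : ∃ c₀ m a b, a < b ∧ ivl c₀ m = (a, b) ∧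
      lo c₀ = a ∧ hi c₀ = b ∧ (c₀, (b : ℝ)) ∈ U ∧ (c₀, (a : ℝ)) ∈ V := by
    obtain ⟨m, hmU, hmV⟩ := hev.exists
    exact ⟨trunc c m, m, (ivl c m).1, (ivl c m).2, ivl_lt c m, ivl_trunc c m, lo_trunc c m,
      hi_trunc c m, hi_trunc c m ▸ hmU, lo_trunc c m ▸ hmV⟩
  obtain ⟨k, η, hη, hk⟩ := exists_cylinder_prod_subset (hV.mem_nhds haV)
  let State := {p : Code × ℕ × ℚ // k ≤ p.2.1 ∧ p.1 ∈ PiNat.cylinder c₀ k ∧ a < p.2.2 ∧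
    ivl p.1 p.2.1 = (a, p.2.2) ∧ lo p.1 = a ∧ hi p.1 = p.2.2 ∧ (p.1, (p.2.2 : ℝ)) ∈ U}
  have hstep : ∀ (p : State) (i : ℕ), ∃ q : State, p.1.2.1 < q.1.2.1 ∧
      q.1.1 ∈ PiNat.cylinder p.1.1 p.1.2.1 ∧ ∃ d ∈ PiNat.cylinder p.1.1 p.1.2.1,
        lo d < hi d ∧ (d, hi d) ∈ V ∧ |hi d - q.1.2.2| < 1 / ((i : ℝ) + 1) := by
    rintro ⟨⟨d, n, b'⟩, hkn, hd, h1, h2, h3, h4, h5⟩ i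
    obtain ⟨d', n', b'', hnn, g1, hd', g2, g3, g4, g5, e, he⟩ := exists_stamp_step hU hV hUV hdisj
      h1 h2 h3 h4 h5 (hk d hd a (by simpa using hη)) (Nat.one_div_pos_of_nat (α := ℝ) (n := i))
    refine ⟨⟨⟨d', n', b''⟩, hkn.trans hnn.le, ?_, g1, g2, g3, g4, g5⟩, hnn, hd', e, he⟩
    rw [← PiNat.mem_cylinder_iff_eq.mp hd]
    exact PiNat.cylinder_anti d hkn hd'
  choose g hg using hstep
  let p₀ : State := ⟨(c₀, max m k, b), le_max_right _ _, PiNat.self_mem_cylinder _ _, hab,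
    ivl_eq_of_le hivl hlo hhi (le_max_left _ _), hlo, hhi, hbU⟩
  let s : ℕ → State := fun i => Nat.rec p₀ (fun i p => g p i) i
  have hs : ∀ i, s (i + 1) = g (s i) i := fun i => rfl
  have hmono : StrictMono fun i => (s i).1.2.1 := strictMono_nat_of_lt_succ fun i => (hg (s i) i).1
  have hnest : ∀ i j, i ≤ j → (s j).1.1 ∈ PiNat.cylinder (s i).1.1 (s i).1.2.1 := by
    intro i j hij
    induction j, hij using Nat.le_induction with
    | base => exact PiNat.self_mem_cylinder _ _
    | succ j hij ih =>
      rw [← PiNat.mem_cylinder_iff_eq.mp ih]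
      exact PiNat.cylinder_anti _ (hmono.monotone hij) (hg (s j) j).2.1
  let e : Code := fun i => (s (i + 1)).1.1 i
  have he : ∀ i, e ∈ PiNat.cylinder (s i).1.1 (s i).1.2.1 := by
    intro i l hl
    rcases le_total i (l + 1) with h | h
    · exact hnest i (l + 1) h l hl
    · exact (hnest (l + 1) i h l (l.lt_succ_self.trans_le hmono.le_apply)).symm
  have hivl_e : ∀ i, ivl e (s i).1.2.1 = (a, (s i).1.2.2) := fun i =>
    (ivl_congr (he i)).trans (s i).2.2.2.2.1
  have hlo_e : lo e = a := by
    have h := (tendsto_ivl_fst e).comp hmono.tendsto_atTop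
    refine tendsto_nhds_unique h (tendsto_const_nhds.congr fun i => ?_)
    simp only [Function.comp_apply, hivl_e]
  have hhi_e : Filter.Tendsto (fun i => ((s i).1.2.2 : ℝ)) Filter.atTop (𝓝 (hi e)) := by
    have h := (tendsto_ivl_snd e).comp hmono.tendsto_atTop
    refine h.congr fun i => ?_
    simp only [Function.comp_apply, hivl_e]
  have hlt_s : ∀ i, lo (s i).1.1 < hi (s i).1.1 := fun i => by
    rw [(s i).2.2.2.2.2.1, (s i).2.2.2.2.2.2.1]
    exact_mod_cast (s i).2.2.2.1
  have hlt_e : lo e < hi e := by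
    -- The limit fibre does not collapse: all points at height within `η` of `a` over the initial
    -- cylinder belong to `V`, while the tops constructed belong to `U`.
    have : (a : ℝ) + η ≤ hi e := by
      refine ge_of_tendsto' hhi_e fun i => ?_
      by_contra! h
      have h0 : (a : ℝ) < (s i).1.2.2 := by exact_mod_cast (s i).2.2.2.1
      refine hdisj _ (hlt_s i) ?_ (hk _ (s i).2.2.1 _ ?_)
      · rw [(s i).2.2.2.2.2.2.1]
        exact (s i).2.2.2.2.2.2.2
      · rw [(s i).2.2.2.2.2.2.1, abs_lt]
        constructor <;> linarith
    linarith
  have hconv : ∀ d : ℕ → Code, (∀ i, d i ∈ PiNat.cylinder (s i).1.1 (s i).1.2.1) →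
      Filter.Tendsto d Filter.atTop (𝓝 e) := by
    intro d hd W hW
    obtain ⟨n, hn⟩ := exists_cylinder_subset hW
    rw [Filter.mem_map]
    filter_upwards [Filter.eventually_ge_atTop n] with i hi
    refine hn (PiNat.cylinder_anti e (hi.trans hmono.le_apply) ?_)
    rw [PiNat.mem_cylinder_iff_eq.mp (he i)]
    exact hd i
  have hlim := (hconv _ fun i => PiNat.self_mem_cylinder _ _).prodMk_nhds hhi_e
  rcases hUV e hlt_e with h | h
  · choose d hd hdlt hdV hdist using fun i => (hg (s i) i).2.2
    have h1 : Filter.Tendsto (fun i => hi (d i)) Filter.atTop (𝓝 (hi e)) := by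
      refine tendsto_of_tendsto_of_dist ((Filter.tendsto_add_atTop_iff_nat 1).mpr hhi_e) ?_
      refine squeeze_zero (fun _ => dist_nonneg) (fun i => ?_)
        (tendsto_one_div_add_atTop_nhds_zero_nat (𝕜 := ℝ))
      rw [dist_comm, Real.dist_eq]
      exact (hdist i).le
    obtain ⟨i, hi⟩ := (((hconv d hd).prodMk_nhds h1).eventually (hU.mem_nhds h)).exists
    exact hdisj _ (hdlt i) hi (hdV i)
  · obtain ⟨i, hi⟩ := (hlim.eventually (hV.mem_nhds h)).exists
    have h2 := (s i).2.2.2.2.2.2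
    exact hdisj _ (hlt_s i) (h2.1.symm ▸ h2.2) (h2.1.symm ▸ hi)

/-! ### Spaces of upper ends of fibres -/

theorem isClopen_setOf_ivl (p : ℚ × ℚ → Prop) (n : ℕ) : IsClopen {c | p (ivl c n)} := by
  have h : ∀ p : ℚ × ℚ → Prop, IsOpen {c | p (ivl c n)} := fun p => by
    refine isOpen_iff_mem_nhds.mpr fun c hc => ?_
    filter_upwards [(isClopen_cylinder c n).isOpen.mem_nhds (PiNat.self_mem_cylinder c n)] with d hd
    rw [ivl_congr hd]
    exact hc
  exact ⟨isOpen_compl_iff.mp (h fun q => ¬ p q), h p⟩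

section TopSpaces

variable {X : Type u} [TopologicalSpace X] {κ : X → Code}

theorem exists_window_subset (hκ : IsEmbedding fun x => (κ x, hi (κ x))) {x : X} {V : Set X}
    (hV : V ∈ 𝓝 x) : ∃ n, ∃ δ > 0, ∀ y, κ y ∈ PiNat.cylinder (κ x) n →
      |hi (κ y) - hi (κ x)| < δ → y ∈ V := by
  obtain ⟨W, hW, hWV⟩ := hκ.isInducing.nhds_eq_comap x ▸ hV
  obtain ⟨n, δ, hδ, h⟩ := exists_cylinder_prod_subset hW
  exact ⟨n, δ, hδ, fun y hy hyδ => hWV (h _ hy _ hyδ)⟩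

/-- Only a lower bound on the height is needed, since by upper semicontinuity a small cylinder
already bounds `hi` from above. -/
theorem exists_ge_subset (hκ : IsEmbedding fun x => (κ x, hi (κ x))) {x : X} {V : Set X}
    (hV : V ∈ 𝓝 x) : ∃ n, ∃ a < hi (κ x), ∀ y, κ y ∈ PiNat.cylinder (κ x) n →
      a ≤ hi (κ y) → y ∈ V := by
  obtain ⟨n, δ, hδ, h⟩ := exists_window_subset hκ hV
  obtain ⟨m, hm⟩ := ((tendsto_ivl_snd (κ x)).eventually_lt_const
    (show hi (κ x) < hi (κ x) + δ by linarith)).exists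
  refine ⟨max n m, hi (κ x) - δ / 2, by linarith, fun y hy hya =>
    h y (PiNat.cylinder_anti _ (le_max_left _ _) hy) ?_⟩
  have := hi_le_ivl_snd_of_mem (PiNat.cylinder_anti _ (le_max_right n m) hy)
  rw [abs_lt]
  constructor <;> linarith

theorem continuous_code (hκ : IsEmbedding fun x => (κ x, hi (κ x))) : Continuous κ :=
  continuous_fst.comp hκ.continuous

theorem continuous_height (hκ : IsEmbedding fun x => (κ x, hi (κ x))) :
    Continuous fun x => hi (κ x) :=
  continuous_snd.comp hκ.continuous

theorem isClopen_preimage_cylinder (hκ : IsEmbedding fun x => (κ x, hi (κ x))) (c : Code) (n : ℕ) :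
    IsClopen (κ ⁻¹' PiNat.cylinder c n) :=
  (isClopen_cylinder c n).preimage (continuous_code hκ)

/-- The condition `a ≤ hi` is the conjunction of the clopen conditions that `a` is at most the upper
end of the k-th interval. -/
theorem almostZeroDimensional_of_isEmbedding (hκ : IsEmbedding fun x => (κ x, hi (κ x))) :
    AlmostZeroDimensional X := by
  intro x V hV
  obtain ⟨n, a, ha, h⟩ := exists_ge_subset hκ hV
  refine ⟨κ ⁻¹' PiNat.cylinder (κ x) n ∩ {y | a ≤ hi (κ y)}, ?_, fun y hy => h y hy.1 hy.2, ?_,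
    Set.range fun k => κ ⁻¹' PiNat.cylinder (κ x) n ∩ {y | a ≤ (ivl (κ y) k).2}, ?_, ?_⟩
  · refine Filter.inter_mem ((isClopen_preimage_cylinder hκ _ _).isOpen.mem_nhds
      (PiNat.self_mem_cylinder _ _)) ?_
    exact Filter.mem_of_superset ((isOpen_lt continuous_const (continuous_height hκ)).mem_nhds ha)
      fun y (hy : a < hi (κ y)) => hy.le
  · exact (isClopen_preimage_cylinder hκ _ _).isClosed.inter
      (isClosed_le continuous_const (continuous_height hκ))
  · rintro _ ⟨k, rfl⟩
    exact (isClopen_preimage_cylinder hκ _ _).inter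
      ((isClopen_setOf_ivl (fun q => a ≤ q.2) k).preimage (continuous_code hκ))
  · rw [Set.sInter_range, ← Set.inter_iInter]
    congr 1
    ext y
    simp only [Set.mem_ofPred_eq, Set.mem_iInter, le_hi_iff]

/-- The sets given by a cylinder and a condition `a < hi` form a basis. On their frontiers the
height is constantly `a`, so the frontiers embed into the zero-dimensional space of codes. -/
theorem hasSmallInductiveDimensionLE_one_of_isEmbedding
    (hκ : IsEmbedding fun x => (κ x, hi (κ x))) : HasSmallInductiveDimensionLE X 1 := by
  refine .succ 1 {U | ∃ c n a, U = κ ⁻¹' PiNat.cylinder c n ∩ {y | a < hi (κ y)}} ?_ ?_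
  · refine isTopologicalBasis_of_isOpen_of_nhds ?_ fun x V hx hV => ?_
    · rintro _ ⟨c, n, a, rfl⟩
      exact (isClopen_preimage_cylinder hκ c n).isOpen.inter
        (isOpen_lt continuous_const (continuous_height hκ))
    · obtain ⟨n, a, ha, h⟩ := exists_ge_subset hκ (hV.mem_nhds hx)
      exact ⟨_, ⟨κ x, n, a, rfl⟩, ⟨PiNat.self_mem_cylinder _ _, ha⟩,
        fun y hy => h y hy.1 (le_of_lt hy.2)⟩
  · rintro _ ⟨c, n, a, rfl⟩
    set U := κ ⁻¹' PiNat.cylinder c n ∩ {y | a < hi (κ y)}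
    have hfr : ∀ y ∈ frontier U, hi (κ y) = a := fun y hy => by
      have := frontier_inter_subset _ _ hy
      rw [(isClopen_preimage_cylinder hκ c n).frontier_eq, Set.empty_inter, Set.empty_union] at this
      exact (frontier_lt_subset_eq continuous_const (continuous_height hκ) this.2).symm
    have hind : IsInducing fun y : frontier U => κ y := by
      refine .of_comp (g := fun c : Code => (c, a))
        ((continuous_code hκ).comp continuous_subtype_val) (by fun_prop) ?_
      have : (fun c : Code => (c, a)) ∘ (fun y : frontier U => κ y) =
          (fun x => (κ x, hi (κ x))) ∘ Subtype.val :=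
        funext fun y => Prod.ext rfl (hfr y y.2).symm
      rw [this]
      exact hκ.isInducing.comp .subtypeVal
    have : HasSmallInductiveDimensionLE Code 0 := hasSmallInductiveDimensionLE_zero_pi
    exact hasSmallInductiveDimensionLE_zero_of_isInducing hind

/-- If a clopen set stayed above height `t`, adding the points below `t` to the complementary open
set would separate the top of the fibre over `κ x` from its bottom. -/
theorem exists_mem_hi_lt (hκ : IsEmbedding fun x => (κ x, hi (κ x)))
    (hM : ∀ c, lo c < hi c → c ∈ Set.range κ) {C : Set X} (hC : IsClopen C) {x : X} (hx : x ∈ C)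
    {t : ℝ} (ht : lo (κ x) < t) : ∃ y ∈ C, hi (κ y) < t := by
  by_contra! hge
  obtain ⟨U, hU, hUC⟩ := hκ.isInducing.isOpen_iff.mp hC.isOpen
  obtain ⟨V, hV, hVC⟩ := hκ.isInducing.isOpen_iff.mp hC.compl.isOpen
  have hU' : ∀ y, (κ y, hi (κ y)) ∈ U ↔ y ∈ C := fun y => Set.ext_iff.mp hUC y
  have hV' : ∀ y, (κ y, hi (κ y)) ∈ V ↔ y ∉ C := fun y => Set.ext_iff.mp hVC y
  refine false_of_separated (c := κ x) hU
    (hV.union (isOpen_lt continuous_snd continuous_const : IsOpen {p : Code × ℝ | p.2 < t}))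
    (fun c hc => ?_) (fun c hc => ?_) ((hU' x).mpr hx) (Or.inr ht)
  · obtain ⟨y, rfl⟩ := hM c hc
    by_cases hy : y ∈ C
    exacts [Or.inl ((hU' y).mpr hy), Or.inr (Or.inl ((hV' y).mpr hy))]
  · obtain ⟨y, rfl⟩ := hM c hc
    rintro hy (hy' | hy')
    · exact (hV' y).mp hy' ((hU' y).mp hy)
    · exact (hge y ((hU' y).mp hy)).not_gt hy'

theorem exists_nhds_forall_isClopen (hκ : IsEmbedding fun x => (κ x, hi (κ x)))
    (hM : ∀ c, lo c < hi c → c ∈ Set.range κ) {x : X} (hx : lo (κ x) < hi (κ x)) :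
    ∃ V ∈ 𝓝 x, ∀ C ⊆ V, IsClopen C → x ∉ C := by
  obtain ⟨t, ht, ht'⟩ := exists_between hx
  refine ⟨{y | t < hi (κ y)}, (isOpen_lt continuous_const (continuous_height hκ)).mem_nhds ht',
    fun C hCV hC hxC => ?_⟩
  obtain ⟨y, hy, hyt⟩ := exists_mem_hi_lt hκ hM hC hxC ht
  exact lt_asymm hyt (hCV hy)

/-- When the intervals shrink to a point, a cylinder also bounds the heights from below. Such clopen
neighbourhoods are what distinguishes points over degenerate fibres from the others under
homeomorphisms. -/
theorem exists_isClopen_of_lo_eq_hi (hκ : IsEmbedding fun x => (κ x, hi (κ x))) {x : X}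
    (hx : lo (κ x) = hi (κ x)) {V : Set X} (hV : V ∈ 𝓝 x) : ∃ C ⊆ V, IsClopen C ∧ x ∈ C := by
  obtain ⟨n, a, ha, h⟩ := exists_ge_subset hκ hV
  obtain ⟨m, hm⟩ := ((tendsto_ivl_fst (κ x)).eventually_const_lt (hx ▸ ha)).exists
  refine ⟨κ ⁻¹' PiNat.cylinder (κ x) (max n m), fun y hy =>
    h y (PiNat.cylinder_anti _ (le_max_left _ _) hy) ?_, isClopen_preimage_cylinder hκ _ _,
    PiNat.self_mem_cylinder _ _⟩
  exact hm.le.trans ((ivl_fst_le_lo_of_mem (PiNat.cylinder_anti _ (le_max_right n m) hy)).trans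
    (lo_le_hi _))

theorem exists_lo_lt_hi : ∃ c, lo c < hi c := by
  refine ⟨trunc (fun _ => false) 0, ?_⟩
  rw [lo_trunc, hi_trunc]
  exact_mod_cast ivl_lt _ _

theorem smallInductiveDimension_eq_one (hκ : IsEmbedding fun x => (κ x, hi (κ x)))
    (hM : ∀ c, lo c < hi c → c ∈ Set.range κ) : smallInductiveDimension X = 1 := by
  refine smallInductiveDimension_eq 1 (hasSmallInductiveDimensionLE_one_of_isEmbedding hκ)
    fun h => ?_
  obtain ⟨c, hc⟩ := exists_lo_lt_hi
  obtain ⟨x, rfl⟩ := hM c hc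
  obtain ⟨V, hV, hVC⟩ := exists_nhds_forall_isClopen hκ hM hc
  obtain ⟨W, hWV, hW, hxW⟩ := mem_nhds_iff.mp hV
  obtain ⟨C, hC, hxC, hCW⟩ := exists_isClopen_mem_subset (h := h) hW hxW
  exact hVC C (hCW.trans hWV) hC hxC

/-- Near the top of a nondegenerate fibre there are cylinders whose interval `[a, b]` is a short
rational one close to that top. The clopen set of all points over such a cylinder lies in the given
neighbourhood. -/
theorem not_cohesive_of_isEmbedding (hκ : IsEmbedding fun x => (κ x, hi (κ x)))
    (hM : ∀ c, lo c < hi c → c ∈ Set.range κ) : ¬ Cohesive X := by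
  intro hcoh
  obtain ⟨c, hc⟩ := exists_lo_lt_hi
  obtain ⟨x, rfl⟩ := hM c hc
  obtain ⟨V, hV, hVC⟩ := hcoh x
  obtain ⟨n, δ, hδ, h⟩ := exists_window_subset hκ hV
  obtain ⟨b, hb, hb'⟩ := exists_rat_btwn (show max (lo (κ x)) (hi (κ x) - δ) < hi (κ x) from
    max_lt hc (by linarith))
  obtain ⟨a, ha, hab⟩ := exists_rat_btwn hb
  obtain ⟨ha1, ha2⟩ := max_lt_iff.mp ha
  have h1 := ivl_fst_le_lo (κ x) n
  have h2 := hi_le_ivl_snd (κ x) n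
  obtain ⟨j, -, hnj, hj, hl, hh, -⟩ := exists_stamp (κ x) n 0 (a := a) (b := b)
    (by exact_mod_cast h1.trans ha1.le) (by exact_mod_cast hab) (by exact_mod_cast hb'.le.trans h2)
    Set.finite_empty
  obtain ⟨y, hy⟩ := hM (stamp (κ x) n j) (by rw [hl, hh]; exact hab)
  refine hVC (κ ⁻¹' PiNat.cylinder (stamp (κ x) n j) (j + 1)) (fun z hz => ?_)
    (isClopen_preimage_cylinder hκ _ _) ⟨y, hy ▸ PiNat.self_mem_cylinder _ _⟩
  refine h z (cylinder_stamp_subset _ hnj hz) ?_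
  have h3 := ivl_fst_le_lo_of_mem hz
  have h4 := hi_le_ivl_snd_of_mem hz
  rw [hj] at h3 h4
  have h5 := lo_le_hi (κ z)
  rw [abs_lt]
  constructor <;> linarith

theorem exists_homeomorph_of_equiv (hκ : IsEmbedding fun x => (κ x, hi (κ x))) (τ : Code ≃ Code)
    (hτ : ∀ c, τ c ∈ Set.range κ ↔ c ∈ Set.range κ)
    (h : ∀ c, Filter.Tendsto τ (topNhds c) (topNhds (τ c)))
    (h' : ∀ c, Filter.Tendsto τ.symm (topNhds c) (topNhds (τ.symm c))) :
    ∃ f : X ≃ₜ X, ∀ x, κ (f x) = τ (κ x) := by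
  have hinj : Function.Injective κ := fun x y hxy => hκ.injective (by simp only [hxy])
  have hcont : ∀ (f : X → X) (σ : Code → Code), (∀ x, κ (f x) = σ (κ x)) →
      (∀ c, Filter.Tendsto σ (topNhds c) (topNhds (σ c))) → Continuous f := by
    intro f σ hf hσ
    have hnhds : ∀ x, 𝓝 x = Filter.comap κ (topNhds (κ x)) := fun x => by
      rw [hκ.isInducing.nhds_eq_comap, nhds_prod_eq, Filter.prod_eq_inf, Filter.comap_inf, topNhds,
        Filter.comap_inf, Filter.comap_comap, Filter.comap_comap, Filter.comap_comap]
      rfl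
    rw [continuous_iff_continuousAt]
    intro x
    rw [ContinuousAt, hnhds (f x), Filter.tendsto_comap_iff, hf x]
    have : κ ∘ f = σ ∘ κ := funext hf
    rw [this, hnhds x]
    exact (hσ _).comp Filter.tendsto_comap
  choose f hf using fun x => (hτ (κ x)).mpr ⟨x, rfl⟩
  choose g hg using fun x : X => (hτ (τ.symm (κ x))).mp (by simp)
  refine ⟨⟨⟨f, g, fun x => hinj ?_, fun x => hinj ?_⟩, hcont f τ hf h, hcont g τ.symm hg h'⟩, hf⟩
  · rw [hg, hf, Equiv.symm_apply_apply]
  · rw [hf, hg, Equiv.apply_symm_apply]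

theorem exists_homeomorph_apply_eq (hκ : IsEmbedding fun x => (κ x, hi (κ x)))
    (hr : Set.range κ = Set.univ ∨ Set.range κ = {c | lo c < hi c}) {x y : X}
    (hxy : lo (κ x) < hi (κ x) ↔ lo (κ y) < hi (κ y)) : ∃ f : X ≃ₜ X, f x = y := by
  obtain ⟨τ, hτ, hlt, h, h'⟩ := exists_equiv_tendsto hxy
  obtain ⟨f, hf⟩ := exists_homeomorph_of_equiv hκ τ (fun c => by
    rcases hr with hr | hr <;> rw [hr]
    exacts [Iff.rfl, hlt c]) h h'
  have hinj : Function.Injective κ := fun x y hxy => hκ.injective (by simp only [hxy])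
  exact ⟨f, hinj ((hf x).trans hτ)⟩

theorem homogeneous_of_isEmbedding (hκ : IsEmbedding fun x => (κ x, hi (κ x)))
    (hr : Set.range κ = {c | lo c < hi c}) : Homogeneous X := fun x y =>
  have h : ∀ x, lo (κ x) < hi (κ x) := fun x => hr.subset ⟨x, rfl⟩
  exists_homeomorph_apply_eq hκ (Or.inr hr) (iff_of_true (h x) (h y))

theorem lo_lt_hi_homeomorph_iff (hκ : IsEmbedding fun x => (κ x, hi (κ x)))
    (hM : ∀ c, lo c < hi c → c ∈ Set.range κ) (f : X ≃ₜ X) (x : X) :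
    lo (κ (f x)) < hi (κ (f x)) ↔ lo (κ x) < hi (κ x) := by
  have key : ∀ (f : X ≃ₜ X) (x : X), lo (κ x) < hi (κ x) → lo (κ (f x)) < hi (κ (f x)) := by
    intro f x hx
    refine (lo_le_hi _).lt_of_ne fun heq => ?_
    obtain ⟨V, hV, h⟩ := exists_nhds_forall_isClopen hκ hM hx
    obtain ⟨C, hCV, hC, hxC⟩ := exists_isClopen_of_lo_eq_hi hκ heq
      (V := f.symm ⁻¹' V) (f.symm.continuous.continuousAt.preimage_mem_nhds (by simpa using hV))
    exact h (f ⁻¹' C) (fun z hz => by simpa using hCV hz) (hC.preimage f.continuous) hxC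
  exact ⟨fun h => by simpa using key f.symm (f x) h, key f x⟩

/-- By Baire category: having some interval shorter than a given length is an open condition on
codes, and a dense one since short windows can be applied at will. -/
theorem dense_lo_eq_hi : Dense {c : Code | lo c = hi c} := by
  have hd : Dense (⋂ n : ℕ, {c : Code | ∃ k, (ivl c k).2 - (ivl c k).1 < 1 / ((n : ℚ) + 1)}) := by
    refine dense_iInter_of_isOpen (fun n => ?_) fun n => ?_
    · simp only [Set.ofPred_exists]
      exact isOpen_iUnion fun k =>
        (isClopen_setOf_ivl (fun q => q.2 - q.1 < 1 / ((n : ℚ) + 1)) k).isOpen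
    · refine dense_iff_inter_open.mpr fun U hU ⟨c, hc⟩ => ?_
      obtain ⟨m, hm⟩ := exists_cylinder_subset (hU.mem_nhds hc)
      obtain ⟨b, hab, hb⟩ := exists_between (show (ivl c m).1 < min (ivl c m).2
        ((ivl c m).1 + 1 / ((n : ℚ) + 1)) from lt_min (ivl_lt c m) (by
          have : 0 < 1 / ((n : ℚ) + 1) := by positivity
          linarith))
      obtain ⟨hb1, hb2⟩ := lt_min_iff.mp hb
      obtain ⟨j, -, -, hj, -⟩ := exists_stamp c m 0 le_rfl hab hb1.le Set.finite_empty
      exact ⟨stamp c m j, hm (stamp_mem_cylinder c m j), j + 1, by rw [hj]; linarith⟩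
  refine hd.mono fun c hc => ?_
  refine (lo_le_hi c).antisymm (le_of_forall_pos_le_add fun ε hε => ?_)
  obtain ⟨n, hn⟩ := exists_nat_one_div_lt hε
  obtain ⟨k, hk⟩ := Set.mem_iInter.mp hc n
  have hk' : ((ivl c k).2 : ℝ) - (ivl c k).1 < 1 / ((n : ℝ) + 1) := by
    have := (Rat.cast_lt (K := ℝ)).mpr hk
    push_cast at this
    exact this
  have h1 := ivl_fst_le_lo c k
  have h2 := hi_le_ivl_snd c k
  linarith

theorem oneOverHomogeneous_two_of_isEmbedding (hκ : IsEmbedding fun x => (κ x, hi (κ x)))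
    (hr : Set.range κ = Set.univ) : OneOverHomogeneous X 2 := by
  have hsurj : Function.Surjective κ := Set.range_eq_univ.mp hr
  have horb : ∀ x, {y : X | ∃ h : X ≃ₜ X, h x = y} =
      {y | lo (κ y) < hi (κ y) ↔ lo (κ x) < hi (κ x)} := by
    intro x
    ext y
    constructor
    · rintro ⟨f, rfl⟩
      exact lo_lt_hi_homeomorph_iff hκ (fun c _ => hsurj c) f x
    · intro h
      exact exists_homeomorph_apply_eq hκ (Or.inl hr) h.symm
  obtain ⟨c, hc⟩ := exists_lo_lt_hi
  obtain ⟨x, rfl⟩ := hsurj c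
  obtain ⟨d, hd⟩ := dense_lo_eq_hi.nonempty
  obtain ⟨y, rfl⟩ := hsurj d
  have hy : ¬ lo (κ y) < hi (κ y) := fun h => h.ne hd
  have hrange : (Set.range fun x : X => {y : X | ∃ h : X ≃ₜ X, h x = y}) =
      {{z | lo (κ z) < hi (κ z)}, {z | ¬ lo (κ z) < hi (κ z)}} := by
    ext A
    simp only [horb, Set.mem_range, Set.mem_insert_iff, Set.mem_singleton_iff]
    constructor
    · rintro ⟨z, rfl⟩
      by_cases hz : lo (κ z) < hi (κ z)
      · exact Or.inl (by simp only [hz, iff_true])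
      · exact Or.inr (by simp only [hz, iff_false])
    · rintro (rfl | rfl)
      · exact ⟨x, by simp only [hc, iff_true]⟩
      · exact ⟨y, by simp only [hy, iff_false]⟩
  rw [OneOverHomogeneous, hrange, Set.encard_pair fun h => ?_]
  · rfl
  · exact (Set.ext_iff.mp h x).mp hc hc

end TopSpaces

/-! ### Complete metrizability -/

theorem isGδ_hi_le : IsGδ {p : Code × ℝ | hi p.1 ≤ p.2} := by
  have : {p : Code × ℝ | hi p.1 ≤ p.2} = ⋂ n : ℕ, {p | p.2 + 1 / ((n : ℝ) + 1) ≤ hi p.1}ᶜ := by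
    ext p
    simp only [Set.mem_ofPred_eq, Set.mem_iInter, Set.mem_compl_iff, not_le]
    refine ⟨fun h n => h.trans_lt (lt_add_of_pos_right _ Nat.one_div_pos_of_nat), fun h =>
      le_of_forall_pos_le_add fun ε hε => ?_⟩
    obtain ⟨n, hn⟩ := exists_nat_one_div_lt hε
    linarith [h n]
  rw [this]
  exact IsGδ.iInter_of_isOpen fun n =>
    (isClosed_le_hi continuous_fst (by fun_prop)).isOpen_compl

theorem isGδ_le_lo : IsGδ {p : Code × ℝ | p.2 ≤ lo p.1} := by
  have : {p : Code × ℝ | p.2 ≤ lo p.1} = ⋂ n : ℕ, {p | lo p.1 ≤ p.2 - 1 / ((n : ℝ) + 1)}ᶜ := by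
    ext p
    simp only [Set.mem_ofPred_eq, Set.mem_iInter, Set.mem_compl_iff, not_le]
    refine ⟨fun h n => (sub_lt_self _ Nat.one_div_pos_of_nat).trans_le h, fun h =>
      le_of_forall_pos_le_add fun ε hε => ?_⟩
    obtain ⟨n, hn⟩ := exists_nat_one_div_lt hε
    linarith [h n]
  rw [this]
  exact IsGδ.iInter_of_isOpen fun n =>
    (isClosed_lo_le continuous_fst (by fun_prop)).isOpen_compl

theorem isGδ_eq_hi : IsGδ {p : Code × ℝ | p.2 = hi p.1} := by
  have : {p : Code × ℝ | p.2 = hi p.1} = {p | p.2 ≤ hi p.1} ∩ {p | hi p.1 ≤ p.2} := by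
    ext p
    exact le_antisymm_iff
  rw [this]
  exact (isClosed_le_hi continuous_fst continuous_snd).isGδ.inter isGδ_hi_le

instance : PolishSpace (Code × ℝ) :=
  have : SeparableSpace (Code × ℝ) := SecondCountableTopology.to_separableSpace
  inferInstance

theorem polishSpace_of_isEmbedding {X : Type u} [TopologicalSpace X] {Y : Type v}
    [TopologicalSpace Y] [PolishSpace Y] {j : X → Y} (hj : IsEmbedding j)
    (h : IsGδ (Set.range j)) : PolishSpace X :=
  have := polishSpace_of_isGδ h
  hj.toHomeomorph.isClosedEmbedding.polishSpace

theorem polishSpace_of_range_eq_univ {X : Type u} [TopologicalSpace X] {κ : X → Code}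
    (hκ : IsEmbedding fun x => (κ x, hi (κ x))) (hr : Set.range κ = Set.univ) : PolishSpace X := by
  refine polishSpace_of_isEmbedding hκ ?_
  have : (Set.range fun x => (κ x, hi (κ x))) = {p : Code × ℝ | p.2 = hi p.1} := by
    ext ⟨c, t⟩
    constructor
    · rintro ⟨x, h⟩
      obtain ⟨rfl, rfl⟩ := Prod.ext_iff.mp h
      rfl
    · rintro (rfl : t = hi c)
      obtain ⟨x, rfl⟩ := Set.range_eq_univ.mp hr c
      exact ⟨x, rfl⟩
  exact this ▸ isGδ_eq_hi

/-- The pieces are the sets of fibres of length at least `1 / (n + 1)`. They are closed because the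
height is continuous on `X` and `lo` is lower semicontinuous. -/
theorem stronglySigmaComplete_of_isEmbedding {X : Type u} [TopologicalSpace X] {κ : X → Code}
    (hκ : IsEmbedding fun x => (κ x, hi (κ x))) (hr : Set.range κ = {c | lo c < hi c}) :
    StronglySigmaComplete X := by
  have hcl : ∀ n : ℕ, IsClosed {p : Code × ℝ | lo p.1 ≤ p.2 - 1 / ((n : ℝ) + 1)} := fun n =>
    isClosed_lo_le continuous_fst (by fun_prop)
  refine ⟨fun n => {x | lo (κ x) ≤ hi (κ x) - 1 / ((n : ℝ) + 1)}, fun n =>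
    ⟨(hcl n).preimage hκ.continuous, ?_⟩, ?_⟩
  · have : PolishSpace {x | lo (κ x) ≤ hi (κ x) - 1 / ((n : ℝ) + 1)} := by
      refine polishSpace_of_isEmbedding (hκ.comp .subtypeVal) ?_
      have : Set.range ((fun x => (κ x, hi (κ x))) ∘ (Subtype.val :
          {x | lo (κ x) ≤ hi (κ x) - 1 / ((n : ℝ) + 1)} → X)) =
          {p : Code × ℝ | p.2 = hi p.1} ∩ {p | lo p.1 ≤ p.2 - 1 / ((n : ℝ) + 1)} := by
        ext ⟨c, t⟩
        constructor
        · rintro ⟨⟨x, hx⟩, h⟩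
          obtain ⟨rfl, rfl⟩ := Prod.ext_iff.mp h
          exact ⟨rfl, hx⟩
        · rintro ⟨(rfl : t = hi c), ht : lo c ≤ hi c - 1 / ((n : ℝ) + 1)⟩
          obtain ⟨x, rfl⟩ := hr.superset (show lo c < hi c from
            ht.trans_lt (sub_lt_self _ Nat.one_div_pos_of_nat))
          exact ⟨⟨x, ht⟩, rfl⟩
      rw [this]
      exact isGδ_eq_hi.inter (hcl n).isGδ
    infer_instance
  · refine Set.eq_univ_of_forall fun x => Set.mem_iUnion.mpr ?_
    have hx : lo (κ x) < hi (κ x) := hr.subset ⟨x, rfl⟩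
    obtain ⟨n, hn⟩ := exists_nat_one_div_lt (sub_pos.mpr hx)
    exact ⟨n, show lo (κ x) ≤ hi (κ x) - 1 / ((n : ℝ) + 1) by linarith⟩

/-! ### Endpoints -/

section Endpoints

variable {X : Type u} [TopologicalSpace X] {e : X → Code × ℝ}

/-- Codes form a totally disconnected space, so an arc stays in one fibre and is traversed
monotonically; an end of the fibre can only be an end of it. Any other point is interior to the
fibre, which is itself an arc. -/
theorem endpoints_eq (he : IsEmbedding e)
    (hr : Set.range e = {p | lo p.1 ≤ p.2 ∧ p.2 ≤ hi p.1}) :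
    endpoints X = {x | (e x).2 = lo (e x).1 ∨ (e x).2 = hi (e x).1} := by
  have hfib : ∀ x, lo (e x).1 ≤ (e x).2 ∧ (e x).2 ≤ hi (e x).1 := fun x => hr.subset ⟨x, rfl⟩
  ext x
  constructor
  · intro hx
    by_contra hne
    rw [Set.mem_ofPred_eq, not_or] at hne
    obtain ⟨hlo, hhi⟩ := hne
    set c := (e x).1
    have hlt : lo c < (e x).2 := (hfib x).1.lt_of_ne' hlo
    have hgt : (e x).2 < hi c := (hfib x).2.lt_of_ne hhi
    have hpos : 0 < hi c - lo c := by linarith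
    have hmem : ∀ s : unitInterval, (c, lo c + s * (hi c - lo c)) ∈ Set.range e := fun s => by
      have h0 := mul_nonneg s.2.1 hpos.le
      have h1 := mul_le_of_le_one_left hpos.le s.2.2
      rw [hr]
      exact ⟨by simpa using h0, show lo c + s * (hi c - lo c) ≤ hi c by linarith⟩
    choose f hf using hmem
    have : T2Space X := he.t2Space
    have hcont : Continuous f := by
      rw [he.isInducing.continuous_iff]
      have : e ∘ f = fun s : unitInterval => (c, lo c + s * (hi c - lo c)) := funext hf
      rw [this]
      fun_prop
    have hinj : Function.Injective f := fun s t hst => by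
      have h := (hf s).symm.trans ((congrArg e hst).trans (hf t))
      have h2 := add_left_cancel (Prod.ext_iff.mp h).2
      exact Subtype.ext (mul_right_cancel₀ hpos.ne' h2)
    have hxf : x ∈ Set.range f := by
      refine ⟨⟨((e x).2 - lo c) / (hi c - lo c), div_nonneg (by linarith) hpos.le,
        (div_le_one hpos).mpr (by linarith)⟩, he.injective ((hf _).trans (Prod.ext rfl ?_))⟩
      change lo c + ((e x).2 - lo c) / (hi c - lo c) * (hi c - lo c) = (e x).2
      rw [div_mul_cancel₀ _ hpos.ne']
      ring
    rcases hx f (hcont.isClosedEmbedding hinj).isEmbedding hxf with h | h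
    · refine hlo ?_
      rw [h, hf]
      simp
    · refine hhi ?_
      rw [h, hf]
      simp
  · rintro hx f hf ⟨s, rfl⟩
    have hc : Continuous fun t => (e (f t)).1 :=
      continuous_fst.comp (he.continuous.comp hf.continuous)
    have hh : Continuous fun t => (e (f t)).2 :=
      continuous_snd.comp (he.continuous.comp hf.continuous)
    have hconst : ∀ t, (e (f t)).1 = (e (f s)).1 := fun t =>
      (isPreconnected_range hc).subsingleton ⟨t, rfl⟩ ⟨s, rfl⟩
    have hinj : Function.Injective fun t => (e (f t)).2 := fun t t' h =>
      hf.injective (he.injective (Prod.ext ((hconst t).trans (hconst t').symm) h))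
    have h0 := hfib (f 0)
    have h1 := hfib (f 1)
    rw [hconst] at h0 h1
    have hend : ∀ t, (e (f s)).2 = (e (f t)).2 → f s = f t := fun t h => congrArg f (hinj h)
    have hs0 : (0 : unitInterval) ≤ s := unitInterval.nonneg s
    have hs1 : s ≤ (1 : unitInterval) := unitInterval.le_one s
    rcases hh.strictMono_of_inj hinj with hm | hm
    · have h2 := hm.monotone hs0
      have h3 := hm.monotone hs1
      beta_reduce at h2 h3
      rcases hx with hx | hx
      · exact Or.inl (hend 0 (le_antisymm (by linarith) h2))
      · exact Or.inr (hend 1 (le_antisymm h3 (by linarith)))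
    · have h2 := hm.antitone hs0
      have h3 := hm.antitone hs1
      beta_reduce at h2 h3
      rcases hx with hx | hx
      · exact Or.inr (hend 1 (le_antisymm (by linarith) h3))
      · exact Or.inl (hend 0 (le_antisymm h2 (by linarith)))

theorem polishSpace_endpoints (he : IsEmbedding e)
    (hr : Set.range e = {p | lo p.1 ≤ p.2 ∧ p.2 ≤ hi p.1}) : PolishSpace (endpoints X) := by
  refine polishSpace_of_isEmbedding (he.comp .subtypeVal) ?_
  have : Set.range (e ∘ (Subtype.val : endpoints X → X)) =
      ({p | lo p.1 ≤ p.2} ∩ {p | p.2 ≤ hi p.1}) ∩ ({p | p.2 ≤ lo p.1} ∪ {p | hi p.1 ≤ p.2}) := by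
    rw [Set.range_comp, Subtype.range_coe, endpoints_eq he hr]
    ext p
    constructor
    · rintro ⟨x, hx, rfl⟩
      exact ⟨hr.subset ⟨x, rfl⟩, hx.imp le_of_eq ge_of_eq⟩
    · rintro ⟨h, h'⟩
      obtain ⟨x, rfl⟩ := hr.superset h
      exact ⟨x, h'.imp (fun h' => le_antisymm h' h.1) fun h' => le_antisymm h.2 h', rfl⟩
  rw [this]
  exact ((isClosed_lo_le continuous_fst continuous_snd).isGδ.inter
    (isClosed_le_hi continuous_fst continuous_snd).isGδ).inter (isGδ_le_lo.union isGδ_hi_le)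

/-- No clopen set of endpoints contains the top of a nondegenerate fibre and omits its bottom, by
`false_of_separated`. -/
theorem not_totallySeparatedSpace_endpoints (he : IsEmbedding e)
    (hr : Set.range e = {p | lo p.1 ≤ p.2 ∧ p.2 ≤ hi p.1}) :
    ¬ TotallySeparatedSpace (endpoints X) := by
  intro hsep
  have htop : ∀ c, ∃ x : endpoints X, e x = (c, hi c) := fun c => by
    obtain ⟨x, hx⟩ := hr.superset (show (c, hi c) ∈ _ from ⟨lo_le_hi c, le_rfl⟩)
    exact ⟨⟨x, by rw [endpoints_eq he hr]; exact Or.inr (by rw [hx])⟩, hx⟩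
  have hbot : ∀ c, ∃ x : endpoints X, e x = (c, lo c) := fun c => by
    obtain ⟨x, hx⟩ := hr.superset (show (c, lo c) ∈ _ from ⟨le_rfl, lo_le_hi c⟩)
    exact ⟨⟨x, by rw [endpoints_eq he hr]; exact Or.inl (by rw [hx])⟩, hx⟩
  have hind : IsInducing fun x : endpoints X => e x := he.isInducing.comp .subtypeVal
  obtain ⟨c, hc⟩ := exists_lo_lt_hi
  obtain ⟨x, hx⟩ := htop c
  obtain ⟨y, hy⟩ := hbot c
  have hxy : x ≠ y := by
    rintro rfl
    exact hc.ne' (Prod.ext_iff.mp (hx.symm.trans hy)).2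
  obtain ⟨C, hC, hxC, hyC⟩ := exists_isClopen_of_totally_separated hxy
  obtain ⟨U, hU, hUC⟩ := hind.isOpen_iff.mp hC.isOpen
  obtain ⟨V, hV, hVC⟩ := hind.isOpen_iff.mp hC.compl.isOpen
  have hU' : ∀ z : endpoints X, e z ∈ U ↔ z ∈ C := fun z => Set.ext_iff.mp hUC z
  have hV' : ∀ z : endpoints X, e z ∈ V ↔ z ∉ C := fun z => Set.ext_iff.mp hVC z
  refine false_of_separated (c := c) hU hV (fun d _ => ?_) (fun d _ => ?_)
    (hx ▸ (hU' x).mpr hxC) (hy ▸ (hV' y).mpr hyC)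
  · obtain ⟨z, hz⟩ := htop d
    rw [← hz, hU', hV']
    exact em _
  · obtain ⟨z, hz⟩ := htop d
    rw [← hz, hU', hV']
    exact not_not_intro

end Endpoints

/-! ### A characterization of the Baire space -/

/-- The label `w k x` names the node of a tree at depth `k` through which `x` passes. Every node has
infinitely many children, countably many labels being available, so the children can be numbered by
ℕ; the numbers along its branch are the coordinates of `x`. -/
theorem nonempty_homeomorph_nat_nat {X : Type u} {T : Type v} [TopologicalSpace X] [T0Space X]
    [Nonempty X] [Countable T] (w : ℕ → X → T) (hw₀ : ∀ x y, w 0 x = w 0 y)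
    (hloc : ∀ k x, ∀ᶠ y in 𝓝 x, w k y = w k x)
    (hnhds : ∀ x, ∀ V ∈ 𝓝 x, ∃ k, ∀ y, w k y = w k x → y ∈ V)
    (hinf : ∀ k x, {t | ∃ y, w k y = w k x ∧ w (k + 1) y = t}.Infinite)
    (hcomplete : ∀ x : ℕ → X, (∀ k, w k (x (k + 1)) = w k (x k)) → ∃ y, ∀ k, w k y = w k (x k)) :
    Nonempty (X ≃ₜ (ℕ → ℕ)) := by
  have hg : ∀ k (t : T), ∃ g : T → ℕ, (∃ x, w k x = t) →
      Set.BijOn g {s | ∃ y, w k y = t ∧ w (k + 1) y = s} Set.univ := by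
    intro k t
    by_cases h : ∃ x, w k x = t
    · obtain ⟨x, rfl⟩ := h
      have := (hinf k x).to_subtype
      obtain ⟨φ⟩ := nonempty_equiv_of_countable
        (α := {s | ∃ y, w k y = w k x ∧ w (k + 1) y = s}) (β := ℕ)
      classical
      have hval : ∀ s (hs : s ∈ {s | ∃ y, w k y = w k x ∧ w (k + 1) y = s}),
          (if hs : s ∈ {s | ∃ y, w k y = w k x ∧ w (k + 1) y = s} then φ ⟨s, hs⟩ else 0) =
            φ ⟨s, hs⟩ := fun s hs => dif_pos hs
      refine ⟨fun s => if hs : s ∈ {s | ∃ y, w k y = w k x ∧ w (k + 1) y = s}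
        then φ ⟨s, hs⟩ else 0, fun _ => ⟨fun _ _ => trivial, fun s hs s' hs' h => ?_,
          fun m _ => ?_⟩⟩
      · have h' := (hval s hs).symm.trans (h.trans (hval s' hs'))
        exact congrArg Subtype.val (φ.injective h')
      · refine ⟨(φ.symm m).1, (φ.symm m).2, (hval _ (φ.symm m).2).trans ?_⟩
        simp
    · exact ⟨fun _ => 0, fun h' => absurd h' h⟩
  choose g hg using hg
  let F : X → ℕ → ℕ := fun x k => g k (w k x) (w (k + 1) x)
  have hF : ∀ k x y, (∀ j < k, F x j = F y j) → w k x = w k y := by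
    intro k
    induction k with
    | zero => exact fun x y _ => hw₀ x y
    | succ k ih =>
      intro x y h
      have hk := ih x y fun j hj => h j (hj.trans k.lt_succ_self)
      have := h k k.lt_succ_self
      simp only [F, hk] at this
      exact (hg k (w k y) ⟨y, rfl⟩).injOn ⟨x, hk, rfl⟩ ⟨y, rfl, rfl⟩ this
  have hind : IsInducing F := by
    refine isInducing_iff_nhds.mpr fun x => le_antisymm ?_ fun V hV => ?_
    · refine Filter.map_le_iff_le_comap.mp (tendsto_pi_nhds.mpr fun k => ?_)
      refine tendsto_const_nhds.congr' ?_
      filter_upwards [hloc k x, hloc (k + 1) x] with y h1 h2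
      simp only [F, h1, h2]
    · obtain ⟨k, hk⟩ := hnhds x V hV
      refine ⟨PiNat.cylinder (F x) k, (PiNat.isOpen_cylinder _ _ _).mem_nhds
        (PiNat.self_mem_cylinder _ _), fun y hy => hk y (hF k y x hy)⟩
  have hsurj : Function.Surjective F := by
    intro β
    have hstep : ∀ k (x : X), ∃ y, w k y = w k x ∧ g k (w k x) (w (k + 1) y) = β k := by
      intro k x
      obtain ⟨_, ⟨y, hy, rfl⟩, h⟩ := (hg k (w k x) ⟨x, rfl⟩).surjOn (Set.mem_univ (β k))
      exact ⟨y, hy, h⟩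
    choose next hnext using hstep
    let x : ℕ → X := fun k => Nat.rec (Classical.arbitrary X) next k
    obtain ⟨y, hy⟩ := hcomplete x fun k => (hnext k (x k)).1
    refine ⟨y, funext fun k => ?_⟩
    simp only [F, hy]
    exact (hnext k (x k)).2
  exact ⟨(Equiv.ofBijective F ⟨hind.injective, hsurj⟩).toHomeomorphOfIsInducing hind⟩

/-! ### The codes of degenerate fibres -/

theorem exists_ivl_length_lt {c : Code} (hc : lo c = hi c) (n : ℕ) :
    ∃ m, n < m ∧ (ivl c m).2 - (ivl c m).1 < ((ivl c n).2 - (ivl c n).1) / 2 := by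
  have h := (tendsto_ivl_snd c).sub (tendsto_ivl_fst c)
  have h0 : (0 : ℝ) < ((ivl c n).2 - (ivl c n).1) / 2 := by
    have : ((ivl c n).1 : ℝ) < (ivl c n).2 := by exact_mod_cast ivl_lt c n
    linarith
  rw [hc, sub_self] at h
  obtain ⟨m, hm, hnm⟩ := ((h.eventually_lt_const h0).and (Filter.eventually_gt_atTop n)).exists
  refine ⟨m, hnm, (Rat.cast_lt (K := ℝ)).mp ?_⟩
  push_cast
  exact hm

section Halving

open scoped Classical in
/-- The first level after `n` at which the interval of `c` is less than half as long. -/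
noncomputable def halve (c : Code) (n : ℕ) : ℕ :=
  if h : ∃ m, n < m ∧ (ivl c m).2 - (ivl c m).1 < ((ivl c n).2 - (ivl c n).1) / 2 then Nat.find h
  else n + 1

theorem halve_spec {c : Code} (hc : lo c = hi c) (n : ℕ) : n < halve c n ∧
    (ivl c (halve c n)).2 - (ivl c (halve c n)).1 < ((ivl c n).2 - (ivl c n).1) / 2 := by
  rw [halve, dif_pos (exists_ivl_length_lt hc n)]
  exact Nat.find_spec (exists_ivl_length_lt hc n)

theorem halve_le {c : Code} {n m : ℕ} (hnm : n < m)
    (h : (ivl c m).2 - (ivl c m).1 < ((ivl c n).2 - (ivl c n).1) / 2) : halve c n ≤ m := by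
  rw [halve, dif_pos ⟨m, hnm, h⟩]
  exact Nat.find_min' _ ⟨hnm, h⟩

/-- Whether a level is the first to halve the interval is decided by the digits below that level. -/
theorem halve_congr {c d : Code} (hc : lo c = hi c) (hd : lo d = hi d) {n : ℕ}
    (h : d ∈ PiNat.cylinder c (halve c n)) : halve d n = halve c n := by
  have hcong : ∀ m ≤ halve c n, ivl d m = ivl c m := fun m hm =>
    ivl_congr (PiNat.cylinder_anti c hm h)
  obtain ⟨h1, h2⟩ := halve_spec hc n
  have hle : halve d n ≤ halve c n := halve_le h1 (by
    rwa [hcong _ le_rfl, hcong _ h1.le])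
  refine le_antisymm hle (halve_le (halve_spec hd n).1 ?_)
  rw [← hcong _ hle, ← hcong _ h1.le]
  exact (halve_spec hd n).2

/-- The levels obtained by iterating `halve`. -/
noncomputable def halvingLevel (c : Code) : ℕ → ℕ
  | 0 => 0
  | k + 1 => halve c (halvingLevel c k)

theorem strictMono_halvingLevel {c : Code} (hc : lo c = hi c) : StrictMono (halvingLevel c) :=
  strictMono_nat_of_lt_succ fun _ => (halve_spec hc _).1

theorem halvingLevel_congr {c d : Code} (hc : lo c = hi c) (hd : lo d = hi d) {k : ℕ}
    (h : d ∈ PiNat.cylinder c (halvingLevel c k)) : halvingLevel d k = halvingLevel c k := by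
  induction k with
  | zero => rfl
  | succ k ih =>
    have hk := ih (PiNat.cylinder_anti c (strictMono_halvingLevel hc k.lt_succ_self).le h)
    rw [halvingLevel, hk]
    exact halve_congr hc hd h

theorem ivl_halvingLevel_lt {c : Code} (hc : lo c = hi c) (k : ℕ) :
    (ivl c (halvingLevel c k)).2 - (ivl c (halvingLevel c k)).1 ≤
      ((ivl c 0).2 - (ivl c 0).1) * (1 / 2) ^ k := by
  induction k with
  | zero => simp [halvingLevel]
  | succ k ih =>
    refine (halve_spec hc (halvingLevel c k)).2.le.trans ?_
    rw [pow_succ]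
    linarith

/-- The finite initial segments, of all lengths. -/
abbrev Segment : Type := Set.range fun p : Code × ℕ => (trunc p.1 p.2, p.2)

instance : Countable Segment := by
  have : (Set.range fun p : Code × ℕ => (trunc p.1 p.2, p.2)) ⊆
      ⋃ n, (Set.range fun c => trunc c n) ×ˢ {n} := by
    rintro _ ⟨⟨c, n⟩, rfl⟩
    exact Set.mem_iUnion.mpr ⟨n, ⟨c, rfl⟩, rfl⟩
  exact ((Set.countable_iUnion fun n =>
    ((finite_range_trunc n).prod (Set.finite_singleton n)).countable).mono this).to_subtype

/-- The initial segment of `c` of length `halvingLevel c k`. -/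
noncomputable def halvingSegment (k : ℕ) (c : {c : Code // lo c = hi c}) : Segment :=
  ⟨_, (c.1, halvingLevel c.1 k), rfl⟩

theorem halvingSegment_eq_iff {k : ℕ} {c d : {c : Code // lo c = hi c}} :
    halvingSegment k d = halvingSegment k c ↔ d.1 ∈ PiNat.cylinder c.1 (halvingLevel c.1 k) := by
  rw [Subtype.ext_iff]
  change (trunc d.1 (halvingLevel d.1 k), halvingLevel d.1 k) =
    (trunc c.1 (halvingLevel c.1 k), halvingLevel c.1 k) ↔ _
  rw [Prod.mk.injEq]
  constructor
  · rintro ⟨h1, h2⟩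
    rw [h2] at h1
    exact mem_cylinder_trunc.mpr h1
  · intro h
    rw [halvingLevel_congr c.2 d.2 h]
    exact ⟨mem_cylinder_trunc.mp h, rfl⟩

/-- Were there finitely many successors, their cylinders would form a closed set containing the
degenerate codes of the cylinder of `c`, which are dense there, and hence also its center. But the
interval of the center is never shortened again, so no halving occurs along its digits. -/
theorem infinite_halvingSegment (k : ℕ) (c : {c : Code // lo c = hi c}) :
    {t | ∃ d, halvingSegment k d = halvingSegment k c ∧ halvingSegment (k + 1) d = t}.Infinite := by
  intro hfin
  set n := halvingLevel c.1 k with hn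
  let S : {c : Code // lo c = hi c} → Set Code := fun d =>
    PiNat.cylinder d.1 (halvingLevel d.1 (k + 1))
  have hS : (S '' {d | halvingSegment k d = halvingSegment k c}).Finite := by
    have : Nonempty {c : Code // lo c = hi c} := ⟨c⟩
    choose! r hr using fun t (ht : ∃ d, halvingSegment k d = halvingSegment k c ∧
      halvingSegment (k + 1) d = t) => ht
    refine (hfin.image fun t => S (r t)).subset ?_
    rintro _ ⟨d, hd, rfl⟩
    refine ⟨_, ⟨d, hd, rfl⟩, ?_⟩
    have := (hr _ ⟨d, hd, rfl⟩).2
    rw [halvingSegment_eq_iff] at this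
    change PiNat.cylinder _ _ = PiNat.cylinder _ _
    rw [halvingLevel_congr d.2 (r _).2 this]
    exact PiNat.mem_cylinder_iff_eq.mp this
  have hcl : IsClosed (⋃₀ (S '' {d | halvingSegment k d = halvingSegment k c})) := by
    rw [Set.sUnion_eq_biUnion]
    refine hS.isClosed_biUnion ?_
    rintro _ ⟨d, -, rfl⟩
    exact (isClopen_cylinder _ _).isClosed
  have hmem : trunc c.1 n ∈ ⋃₀ (S '' {d | halvingSegment k d = halvingSegment k c}) := by
    by_contra hnot
    obtain ⟨d, ⟨hd1, hd2⟩, hd⟩ := dense_lo_eq_hi.inter_open_nonempty _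
      ((isClopen_cylinder c.1 n).isOpen.inter hcl.isOpen_compl)
      ⟨_, trunc_mem_cylinder c.1 n, hnot⟩
    exact hd2 ⟨_, ⟨⟨d, hd⟩, halvingSegment_eq_iff.mpr hd1, rfl⟩, PiNat.self_mem_cylinder _ _⟩
  obtain ⟨_, ⟨d, hd, rfl⟩, hmem⟩ := hmem
  have hd' := halvingSegment_eq_iff.mp hd
  have hnd : halvingLevel d.1 k = n := halvingLevel_congr c.2 d.2 hd'
  obtain ⟨h1, h2⟩ := halve_spec d.2 n
  have hS' : S d = PiNat.cylinder d.1 (halve d.1 n) := by rw [← hnd]; rfl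
  rw [hS'] at hmem
  have h3 := ivl_eq_of_le (ivl_trunc c.1 n) (lo_trunc c.1 n) (hi_trunc c.1 n) h1.le
  rw [ivl_congr hmem] at h3
  rw [h3, ivl_congr hd'] at h2
  have := ivl_lt c.1 n
  dsimp only at h2
  linarith

theorem nonempty_homeomorph_lo_eq_hi : Nonempty ({c : Code // lo c = hi c} ≃ₜ (ℕ → ℕ)) := by
  have : Nonempty {c : Code // lo c = hi c} := dense_lo_eq_hi.nonempty.to_subtype
  refine nonempty_homeomorph_nat_nat halvingSegment (fun c d => ?_)
    (fun k c => ?_) (fun c V hV => ?_) infinite_halvingSegment fun x hx => ?_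
  · exact halvingSegment_eq_iff.mpr fun i hi => absurd hi (Nat.not_lt_zero i)
  · filter_upwards [((isClopen_cylinder c.1 (halvingLevel c.1 k)).isOpen.preimage
      continuous_subtype_val).mem_nhds (PiNat.self_mem_cylinder _ _)] with d hd
    exact halvingSegment_eq_iff.mpr hd
  · obtain ⟨W, hW, hWV⟩ := mem_nhds_induced _ _ _ |>.mp hV
    obtain ⟨n, hn⟩ := exists_cylinder_subset hW
    exact ⟨n, fun d hd => hWV (hn (PiNat.cylinder_anti _
      (strictMono_halvingLevel c.2).le_apply (halvingSegment_eq_iff.mp hd)))⟩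
  · have hx' : ∀ k, (x (k + 1)).1 ∈ PiNat.cylinder (x k).1 (halvingLevel (x k).1 k) := fun k =>
      halvingSegment_eq_iff.mp (hx k)
    have hlev : ∀ k, halvingLevel (x (k + 1)).1 k = halvingLevel (x k).1 k := fun k =>
      halvingLevel_congr (x k).2 (x (k + 1)).2 (hx' k)
    have hmono : StrictMono fun k => halvingLevel (x k).1 k := strictMono_nat_of_lt_succ fun k => by
      rw [← hlev k]
      exact strictMono_halvingLevel (x (k + 1)).2 k.lt_succ_self
    have hnest : ∀ i j, i ≤ j → (x j).1 ∈ PiNat.cylinder (x i).1 (halvingLevel (x i).1 i) := by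
      intro i j hij
      induction j, hij using Nat.le_induction with
      | base => exact PiNat.self_mem_cylinder _ _
      | succ j hij ih =>
        rw [← PiNat.mem_cylinder_iff_eq.mp ih]
        exact PiNat.cylinder_anti _ (hmono.monotone hij) (hx' j)
    let y : Code := fun i => (x (i + 1)).1 i
    have hy : ∀ i, y ∈ PiNat.cylinder (x i).1 (halvingLevel (x i).1 i) := by
      intro i l hl
      rcases le_total i (l + 1) with h | h
      · exact hnest i (l + 1) h l hl
      · exact (hnest (l + 1) i h l (l.lt_succ_self.trans_le hmono.le_apply)).symm
    -- The k-th chosen interval has length at most `(1 / 2) ^ k` times that of the initial one, so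
    -- the limit code is degenerate. This is the completeness of the tree of halvings.
    have hdeg : lo y = hi y := by
      have h0 := ((tendsto_ivl_snd y).sub (tendsto_ivl_fst y)).comp hmono.tendsto_atTop
      have h1 : Filter.Tendsto (fun k : ℕ => (((ivl y 0).2 - (ivl y 0).1 : ℚ) : ℝ) * (1 / 2) ^ k)
          Filter.atTop (𝓝 0) := by
        simpa using (tendsto_pow_atTop_nhds_zero_of_lt_one (r := (1 / 2 : ℝ)) (by norm_num)
          (by norm_num)).const_mul (((ivl y 0).2 - (ivl y 0).1 : ℚ) : ℝ)
      have := le_of_tendsto_of_tendsto' h0 h1 fun k => by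
        have h2 := ivl_halvingLevel_lt (x k).2 k
        rw [← ivl_congr (hy k), ← ivl_congr (c := (x k).1) (d := y) (n := 0)
          fun i hi => absurd hi (Nat.not_lt_zero i)] at h2
        have h3 := (Rat.cast_le (K := ℝ)).mpr h2
        push_cast at h3 ⊢
        exact h3
      linarith [lo_le_hi y]
    exact ⟨⟨y, hdeg⟩, fun k => halvingSegment_eq_iff.mpr (hy k)⟩

end Halving

/-! ### The Fraïssé fence as a space of fibres -/

/-- Where `lo` and `hi` agree, their common value is both lower and upper semicontinuous. The graph
topology on degenerate codes is therefore the usual one. -/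
theorem continuous_hi_of_lo_eq_hi : Continuous fun d : {c : Code // lo c = hi c} => hi d.1 := by
  refine OrderTopology.continuous_iff.mpr fun a => ⟨?_, ?_⟩
  · have : (fun d : {c : Code // lo c = hi c} => hi d.1) ⁻¹' Set.Ioi a = {d | lo d.1 ≤ a}ᶜ := by
      ext d
      rw [Set.mem_preimage, Set.mem_Ioi, ← d.2, ← not_le]
      rfl
    rw [this]
    exact (isClosed_lo_le continuous_subtype_val continuous_const).isOpen_compl
  · have : (fun d : {c : Code // lo c = hi c} => hi d.1) ⁻¹' Set.Iio a = {d | a ≤ hi d.1}ᶜ := by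
      ext d
      rw [Set.mem_preimage, Set.mem_Iio, ← not_le]
      rfl
    rw [this]
    exact (isClosed_le_hi continuous_subtype_val continuous_const).isOpen_compl

theorem nonempty_homeomorph_of_range_eq {X : Type u} [TopologicalSpace X] {κ : X → Code}
    (hκ : IsEmbedding fun x => (κ x, hi (κ x))) (hr : Set.range κ = {c | lo c = hi c}) :
    Nonempty (X ≃ₜ (ℕ → ℕ)) := by
  obtain ⟨f⟩ := nonempty_homeomorph_lo_eq_hi
  let g : X → {c : Code // lo c = hi c} := fun x => ⟨κ x, hr.subset ⟨x, rfl⟩⟩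
  have hg : IsInducing g := .of_comp ((continuous_code hκ).subtype_mk _)
    (continuous_subtype_val.prodMk continuous_hi_of_lo_eq_hi) hκ.isInducing
  have hbij : Function.Bijective g := by
    refine ⟨fun x y h => hκ.injective ?_, fun d => ?_⟩
    · have h' : κ x = κ y := congrArg Subtype.val h
      simp only [h']
    · obtain ⟨x, hx⟩ := hr.superset d.2
      exact ⟨x, Subtype.ext hx⟩
  exact ⟨((Equiv.ofBijective g hbij).toHomeomorphOfIsInducing hg).trans f⟩

namespace IsProjectiveFraisseLimit

variable {F : TopStructure.{u}}

theorem exists_isEmbedding_quo (hF : IsProjectiveFraisseLimit IsFiniteHForest.{0} F) :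
    ∃ e : F.Quo → Code × ℝ, IsEmbedding e ∧ Set.range e = {p | lo p.1 ≤ p.2 ∧ p.2 ≤ hi p.1} ∧
    ∀ x y, F.quoLE x y ↔ (e x).1 = (e y).1 ∧ (e x).2 ≤ (e y).2 := by
  obtain ⟨π, hπ, hr, hR, hle, hle'⟩ := hF.exists_projection
  let e : F.Quo → Code × ℝ := Quot.lift π fun x y h => (hR x y).mp h
  have hinj : Function.Injective e := by
    rintro ⟨x⟩ ⟨y⟩ h
    exact Quot.sound ((hR x y).mpr h)
  have hfib : ∀ x, e x ∈ {p : Code × ℝ | lo p.1 ≤ p.2 ∧ p.2 ≤ hi p.1} := by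
    rintro ⟨x⟩
    exact hr.subset ⟨x, rfl⟩
  refine ⟨e, ((continuous_quot_lift _ hπ).isClosedEmbedding hinj).isEmbedding, ?_,
    fun x y => ⟨?_, ?_⟩⟩
  · refine subset_antisymm (Set.range_subset_iff.mpr hfib) fun p hp => ?_
    obtain ⟨x, rfl⟩ := hr.superset hp
    exact ⟨Quot.mk _ x, rfl⟩
  · rintro ⟨a, b, rfl, rfl, h⟩
    exact hle a b h
  · rintro ⟨h1, h2⟩
    obtain ⟨a, b, ha, hb, hab⟩ := hle' (e x) (e y) (hfib x).1 (hfib y).2 h1 h2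
    exact ⟨a, b, hinj ha, hinj hb, hab⟩

theorem equivalence_R (hF : IsProjectiveFraisseLimit IsFiniteHForest.{0} F) :
    Equivalence F.R := by
  obtain ⟨π, -, -, hR, -⟩ := hF.exists_projection
  simp only [funext fun x => funext fun y => propext (hR x y)]
  exact ⟨fun _ => rfl, fun h => h.symm, fun h h' => h.trans h'⟩

theorem isPartialOrder_quoLE (hF : IsProjectiveFraisseLimit IsFiniteHForest.{0} F) :
    IsPartialOrder F.Quo F.quoLE := by
  obtain ⟨e, he, -, hle⟩ := hF.exists_isEmbedding_quo
  simp only [funext fun x => funext fun y => propext (hle x y)]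
  exact {
    refl := fun _ => ⟨rfl, le_rfl⟩
    trans := fun _ _ _ h h' => ⟨h.1.trans h'.1, h.2.trans h'.2⟩
    antisymm := fun _ _ h h' => he.injective (Prod.ext h.1 (h.2.antisymm h'.2)) }

end IsProjectiveFraisseLimit

section Fence

variable {F : TopStructure.{u}} {e : F.Quo → Code × ℝ}

theorem lower_eq (he : Function.Injective e)
    (hr : Set.range e = {p | lo p.1 ≤ p.2 ∧ p.2 ≤ hi p.1})
    (hle : ∀ x y, F.quoLE x y ↔ (e x).1 = (e y).1 ∧ (e x).2 ≤ (e y).2) :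
    F.lower = {x | (e x).2 = lo (e x).1} := by
  ext x
  have hx : lo (e x).1 ≤ (e x).2 := (hr.subset ⟨x, rfl⟩).1
  constructor
  · intro h
    obtain ⟨y, hy⟩ := hr.superset (show ((e x).1, lo (e x).1) ∈ _ from ⟨le_rfl, lo_le_hi _⟩)
    have hyx := h y ((hle y x).mpr (by rw [hy]; exact ⟨rfl, hx⟩))
    rw [hyx] at hy
    exact congrArg Prod.snd hy
  · intro h y hyx
    obtain ⟨h1, h2⟩ := (hle y x).mp hyx
    have hy : lo (e y).1 ≤ (e y).2 := (hr.subset ⟨y, rfl⟩).1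
    rw [h1] at hy
    exact he (Prod.ext h1 (le_antisymm h2 (le_of_eq_of_le h hy)))

theorem upper_eq (he : Function.Injective e)
    (hr : Set.range e = {p | lo p.1 ≤ p.2 ∧ p.2 ≤ hi p.1})
    (hle : ∀ x y, F.quoLE x y ↔ (e x).1 = (e y).1 ∧ (e x).2 ≤ (e y).2) :
    F.upper = {x | (e x).2 = hi (e x).1} := by
  ext x
  have hx : (e x).2 ≤ hi (e x).1 := (hr.subset ⟨x, rfl⟩).2
  constructor
  · intro h
    obtain ⟨y, hy⟩ := hr.superset (show ((e x).1, hi (e x).1) ∈ _ from ⟨lo_le_hi _, le_rfl⟩)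
    have hxy := h y ((hle x y).mpr (by rw [hy]; exact ⟨rfl, hx⟩))
    rw [hxy] at hy
    exact congrArg Prod.snd hy
  · intro h y hxy
    obtain ⟨h1, h2⟩ := (hle x y).mp hxy
    have hy : (e y).2 ≤ hi (e y).1 := (hr.subset ⟨y, rfl⟩).2
    rw [← h1] at hy
    exact he (Prod.ext h1.symm (le_antisymm (hy.trans_eq h.symm) h2))

/-- This treats 𝔏 ∩ 𝔘, 𝔘 and 𝔐 uniformly: each consists of the tops of the fibres over a set `K` of
codes, namely the degenerate ones, all of them, and the nondegenerate ones. -/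
theorem isEmbedding_and_range_eq (he : IsEmbedding e)
    (hr : Set.range e = {p | lo p.1 ≤ p.2 ∧ p.2 ≤ hi p.1}) {S : Set F.Quo} {K : Set Code}
    (hS : ∀ x, x ∈ S ↔ (e x).2 = hi (e x).1 ∧ (e x).1 ∈ K) :
    IsEmbedding (fun x : S => ((e x).1, hi (e x).1)) ∧
      Set.range (fun x : S => (e x).1) = K := by
  constructor
  · have : (fun x : S => ((e x).1, hi (e x).1)) = e ∘ Subtype.val :=
      funext fun x => Prod.ext rfl ((hS x).mp x.2).1.symm
    rw [this]
    exact he.comp .subtypeVal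
  · ext c
    constructor
    · rintro ⟨x, rfl⟩
      exact ((hS x).mp x.2).2
    · intro hc
      obtain ⟨x, hx⟩ := hr.superset (show (c, hi c) ∈ _ from ⟨lo_le_hi _, le_rfl⟩)
      exact ⟨⟨x, (hS x).mpr (by rw [hx]; exact ⟨rfl, hc⟩)⟩, congrArg Prod.fst hx⟩

end Fence

end FraisseFence

/-! ### The main theorem -/

theorem mainTheorem9 :
    -- the finite Hasse forests have a projective Fraïssé limit
    (∃ 𝔽 : FraisseFence.TopStructure.{0},
      FraisseFence.IsProjectiveFraisseLimit FraisseFence.IsFiniteHForest.{0} 𝔽) ∧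
    ∀ 𝔽 : FraisseFence.TopStructure.{u},
      FraisseFence.IsProjectiveFraisseLimit FraisseFence.IsFiniteHForest.{0} 𝔽 →
      -- `R` is an equivalence relation, and the induced relation on the quotient is an order
      Equivalence 𝔽.R ∧
      IsPartialOrder 𝔽.Quo 𝔽.quoLE ∧
      -- (i)
      Nonempty (↥(𝔽.lower ∩ 𝔽.upper) ≃ₜ (ℕ → ℕ)) ∧
      -- (ii)
      (PolishSpace (FraisseFence.endpoints 𝔽.Quo) ∧
        ¬ TotallySeparatedSpace (FraisseFence.endpoints 𝔽.Quo)) ∧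
      -- (iii)
      (FraisseFence.OneOverHomogeneous 𝔽.upper 2 ∧
        PolishSpace 𝔽.upper ∧
        FraisseFence.AlmostZeroDimensional 𝔽.upper ∧
        smallInductiveDimension 𝔽.upper = 1 ∧
        ¬ FraisseFence.Cohesive 𝔽.upper) ∧
      -- (iv)
      (FraisseFence.Homogeneous ↥(𝔽.upper \ 𝔽.lower) ∧
        FraisseFence.StronglySigmaComplete ↥(𝔽.upper \ 𝔽.lower) ∧
        FraisseFence.AlmostZeroDimensional ↥(𝔽.upper \ 𝔽.lower) ∧
        smallInductiveDimension ↥(𝔽.upper \ 𝔽.lower) = 1 ∧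
        ¬ FraisseFence.Cohesive ↥(𝔽.upper \ 𝔽.lower)) := by
  refine ⟨⟨_, FraisseFence.isProjectiveFraisseLimit_prefence⟩, fun 𝔽 hF => ?_⟩
  obtain ⟨e, he, hr, hle⟩ := hF.exists_isEmbedding_quo
  have hL := FraisseFence.lower_eq he.injective hr hle
  have hU := FraisseFence.upper_eq he.injective hr hle
  obtain ⟨hLU, hLUr⟩ := FraisseFence.isEmbedding_and_range_eq he hr (S := 𝔽.lower ∩ 𝔽.upper)
    (K := {c | FraisseFence.lo c = FraisseFence.hi c}) fun x => by
      rw [hL, hU]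
      exact ⟨fun h => ⟨h.2, h.1.symm.trans h.2⟩, fun h => ⟨h.1.trans h.2.symm, h.1⟩⟩
  obtain ⟨hκ, hκr⟩ := FraisseFence.isEmbedding_and_range_eq he hr (S := 𝔽.upper)
    (K := Set.univ) fun x => by
      rw [hU]
      exact ⟨fun h => ⟨h, trivial⟩, fun h => h.1⟩
  obtain ⟨hM, hMr⟩ := FraisseFence.isEmbedding_and_range_eq he hr (S := 𝔽.upper \ 𝔽.lower)
    (K := {c | FraisseFence.lo c < FraisseFence.hi c}) fun x => by
      rw [hL, hU]
      exact ⟨fun h => ⟨h.1, (FraisseFence.lo_le_hi _).lt_of_ne fun h' => h.2 (h.1.trans h'.symm)⟩,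
        fun h => ⟨h.1, fun h' => h.2.ne (h'.symm.trans h.1)⟩⟩
  have hκM := fun c (_ : FraisseFence.lo c < FraisseFence.hi c) => hκr.superset (Set.mem_univ c)
  have hMM := fun c (hc : FraisseFence.lo c < FraisseFence.hi c) => hMr.superset hc
  exact ⟨hF.equivalence_R, hF.isPartialOrder_quoLE,
    FraisseFence.nonempty_homeomorph_of_range_eq hLU hLUr,
    ⟨FraisseFence.polishSpace_endpoints he hr,
      FraisseFence.not_totallySeparatedSpace_endpoints he hr⟩,
    ⟨FraisseFence.oneOverHomogeneous_two_of_isEmbedding hκ hκr,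
      FraisseFence.polishSpace_of_range_eq_univ hκ hκr,
      FraisseFence.almostZeroDimensional_of_isEmbedding hκ,
      FraisseFence.smallInductiveDimension_eq_one hκ hκM,
      FraisseFence.not_cohesive_of_isEmbedding hκ hκM⟩,
    FraisseFence.homogeneous_of_isEmbedding hM hMr,
    FraisseFence.stronglySigmaComplete_of_isEmbedding hM hMr,
    FraisseFence.almostZeroDimensional_of_isEmbedding hM,
    FraisseFence.smallInductiveDimension_eq_one hM hMM,
    FraisseFence.not_cohesive_of_isEmbedding hM hMM⟩
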